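/- Let $k$ be an algebraically closed field of characteristic zero and $n\ge 1$. Varieties are separated reduced schemes of finite type over $k$; $\times$ is the product over $k$. For a $k$-variety $S$ and a finite abelian group $\Gamma$, $K_0(\mathrm{Var}_S^{\Gamma})$ is the abelian group generated by the isomorphism classes $[X\to S]$ of $S$-varieties with a good $\Gamma$-action over $S$ (every orbit lies in an affine open subset), modulo $[X]=[X\setminus Y]+[Y]$ for closed reduced $\Gamma$-stable $Y\subset X$, and $[Y\times\mathbb A^r,\sigma]=[Y\times\mathbb A^r,\sigma']$ whenever $\sigma,\sigma'$ are two liftings of the same action on $Y$ that are affine on the fibres. Write $\mu_n=\mu_n(k)$, and $K_0(\mathrm{Var}_S)$ for the case $\Gamma=1$. $K_0(\mathrm{Var}_k)$ is a commutative ring under $[R][R']=[R\times R']$, and $[R].[X\to S]=[R\times X\to S]$ makes $K_0(\mathrm{Var}_S^{\Gamma})$ a module over it. For a variety $p\colon Z\to\mathbb A^1$ with good right $\mu_n\times\mu_n$-action and $c\in\{0,1\}$ let $Z_c=(Z\times^{\mu_n\times\mu_n}\mathbb G_m\times\mathbb G_m)|_{x^n+y^n=c}$ be the quotient of $Z\times\{(x,y)\in\mathbb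 G_m^2: x^n+y^n=c\}$ by the action $(z,x,y).(s,t)=(z.(s,t),s^{-1}x,t^{-1}y)$, with the map $[z,x,y]\mapsto p(z)$ to $\mathbb A^1$ and the $\mu_n$-action $[z,x,y].t=[z,tx,ty]$. These quotients exist as $\mathbb A^1$-varieties with good $\mu_n$-action, and there is a unique $K_0(\mathrm{Var}_k)$-linear map $\Psi\colon K_0(\mathrm{Var}_{\mathbb A^1}^{\mu_n\times\mu_n})\to K_0(\mathrm{Var}_{\mathbb A^1}^{\mu_n})$ with $\Psi([Z])=-[Z_1]+[Z_0]$ for all $Z$. Let $\star$ be the $K_0(\mathrm{Var}_k)$-bilinear composition $$K_0(\mathrm{Var}_{\mathbb A^1}^{\mu_n})\times K_0(\mathrm{Var}_{\mathbb A^1}^{\mu_n})\xrightarrow{\times}K_0(\mathrm{Var}_{\mathbb A^1\times\mathbb A^1}^{\mu_n\times\mu_n})\xrightarrow{\mathrm{add}_!}K_0(\mathrm{Var}_{\mathbb A^1}^{\mu_n\times\mu_n})\xrightarrow{\Psi}K_0(\mathrm{Var}_{\mathbb A^1}^{\mu_n}),$$ where $\mathrm{add}\colon\mathbb A^1\times\mathbb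 A^1\to\mathbb A^1$ is the addition and $\mathrm{add}_!$ is composition with it. Then $\star$ turns $K_0(\mathrm{Var}_{\mathbb A^1}^{\mu_n})$ into an associative commutative $K_0(\mathrm{Var}_k)$-algebra with identity element $[\operatorname{Spec}k\xrightarrow{0}\mathbb A^1]$ (trivial action). For $V\colon X\to\mathbb A^1$ and $W\colon Y\to\mathbb A^1$ with trivial $\mu_n$-actions, $$[X\xrightarrow{V}\mathbb A^1]\star[Y\xrightarrow{W}\mathbb A^1]=[X\times Y\xrightarrow{V\circledast W}\mathbb A^1],\qquad (V\circledast W)(x,y)=V(x)+W(y),$$ with the trivial action on $X\times Y$. For $n=1$ the map $K_0(\mathrm{Var}_{\mathbb A^1})\to K_0(\mathrm{Var}_{\mathbb A^1}^{\mu_1})$ that adds the trivial action is bijective, so this formula describes $\star$ on $K_0(\mathrm{Var}_{\mathbb A^1})$. -/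

import Mathlib

open CategoryTheory Limits MonoidalCategory CartesianMonoidalCategory AlgebraicGeometry

universe u v w

namespace MotConv

noncomputable section

/-! ### Products of varieties are reduced -/

open TensorProduct in
theorem isReduced_tensor {k A B : Type*} [Field k] [IsAlgClosed k] [CommRing A] [Algebra k A]
    [CommRing B] [Algebra k B] [Algebra.FiniteType k B] [_root_.IsReduced A] [_root_.IsReduced B] :
    _root_.IsReduced (TensorProduct k B A) := by
  refine ⟨fun z hz => ?_⟩
  let b := Module.Basis.ofVectorSpace k A
  have key (φ : B →ₐ[k] k) (i) : φ ((b.baseChange B).repr z i) = 0 := by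
    let F : TensorProduct k B A →ₐ[k] A :=
      Algebra.TensorProduct.lift ((Algebra.ofId k A).comp φ) (AlgHom.id k A)
        (fun _ _ => Commute.all _ _)
    have h1 : F z = 0 := (hz.map F).eq_zero
    have h2 : ∀ w, b.repr (F w) i = φ ((b.baseChange B).repr w i) := by
      intro w
      induction w with
      | zero => simp
      | tmul x y => 
        have : F (x ⊗ₜ y) = φ x • y := by
          simp [F, Algebra.ofId_apply, Algebra.smul_def]
        simp [this, mul_comm]
      | add x y hx hy => simp [hx, hy]
    rw [← h2, h1]; simp
  have hJ : IsJacobsonRing B := isJacobsonRing_of_finiteType (A := k)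
  have hzero (c : B) (hc : ∀ φ : B →ₐ[k] k, φ c = 0) : c = 0 := by
    have : c ∈ (⊥ : Ideal B).jacobson := by
      rw [Ideal.jacobson, Ideal.mem_sInf]
      rintro m ⟨-, hm⟩
      let _ : Field (B ⧸ m) := Ideal.Quotient.field m
      have : Module.Finite k (B ⧸ m) := finite_of_finite_type_of_isJacobsonRing k (B ⧸ m)
      let e : k ≃ₐ[k] (B ⧸ m) := AlgEquiv.ofBijective (Algebra.ofId k (B ⧸ m))
        IsAlgClosed.algebraMap_bijective_of_isIntegral
      have := hc (e.symm.toAlgHom.comp (Ideal.Quotient.mkₐ k m))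
      rw [← Ideal.Quotient.eq_zero_iff_mem]
      exact e.symm.injective (by simpa using this)
    rwa [hJ.out (Ideal.isRadical_iff_quotient_reduced _ |>.2
      (isReduced_of_injective (RingEquiv.quotientBot B) (RingEquiv.injective _)))] at this
  apply (b.baseChange B).repr.injective
  ext i
  simpa using hzero _ fun φ => key φ i

theorem isReduced_pullback_Spec {k : Type u} [Field k] [IsAlgClosed k] {R S : CommRingCat.{u}}
    (f : Spec R ⟶ Spec (.of k)) (g : Spec S ⟶ Spec (.of k)) [hR : IsReduced (Spec R)]
    [hS : IsReduced (Spec S)] [hf : LocallyOfFiniteType f] : IsReduced (pullback f g) := by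
  obtain ⟨φ, rfl⟩ := Spec.map_surjective f
  obtain ⟨ψ, rfl⟩ := Spec.map_surjective g
  let _ : Algebra k R := φ.hom.toAlgebra
  let _ : Algebra k S := ψ.hom.toAlgebra
  have h1 := (affine_isReduced_iff R).1 hR
  have h2 := (affine_isReduced_iff S).1 hS
  have h3 : Algebra.FiniteType k R :=
    (HasRingHomProperty.Spec_iff (P := @LocallyOfFiniteType)).1 hf
  have := isReduced_tensor (k := k) (A := S) (B := R)
  exact isReduced_of_isOpenImmersion (pullbackSpecIso k R S).hom

theorem isReduced_pullback {k : Type u} [Field k] [IsAlgClosed k] {X Y : Scheme.{u}}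
    (f : X ⟶ Spec (.of k)) (g : Y ⟶ Spec (.of k)) [IsReduced X] [IsReduced Y]
    [LocallyOfFiniteType f] : IsReduced (pullback f g) := by
  rw [IsReduced.iff_of_openCover _ (Scheme.Pullback.openCoverOfLeftRight
    X.affineOpenCover.openCover Y.affineOpenCover.openCover f g)]
  rintro ⟨i, j⟩
  have h1 : IsReduced (X.affineOpenCover.openCover.X i) := inferInstance
  have h2 : IsReduced (Y.affineOpenCover.openCover.X j) := inferInstance
  have h3 : LocallyOfFiniteType (X.affineOpenCover.openCover.f i ≫ f) := inferInstance
  exact isReduced_pullback_Spec (hR := h1) (hS := h2) (hf := h3) (X.affineOpenCover.f i ≫ f)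
    (Y.affineOpenCover.f j ≫ g)

/-! ### Varieties with good action -/

/-- Schemes over `k`.  The monoidal structure `⊗` of this category is the fibre product over
`Spec k`, with unit `𝟙_ = Spec k`. -/
abbrev Sch (k : Type u) [Field k] := Over (Spec (CommRingCat.of k))

/-- A `k`-variety: a separated reduced scheme of finite type over `k`. -/
class IsVariety {k : Type u} [Field k] (X : Sch k) : Prop where
  reduced : IsReduced X.left
  separated : IsSeparated X.hom
  locallyOfFiniteType : LocallyOfFiniteType X.hom
  quasiCompact : QuasiCompact X.hom

/-- An `S`-variety `p : X ⟶ S` with a good right action of the (finite, constant) group `Γ` on `X`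
over `S`: every `Γ`-orbit is contained in an affine open subset of `X`. -/
structure EqVar {k : Type u} [Field k] (S : Sch k) (Γ : Type v) [Group Γ] where
  X : Sch k
  isVariety : IsVariety X
  p : X ⟶ S
  act : Γ → (X ⟶ X)
  act_one : act 1 = 𝟙 X
  act_mul : ∀ g h, act (g * h) = act g ≫ act h
  act_p : ∀ g, act g ≫ p = p
  good : ∀ x : X.left, ∃ U : X.left.Opens, IsAffineOpen U ∧ ∀ g, (act g).left x ∈ U

instance {k : Type u} [Field k] : IsVariety (𝟙_ (Sch k)) where
  reduced := inferInstanceAs (IsReduced (Spec (CommRingCat.of k)))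
  separated := inferInstanceAs (IsSeparated (𝟙 (Spec (CommRingCat.of k))))
  locallyOfFiniteType := inferInstanceAs (LocallyOfFiniteType (𝟙 (Spec (CommRingCat.of k))))
  quasiCompact := inferInstanceAs (QuasiCompact (𝟙 (Spec (CommRingCat.of k))))

theorem IsVariety.tensor {k : Type u} [Field k] [IsAlgClosed k] {X Y : Sch k} (hX : IsVariety X)
    (hY : IsVariety Y) : IsVariety (X ⊗ Y) := by
  obtain ⟨_, _, _, _⟩ := hX
  obtain ⟨_, _, _, _⟩ := hY
  refine ⟨?_, ?_, ?_, ?_⟩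
  · exact isReduced_pullback X.hom Y.hom
  · exact inferInstanceAs (IsSeparated (pullback.fst X.hom Y.hom ≫ X.hom))
  · exact inferInstanceAs (LocallyOfFiniteType (pullback.fst X.hom Y.hom ≫ X.hom))
  · exact inferInstanceAs (QuasiCompact (pullback.fst X.hom Y.hom ≫ X.hom))

namespace EqVar

variable {k : Type u} [Field k] {S T : Sch k} {Γ : Type v} [Group Γ] {Δ : Type w} [Group Δ]

/-- An `S`-variety with the trivial action. -/
abbrev triv (Γ : Type v) [Group Γ] (X : Sch k) (hX : IsVariety X) (p : X ⟶ S) : EqVar S Γ where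
  X := X
  isVariety := hX
  p := p
  act _ := 𝟙 X
  act_one := rfl
  act_mul _ _ := (Category.comp_id _).symm
  act_p _ := Category.id_comp _
  good x := by
    obtain ⟨_, ⟨U, hU, rfl⟩, hxU, -⟩ :=
      X.left.isBasis_affineOpens.exists_subset_of_mem_open (Set.mem_univ x) isOpen_univ
    exact ⟨U, hU, fun _ => by simpa using hxU⟩

/-- Composition of the structure morphism with `f : S ⟶ T`. -/
abbrev push (f : S ⟶ T) (A : EqVar S Γ) : EqVar T Γ where
  X := A.X
  isVariety := A.isVariety
  p := A.p ≫ f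
  act := A.act
  act_one := A.act_one
  act_mul := A.act_mul
  act_p g := by rw [← Category.assoc, A.act_p]
  good := A.good

/-- Restriction of the action along a group morphism. -/
abbrev res (φ : Δ →* Γ) (A : EqVar S Γ) : EqVar S Δ where
  X := A.X
  isVariety := A.isVariety
  p := A.p
  act g := A.act (φ g)
  act_one := by rw [map_one, A.act_one]
  act_mul g h := by rw [map_mul, A.act_mul]
  act_p g := A.act_p _
  good x := (A.good x).imp fun _ hU => ⟨hU.1, fun g => hU.2 (φ g)⟩

/-- The product over `k` of an `S`-variety with `Γ`-action and a `T`-variety with `Δ`-action. -/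
abbrev prod [IsAlgClosed k] (A : EqVar S Γ) (B : EqVar T Δ) : EqVar (S ⊗ T) (Γ × Δ) where
  X := A.X ⊗ B.X
  isVariety := A.isVariety.tensor B.isVariety
  p := A.p ⊗ₘ B.p
  act g := A.act g.1 ⊗ₘ B.act g.2
  act_one := by simp [A.act_one, B.act_one]
  act_mul g h := by simp [A.act_mul, B.act_mul]
  act_p g := by simp [A.act_p, B.act_p]
  good z := by
    obtain ⟨U, hU, hU'⟩ := A.good ((fst A.X B.X).left z)
    obtain ⟨V, hV, hV'⟩ := B.good ((snd A.X B.X).left z)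
    have : IsAffine U := hU
    have : IsAffine V := hV
    let j := pullback.map (U.ι ≫ A.X.hom) (V.ι ≫ B.X.hom) A.X.hom B.X.hom U.ι V.ι (𝟙 _)
      (by simp) (by simp)
    refine ⟨j.opensRange, isAffineOpen_opensRange j, fun g => ?_⟩
    change _ ∈ Set.range j
    rw [Scheme.Pullback.range_map]
    refine ⟨?_, ?_⟩
    · rw [Set.mem_preimage]
      have h : (fst A.X B.X).left ((A.act g.1 ⊗ₘ B.act g.2).left z) =
          (A.act g.1).left ((fst A.X B.X).left z) := by
        rw [← Scheme.Hom.comp_apply, ← Scheme.Hom.comp_apply, ← Over.comp_left, ← Over.comp_left,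
          tensorHom_fst]
      exact ⟨⟨_, hU' g.1⟩, h.symm⟩
    · rw [Set.mem_preimage]
      have h : (snd A.X B.X).left ((A.act g.1 ⊗ₘ B.act g.2).left z) =
          (B.act g.2).left ((snd A.X B.X).left z) := by
        rw [← Scheme.Hom.comp_apply, ← Scheme.Hom.comp_apply, ← Over.comp_left, ← Over.comp_left,
          tensorHom_snd]
      exact ⟨⟨_, hV' g.2⟩, h.symm⟩

/-- A `Γ`-equivariant morphism over `S`. -/
structure IsHom (A B : EqVar S Γ) (f : A.X ⟶ B.X) : Prop where
  comm : f ≫ B.p = A.p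
  equivariant : ∀ g, A.act g ≫ f = f ≫ B.act g

/-- Isomorphism of `S`-varieties with `Γ`-action. -/
def Iso (A B : EqVar S Γ) : Prop := ∃ e : A.X ≅ B.X, IsHom A B e.hom

/-- `Y` is (isomorphic to) a closed `Γ`-stable reduced subscheme of `X`, and `U` to its open
complement. -/
def IsScissor (X Y U : EqVar S Γ) : Prop :=
  ∃ (i : Y.X ⟶ X.X) (j : U.X ⟶ X.X), IsHom Y X i ∧ IsHom U X j ∧
    IsClosedImmersion i.left ∧ IsOpenImmersion j.left ∧
    Set.range j.left = (Set.range i.left)ᶜ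

/-- `E` is (isomorphic over `Y` to) the trivial affine bundle `Y × 𝔸ʳ`, with coordinates
`t₁, …, tᵣ` on the fibres, and the action on `E` is a lifting of the action on `Y` that is affine
on the fibres. -/
def IsAffineLift (r : ℕ) (Y E : EqVar S Γ) : Prop :=
  ∃ (π : E.X ⟶ Y.X) (t : ULift.{u} (Fin r) → Γ(E.X.left, ⊤)), IsHom E Y π ∧
    IsIso (AffineSpace.homOfVector π.left t) ∧
    ∀ g i, ∃ (a : ULift.{u} (Fin r) → Γ(Y.X.left, ⊤)) (b : Γ(Y.X.left, ⊤)),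
      (E.act g).left.appTop (t i) = π.left.appTop b + ∑ j, π.left.appTop (a j) * t j

end EqVar

/-! ### Grothendieck groups -/

section K0

variable {k : Type u} [Field k] {S T : Sch k} {Γ : Type v} [Group Γ] {Δ : Type w} [Group Δ]

/-- The relators of the Grothendieck group: isomorphisms, scissor relations, and the equality of
any two affine liftings of the same action to a trivial affine bundle. -/
inductive Relator : FreeAbelianGroup (EqVar S Γ) → Prop
  | iso (A B : EqVar S Γ) (h : A.Iso B) :
      Relator (FreeAbelianGroup.of A - FreeAbelianGroup.of B)
  | scissor (X Y U : EqVar S Γ) (h : X.IsScissor Y U) :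
      Relator (FreeAbelianGroup.of X - FreeAbelianGroup.of U - FreeAbelianGroup.of Y)
  | affine (r : ℕ) (Y E E' : EqVar S Γ) (h : Y.IsAffineLift r E) (h' : Y.IsAffineLift r E') :
      Relator (FreeAbelianGroup.of E - FreeAbelianGroup.of E')

variable (S Γ) in
/-- The Grothendieck group of `S`-varieties with good `Γ`-action. -/
def K0 : Type _ :=
  FreeAbelianGroup (EqVar S Γ) ⧸ AddSubgroup.closure {x : FreeAbelianGroup (EqVar S Γ) | Relator x}

noncomputable instance : AddCommGroup (K0 S Γ) :=
  inferInstanceAs (AddCommGroup (_ ⧸ AddSubgroup.closure _))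

/-- The class `[A]`. -/
def K0.mk (A : EqVar S Γ) : K0 S Γ := QuotientAddGroup.mk (FreeAbelianGroup.of A)


theorem K0.mk_iso {A B : EqVar S Γ} (h : A.Iso B) : K0.mk A = K0.mk B := by
  rw [← sub_eq_zero]
  exact (QuotientAddGroup.eq_zero_iff _).2 (AddSubgroup.subset_closure (.iso A B h))

theorem K0.mk_scissor {X Y U : EqVar S Γ} (h : X.IsScissor Y U) :
    K0.mk X = K0.mk U + K0.mk Y := by
  rw [← sub_eq_zero, ← sub_sub]
  exact (QuotientAddGroup.eq_zero_iff _).2 (AddSubgroup.subset_closure (.scissor X Y U h))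

theorem K0.mk_affine {r : ℕ} {Y E E' : EqVar S Γ} (h : Y.IsAffineLift r E)
    (h' : Y.IsAffineLift r E') : K0.mk E = K0.mk E' := by
  rw [← sub_eq_zero]
  exact (QuotientAddGroup.eq_zero_iff _).2 (AddSubgroup.subset_closure (.affine r Y E E' h h'))

/-- A function on objects that respects the relations induces a morphism on the Grothendieck
group. -/
def K0.lift {M : Type*} [AddCommGroup M] (f : EqVar S Γ → M)
    (h1 : ∀ A B, A.Iso B → f A = f B)
    (h2 : ∀ X Y U : EqVar S Γ, X.IsScissor Y U → f X = f U + f Y)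
    (h3 : ∀ r (Y E E' : EqVar S Γ), Y.IsAffineLift r E → Y.IsAffineLift r E' → f E = f E') :
    K0 S Γ →+ M :=
  QuotientAddGroup.lift _ (FreeAbelianGroup.lift f) <| by
    rw [AddSubgroup.closure_le]
    rintro _ (⟨A, B, h⟩ | ⟨X, Y, U, h⟩ | ⟨r, Y, E, E', h, h'⟩)
    · simp [h1 A B h]
    · simp [h2 X Y U h]
    · simp [h3 r Y E E' h h']

@[simp]
theorem K0.lift_mk {M : Type*} [AddCommGroup M] (f : EqVar S Γ → M) (h1 h2 h3)
    (A : EqVar S Γ) : K0.lift f h1 h2 h3 (K0.mk A) = f A :=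
  (QuotientAddGroup.lift_mk _ _ _).trans (FreeAbelianGroup.lift_apply_of _ _)

theorem K0.hom_ext {M : Type*} [AddCommGroup M] {f g : K0 S Γ →+ M}
    (h : ∀ A, f (K0.mk A) = g (K0.mk A)) : f = g := by
  apply QuotientAddGroup.addMonoidHom_ext
  ext A
  exact h A

theorem K0.induction {P : K0 S Γ → Prop} (x : K0 S Γ) (mk : ∀ A, P (K0.mk A)) (zero : P 0)
    (add : ∀ x y, P x → P y → P (x + y)) (neg : ∀ x, P x → P (-x)) : P x := by
  induction x using QuotientAddGroup.induction_on with
  | H z =>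
    induction z using FreeAbelianGroup.induction_on with
    | zero => exact zero
    | of A => exact mk A
    | neg A h => exact neg _ h
    | add x y hx hy => exact add _ _ hx hy

/-- The pushforward `f_!`. -/
def K0.push (f : S ⟶ T) : K0 S Γ →+ K0 T Γ :=
  K0.lift (fun A => K0.mk (A.push f))
    (fun _ _ ⟨e, h1, h2⟩ => K0.mk_iso ⟨e, by simp [EqVar.push, ← h1], h2⟩)
    (fun _ _ _ ⟨i, j, hi, hj, h⟩ => K0.mk_scissor
      ⟨i, j, ⟨by simp [EqVar.push, ← hi.1], hi.2⟩, ⟨by simp [EqVar.push, ← hj.1], hj.2⟩, h⟩)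
    (fun _ Y _ _ ⟨π, t, h, h'⟩ ⟨π₂, t₂, h₂, h₂'⟩ => K0.mk_affine (Y := Y.push f)
      ⟨π, t, ⟨by simp [EqVar.push, ← h.1], h.2⟩, h'⟩
      ⟨π₂, t₂, ⟨by simp [EqVar.push, ← h₂.1], h₂.2⟩, h₂'⟩)

/-- Restriction of the actions along `φ`. -/
def K0.res (φ : Δ →* Γ) : K0 S Γ →+ K0 S Δ :=
  K0.lift (fun A => K0.mk (A.res φ))
    (fun _ _ ⟨e, h1, h2⟩ => K0.mk_iso ⟨e, h1, fun _ => h2 _⟩)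
    (fun _ _ _ ⟨i, j, hi, hj, h⟩ => K0.mk_scissor
      ⟨i, j, ⟨hi.1, fun _ => hi.2 _⟩, ⟨hj.1, fun _ => hj.2 _⟩, h⟩)
    (fun _ Y _ _ ⟨π, t, h, h0, h'⟩ ⟨π₂, t₂, h₂, h₂0, h₂'⟩ => K0.mk_affine (Y := Y.res φ)
      ⟨π, t, ⟨h.1, fun _ => h.2 _⟩, h0, fun _ => h' _⟩
      ⟨π₂, t₂, ⟨h₂.1, fun _ => h₂.2 _⟩, h₂0, fun _ => h₂' _⟩)

@[simp]
theorem K0.push_mk (f : S ⟶ T) (A : EqVar S Γ) : K0.push f (K0.mk A) = K0.mk (A.push f) :=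
  K0.lift_mk ..

@[simp]
theorem K0.res_mk (φ : Δ →* Γ) (A : EqVar S Γ) : K0.res φ (K0.mk A) = K0.mk (A.res φ) :=
  K0.lift_mk ..

theorem range_whiskerRight {X Y : Sch k} (f : X ⟶ Y) (Z : Sch k) :
    Set.range (f ▷ Z).left = (fst Y Z).left ⁻¹' Set.range f.left := by
  rw [Over.whiskerRight_left, Scheme.Pullback.range_map]
  simp

theorem isPullback_whiskerRight {X Y : Sch k} (f : X ⟶ Y) (Z : Sch k) :
    IsPullback (fst X Z).left (f ▷ Z).left f.left (fst Y Z).left := by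
  have h1 : IsPullback (snd X Z).left (fst X Z).left Z.hom X.hom :=
    (IsPullback.of_hasPullback X.hom Z.hom).flip
  have h2 : IsPullback (snd Y Z).left (fst Y Z).left Z.hom Y.hom :=
    (IsPullback.of_hasPullback Y.hom Z.hom).flip
  refine (IsPullback.of_right (h₁₁ := (f ▷ Z).left) (h₂₁ := f.left) ?_ ?_ h2).flip
  · rwa [← Over.comp_left, whiskerRight_snd, Over.w]
  · rw [← Over.comp_left, ← Over.comp_left, whiskerRight_fst]

section prod

variable [IsAlgClosed k]

theorem EqVar.Iso.prod {A A' : EqVar S Γ} (h : A.Iso A') (B : EqVar T Δ) :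
    (A.prod B).Iso (A'.prod B) := by
  obtain ⟨e, h1, h2⟩ := h
  refine ⟨whiskerRightIso e B.X, ?_, fun g => ?_⟩
  · simp [EqVar.prod, ← h1, ← tensorHom_id]
  · simp [EqVar.prod, ← tensorHom_id, h2]

theorem EqVar.IsHom.prod {A A' : EqVar S Γ} {f : A.X ⟶ A'.X} (h : IsHom A A' f) (B : EqVar T Δ) :
    IsHom (A.prod B) (A'.prod B) (f ▷ B.X) := by
  obtain ⟨h1, h2⟩ := h
  refine ⟨?_, fun g => ?_⟩
  · simp [EqVar.prod, ← h1, ← tensorHom_id]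
  · simp [EqVar.prod, ← tensorHom_id, h2]

theorem EqVar.IsScissor.prod {X Y U : EqVar S Γ} (h : X.IsScissor Y U) (B : EqVar T Δ) :
    (X.prod B).IsScissor (Y.prod B) (U.prod B) := by
  obtain ⟨i, j, hi, hj, h1, h2, h3⟩ := h
  refine ⟨i ▷ B.X, j ▷ B.X, hi.prod B, hj.prod B, ?_, ?_, ?_⟩
  · exact MorphismProperty.of_isPullback (P := @IsClosedImmersion)
      (isPullback_whiskerRight i B.X) h1
  · exact MorphismProperty.of_isPullback (P := @IsOpenImmersion)
      (isPullback_whiskerRight j B.X) h2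
  · rw [range_whiskerRight, range_whiskerRight, h3, Set.preimage_compl]

theorem EqVar.IsAffineLift.prod {r : ℕ} {Y E : EqVar S Γ} (h : Y.IsAffineLift r E)
    (B : EqVar T Δ) : (Y.prod B).IsAffineLift r (E.prod B) := by
  obtain ⟨π, t, h1, h2, h3⟩ := h
  refine ⟨π ▷ B.X, fun i => (fst E.X B.X).left.appTop (t i), h1.prod B, ?_, fun g i => ?_⟩
  · have sq := (isPullback_whiskerRight π B.X)
    let e := asIso (AffineSpace.homOfVector π.left t)
    have sq1 : IsPullback ((fst E.X B.X).left ≫ e.hom) (π ▷ B.X).left (_ ↘ Y.X.left)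
        (fst Y.X B.X).left :=
      sq.of_iso (Iso.refl _) e (Iso.refl _) (Iso.refl _) (by simp) (by simp) (by simp [e]) (by simp)
    have sq2 := AffineSpace.isPullback_map (n := ULift.{u} (Fin r)) (fst Y.X B.X).left
    have : AffineSpace.homOfVector (π ▷ B.X).left (fun i => (fst E.X B.X).left.appTop (t i)) =
        (sq1.isoIsPullback _ _ sq2).hom := by
      apply sq2.hom_ext
      · rw [IsPullback.isoIsPullback_hom_fst]
        ext1
        · simp [e]
        · rw [Scheme.Hom.comp_appTop, CommRingCat.comp_apply, AffineSpace.map_appTop_coord,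
            Scheme.Hom.comp_appTop, CommRingCat.comp_apply]
          simp only [e, asIso_hom, AffineSpace.homOfVector_appTop_coord]
      · rw [IsPullback.isoIsPullback_hom_snd]
        simp
    change IsIso (AffineSpace.homOfVector (π ▷ B.X).left _)
    rw [this]
    infer_instance
  · obtain ⟨a, b, hab⟩ := h3 g.1 i
    refine ⟨fun j => (fst Y.X B.X).left.appTop (a j), (fst Y.X B.X).left.appTop b, ?_⟩
    have e1 : ((E.prod B).act g).left ≫ (fst E.X B.X).left =
        (fst E.X B.X).left ≫ (E.act g.1).left := by
      rw [← Over.comp_left, ← Over.comp_left]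
      congr 1
      simp [EqVar.prod]
    have e2 : (π ▷ B.X).left ≫ (fst Y.X B.X).left = (fst E.X B.X).left ≫ π.left := by
      rw [← Over.comp_left, ← Over.comp_left]
      congr 1
      simp
    have e1' := fun x => congr($(congr(Scheme.Hom.appTop $e1)) x)
    have e2' := fun x => congr($(congr(Scheme.Hom.appTop $e2)) x)
    simp only [Scheme.Hom.comp_appTop, CommRingCat.comp_apply] at e1' e2'
    simp only [e1', e2', hab, map_add, map_sum, map_mul]

theorem K0.mk_swap (A : EqVar S Γ) (B : EqVar T Δ) :
    K0.mk (A.prod B) =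
      K0.res (MonoidHom.prod (MonoidHom.snd Γ Δ) (MonoidHom.fst Γ Δ))
        (K0.push (β_ T S).hom (K0.mk (B.prod A))) := by
  rw [K0.push_mk, K0.res_mk]
  refine K0.mk_iso ⟨β_ A.X B.X, ?_, fun g => ?_⟩
  · ext <;> simp
  · ext <;> simp

/-- The product with a fixed object. -/
def K0.prodRight (B : EqVar T Δ) : K0 S Γ →+ K0 (S ⊗ T) (Γ × Δ) :=
  K0.lift (fun A => K0.mk (A.prod B))
    (fun _ _ h => K0.mk_iso (h.prod B))
    (fun _ _ _ h => K0.mk_scissor (h.prod B))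
    (fun _ _ _ _ h h' => K0.mk_affine (h.prod B) (h'.prod B))

@[simp]
theorem K0.prodRight_mk (A : EqVar S Γ) (B : EqVar T Δ) :
    K0.prodRight B (K0.mk A) = K0.mk (A.prod B) :=
  K0.lift_mk ..

/-- The biadditive map induced by `(A, B) ↦ A × B`. -/
def K0.prod : K0 S Γ →+ K0 T Δ →+ K0 (S ⊗ T) (Γ × Δ) :=
  AddMonoidHom.flip <| K0.lift (fun B => K0.prodRight B)
    (fun B B' h => K0.hom_ext fun A => by
      simp only [K0.prodRight_mk, K0.mk_swap A]
      rw [← K0.prodRight_mk B, ← K0.prodRight_mk B', K0.mk_iso h])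
    (fun X Y U h => K0.hom_ext fun A => by
      simp only [K0.prodRight_mk, K0.mk_swap A, AddMonoidHom.add_apply]
      rw [← K0.prodRight_mk X, ← K0.prodRight_mk Y, ← K0.prodRight_mk U, K0.mk_scissor h,
        map_add, map_add, map_add])
    (fun r Y B B' h h' => K0.hom_ext fun A => by
      simp only [K0.prodRight_mk, K0.mk_swap A]
      rw [← K0.prodRight_mk B, ← K0.prodRight_mk B', K0.mk_affine h h'])

@[simp]
theorem K0.prod_mk (A : EqVar S Γ) (B : EqVar T Δ) :
    K0.prod (K0.mk A) (K0.mk B) = K0.mk (A.prod B) := by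
  simp [K0.prod]

end prod

end K0

/-! ### The ring `K₀(Var_k)` and the module structures over it -/

/-- The Grothendieck group of `k`-varieties (without action). -/
abbrev K0Var (k : Type u) [Field k] : Type _ := K0 (𝟙_ (Sch k)) Unit

section algebra

variable {k : Type u} [Field k] [IsAlgClosed k] {S T : Sch k} {Γ : Type v} [Group Γ]
  {Δ : Type w} [Group Δ]

/-- The `S`-variety `R × A ⟶ S` for a `k`-variety `R` and an `S`-variety `A`, with the action
coming from `A`. -/
abbrev EqVar.smul (R : EqVar (𝟙_ (Sch k)) Unit) (A : EqVar S Γ) : EqVar S Γ :=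
  ((R.prod A).push (λ_ S).hom).res (MonoidHom.inr Unit Γ)

/-- The biadditive map induced by `(R, A) ↦ R × A`. -/
def K0.smulHom : K0Var k →+ K0 S Γ →+ K0 S Γ :=
  K0.prod.compr₂ ((K0.res (MonoidHom.inr Unit Γ)).comp (K0.push (λ_ S).hom))

@[simp]
theorem K0.smulHom_mk (R : EqVar (𝟙_ (Sch k)) Unit) (A : EqVar S Γ) :
    K0.smulHom (K0.mk R) (K0.mk A) = K0.mk (R.smul A) := by
  simp [K0.smulHom]

theorem K0.one_smul' (a : K0 S Γ) :
    K0.smulHom (K0.mk (EqVar.triv Unit (𝟙_ (Sch k)) inferInstance (𝟙 _))) a = a := by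
  suffices K0.smulHom (K0.mk (EqVar.triv Unit (𝟙_ (Sch k)) inferInstance (𝟙 _))) =
    AddMonoidHom.id (K0 S Γ) from congr($this a)
  refine K0.hom_ext fun A => ?_
  rw [K0.smulHom_mk]
  refine K0.mk_iso ⟨λ_ A.X, ?_, fun g => ?_⟩
  · simp
  · simp

theorem K0.mul_smul' (r r' : K0Var k) (a : K0 S Γ) :
    K0.smulHom (K0.smulHom r r') a = K0.smulHom r (K0.smulHom r' a) := by
  induction r using K0.induction with
  | zero => simp
  | add x y hx hy => simp only [map_add, AddMonoidHom.add_apply, hx, hy]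
  | neg x hx => simp only [map_neg, AddMonoidHom.neg_apply, hx]
  | mk R =>
  induction r' using K0.induction with
  | zero => simp
  | add x y hx hy => simp only [map_add, AddMonoidHom.add_apply, hx, hy]
  | neg x hx => simp only [map_neg, AddMonoidHom.neg_apply, hx]
  | mk R' =>
  induction a using K0.induction with
  | zero => simp
  | add x y hx hy => simp only [map_add, hx, hy]
  | neg x hx => simp only [map_neg, hx]
  | mk A =>
  simp only [K0.smulHom_mk]
  refine K0.mk_iso ⟨α_ R.X R'.X A.X, ?_, fun g => ?_⟩
  · simp [leftUnitor_hom]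
  · ext <;> simp [R.act_one, R'.act_one]

theorem K0.mul_comm' (r r' : K0Var k) : K0.smulHom r r' = K0.smulHom r' r := by
  induction r using K0.induction with
  | zero => simp
  | add x y hx hy => simp [hx, hy]
  | neg x hx => simp [hx]
  | mk R =>
  induction r' using K0.induction with
  | zero => simp
  | add x y hx hy => simp [hx, hy]
  | neg x hx => simp [hx]
  | mk R' =>
  simp only [K0.smulHom_mk]
  refine K0.mk_iso ⟨β_ R.X R'.X, toUnit_unique _ _, fun g => ?_⟩
  obtain rfl : g = 1 := rfl
  simp [R.act_one, R'.act_one]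

/-- The ring structure on `K₀(Var_k)` given by the product of varieties. -/
instance : CommRing (K0Var k) :=
  { (inferInstance : AddCommGroup (K0Var k)) with
    mul := fun a b => K0.smulHom a b
    one := K0.mk (EqVar.triv Unit (𝟙_ (Sch k)) inferInstance (𝟙 _))
    mul_assoc := K0.mul_smul'
    one_mul := K0.one_smul'
    mul_one := fun a => (K0.mul_comm' _ _).trans (K0.one_smul' a)
    mul_comm := K0.mul_comm'
    left_distrib := fun a b c => map_add (K0.smulHom a) b c
    right_distrib := fun a b c => DFunLike.congr_fun (map_add K0.smulHom a b) c
    zero_mul := fun a => DFunLike.congr_fun (map_zero K0.smulHom) a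
    mul_zero := fun a => map_zero (K0.smulHom a) }

/-- The `K₀(Var_k)`-module structure `[R] • [A ⟶ S] = [R × A ⟶ S]`. -/
instance : Module (K0Var k) (K0 S Γ) where
  smul r a := K0.smulHom r a
  one_smul := K0.one_smul'
  mul_smul := K0.mul_smul'
  smul_zero r := map_zero (K0.smulHom r)
  smul_add r a b := map_add (K0.smulHom r) a b
  add_smul r r' a := DFunLike.congr_fun (map_add K0.smulHom r r') a
  zero_smul a := DFunLike.congr_fun (map_zero K0.smulHom) a

theorem K0.mk_smul (R : EqVar (𝟙_ (Sch k)) Unit) (A : EqVar S Γ) :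
    (K0.mk R : K0Var k) • K0.mk A = K0.mk (R.smul A) :=
  K0.smulHom_mk R A

/-- The `K₀(Var_k)`-linear pushforward `f_!`. -/
def K0.pushₗ (f : S ⟶ T) : K0 S Γ →ₗ[K0Var k] K0 T Γ :=
  { K0.push f with
    map_smul' := fun r a => by
      change K0.push f (K0.smulHom r a) = K0.smulHom r (K0.push f a)
      induction r using K0.induction with
      | zero => simp
      | add x y hx hy => simp only [map_add, AddMonoidHom.add_apply, hx, hy]
      | neg x hx => simp only [map_neg, AddMonoidHom.neg_apply, hx]
      | mk R =>
      induction a using K0.induction with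
      | zero => simp
      | add x y hx hy => simp only [map_add, hx, hy]
      | neg x hx => simp only [map_neg, hx]
      | mk A =>
      simp only [K0.smulHom_mk, K0.push_mk]
      exact K0.mk_iso ⟨Iso.refl _, by simp [leftUnitor_hom], fun g => by simp⟩ }

theorem K0.smul_prod (r : K0Var k) (a : K0 S Γ) (b : K0 T Δ) :
    K0.prod (r • a) b = r • K0.prod a b := by
  change K0.prod (K0.smulHom r a) b = K0.smulHom r (K0.prod a b)
  induction r using K0.induction with
  | zero => simp
  | add x y hx hy => simp only [map_add, AddMonoidHom.add_apply, hx, hy]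
  | neg x hx => simp only [map_neg, AddMonoidHom.neg_apply, hx]
  | mk R =>
  induction a using K0.induction with
  | zero => simp
  | add x y hx hy => simp only [map_add, AddMonoidHom.add_apply, hx, hy]
  | neg x hx => simp only [map_neg, AddMonoidHom.neg_apply, hx]
  | mk A =>
  induction b using K0.induction with
  | zero => simp
  | add x y hx hy => simp only [map_add, hx, hy]
  | neg x hx => simp only [map_neg, hx]
  | mk B =>
  simp only [K0.smulHom_mk, K0.prod_mk]
  refine K0.mk_iso ⟨α_ R.X A.X B.X, ?_, fun g => ?_⟩
  · ext <;> simp [leftUnitor_hom]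
  · ext <;> simp

theorem K0.prod_smul (r : K0Var k) (a : K0 S Γ) (b : K0 T Δ) :
    K0.prod a (r • b) = r • K0.prod a b := by
  change K0.prod a (K0.smulHom r b) = K0.smulHom r (K0.prod a b)
  induction r using K0.induction with
  | zero => simp
  | add x y hx hy => simp only [map_add, AddMonoidHom.add_apply, hx, hy]
  | neg x hx => simp only [map_neg, AddMonoidHom.neg_apply, hx]
  | mk R =>
  induction a using K0.induction with
  | zero => simp
  | add x y hx hy => simp only [map_add, AddMonoidHom.add_apply, hx, hy]
  | neg x hx => simp only [map_neg, AddMonoidHom.neg_apply, hx]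
  | mk A =>
  induction b using K0.induction with
  | zero => simp
  | add x y hx hy => simp only [map_add, hx, hy]
  | neg x hx => simp only [map_neg, hx]
  | mk B =>
  simp only [K0.smulHom_mk, K0.prod_mk]
  refine K0.mk_iso ⟨(α_ A.X R.X B.X).symm ≪≫ whiskerRightIso (β_ A.X R.X) B.X ≪≫
    α_ R.X A.X B.X, ?_, fun g => ?_⟩
  · ext <;> simp [leftUnitor_hom]
  · ext <;> simp

/-- The exterior product `×`, as a `K₀(Var_k)`-bilinear map. -/
def K0.prodₗ : K0 S Γ →ₗ[K0Var k] K0 T Δ →ₗ[K0Var k] K0 (S ⊗ T) (Γ × Δ) :=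
  LinearMap.mk₂ (K0Var k) (fun a b => K0.prod a b)
    (fun a a' b => by simp) K0.smul_prod (fun a b b' => by simp) K0.prod_smul

end algebra

/-! ### The affine line -/

section line

variable (k : Type u) [Field k]

/-- The affine line over `k`. -/
def A1 : Sch k := Over.mk (𝔸(PUnit.{u + 1}; Spec (CommRingCat.of k)) ↘ Spec (CommRingCat.of k))

/-- The coordinate on the affine line. -/
def A1.coord : Γ((A1 k).left, ⊤) := AffineSpace.coord (Spec (CommRingCat.of k)) PUnit.unit

variable {k} in
/-- The morphism to the affine line given by a global function. -/
def A1.ofFun {X : Sch k} (f : Γ(X.left, ⊤)) : X ⟶ A1 k :=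
  Over.homMk (AffineSpace.homOfVector X.hom fun _ => f) (AffineSpace.homOfVector_over _ _)

/-- The addition morphism `𝔸¹ × 𝔸¹ ⟶ 𝔸¹`. -/
def A1.add : A1 k ⊗ A1 k ⟶ A1 k :=
  A1.ofFun ((fst (A1 k) (A1 k)).left.appTop (A1.coord k) +
    (snd (A1 k) (A1 k)).left.appTop (A1.coord k))

/-- The origin `Spec k ⟶ 𝔸¹`. -/
def A1.zero : 𝟙_ (Sch k) ⟶ A1 k := A1.ofFun 0

end line

/-! ### The curves `xⁿ + yⁿ = c` in the torus and balanced products -/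

section fermat

variable {k : Type u} [Field k]

/-- The ideal of `k[x, y, x', y']` generated by `x x' - 1`, `y y' - 1` and `xⁿ + yⁿ - c`. -/
def fermatIdeal (n : ℕ) (c : k) : Ideal (MvPolynomial (Fin 4) k) :=
  Ideal.span {.X 0 * .X 2 - 1, .X 1 * .X 3 - 1, .X 0 ^ n + .X 1 ^ n - .C c}

/-- The coordinate ring `k[x, y, x⁻¹, y⁻¹] / (xⁿ + yⁿ - c)`. -/
abbrev FermatRing (n : ℕ) (c : k) : Type u := MvPolynomial (Fin 4) k ⧸ fermatIdeal n c

/-- The endomorphism `x ↦ s x`, `y ↦ t y`, `x' ↦ s⁻¹ x'`, `y' ↦ t⁻¹ y'` of `k[x, y, x', y']`. -/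
def scalePoly (s t : kˣ) : MvPolynomial (Fin 4) k →ₐ[k] MvPolynomial (Fin 4) k :=
  MvPolynomial.aeval ![.C (s : k) * .X 0, .C (t : k) * .X 1, .C (s⁻¹ : kˣ).1 * .X 2,
    .C (t⁻¹ : kˣ).1 * .X 3]

theorem scalePoly_mem {n : ℕ} (c : k) (s t : rootsOfUnity n k) :
    fermatIdeal n c ≤ (fermatIdeal n c).comap (scalePoly s.1 t.1) := by
  have hr (r : rootsOfUnity n k) : ((r : kˣ) : k) ^ n = 1 := by
    rw [← Units.val_pow_eq_pow_val, (mem_rootsOfUnity n _).1 r.2, Units.val_one]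
  have hC (r : kˣ) : MvPolynomial.C (σ := Fin 4) (r : k) * MvPolynomial.C (r⁻¹ : kˣ).1 = 1 := by
    rw [← map_mul, Units.mul_inv, map_one]
  have h0 : scalePoly s.1 t.1 (.X 0) = .C (s.1 : k) * .X 0 := MvPolynomial.aeval_X _ _
  have h1 : scalePoly s.1 t.1 (.X 1) = .C (t.1 : k) * .X 1 := MvPolynomial.aeval_X _ _
  have h2 : scalePoly s.1 t.1 (.X 2) = .C (s.1⁻¹ : kˣ).1 * .X 2 := MvPolynomial.aeval_X _ _
  have h3 : scalePoly s.1 t.1 (.X 3) = .C (t.1⁻¹ : kˣ).1 * .X 3 := MvPolynomial.aeval_X _ _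
  have h4 : scalePoly s.1 t.1 (.C c) = .C c := MvPolynomial.aeval_C _ _
  refine Ideal.span_le.2 ?_
  rintro x hx
  suffices h : scalePoly s.1 t.1 x = x by
    change scalePoly s.1 t.1 x ∈ fermatIdeal n c
    rw [h]
    exact Ideal.subset_span hx
  obtain rfl | rfl | rfl := hx
  · rw [map_sub, map_mul, map_one, h0, h2]
    linear_combination (.X 0 * .X 2) * hC s.1
  · rw [map_sub, map_mul, map_one, h1, h3]
    linear_combination (.X 1 * .X 3) * hC t.1
  · rw [map_sub, map_add, map_pow, map_pow, h0, h1, h4, mul_pow, mul_pow, ← map_pow, ← map_pow,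
      hr, hr, map_one, one_mul, one_mul]

/-- The endomorphism `x ↦ s x`, `y ↦ t y` of the coordinate ring, for `s, t ∈ μ_n(k)`. -/
def FermatRing.scale {n : ℕ} (c : k) (s t : rootsOfUnity n k) :
    FermatRing n c →ₐ[k] FermatRing n c :=
  Ideal.quotientMapₐ (fermatIdeal n c) (scalePoly s.1 t.1) (scalePoly_mem c s t)

/-- The closed subvariety `xⁿ + yⁿ = c` of the torus `𝔾ₘ × 𝔾ₘ` with coordinates `x, y`. -/
def fermat (n : ℕ) (c : k) : Sch k :=
  Over.mk (Spec.map (CommRingCat.ofHom (algebraMap k (FermatRing n c))))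

/-- The morphism `(x, y) ↦ (s x, t y)`. -/
def fermatScale {n : ℕ} (c : k) (s t : rootsOfUnity n k) : fermat n c ⟶ fermat n c :=
  Over.homMk (Spec.map (CommRingCat.ofHom (FermatRing.scale c s t).toRingHom)) <| by
    change Spec.map _ ≫ Spec.map _ = Spec.map _
    rw [← Spec.map_comp, ← CommRingCat.ofHom_comp]
    congr 2
    exact (FermatRing.scale c s t).comp_algebraMap

end fermat

/-- `q : P ⟶ Q` is a quotient of the scheme `P` by a family of automorphisms (an action of a finite
group): `q` is affine and invariant, and the functions on an open subset of `Q` are the invariant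
functions on its preimage. -/
structure IsQuotientBy {ι : Type*} {P Q : Scheme.{u}} (σ : ι → (P ⟶ P)) (q : P ⟶ Q) : Prop where
  affine : IsAffineHom q
  invariant : ∀ g, σ g ≫ q = q
  injective : ∀ U : Q.Opens, Function.Injective (q.app U)
  surjective : ∀ (U : Q.Opens) (f : Γ(P, q ⁻¹ᵁ U)),
    (∀ g, (σ g).appLE (q ⁻¹ᵁ U) (q ⁻¹ᵁ U)
      (by rw [← Scheme.Hom.comp_preimage, invariant g]) f = f) → ∃ h, q.app U h = f

/-! ### The convolution product -/

section convolution

variable {k : Type u} [Field k] {S : Sch k}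

/-- For an `S`-variety `Z` with action of `μ_n × μ_n`, the `S`-variety with `μ_n`-action `Q` is (a
model of) the balanced product `(Z ×^{μ_n × μ_n} 𝔾ₘ × 𝔾ₘ)|_{xⁿ + yⁿ = c}`, i.e. the quotient of
`Z × {xⁿ + yⁿ = c}` by `(z, x, y).(s, t) = (z.(s, t), s⁻¹ x, t⁻¹ y)`, with structure morphism
`[z, x, y] ↦ p(z)` and action `[z, x, y].t = [z, t x, t y]`. -/
def IsBalancedProduct (n : ℕ) (c : k) (Z : EqVar S (rootsOfUnity n k × rootsOfUnity n k))
    (Q : EqVar S (rootsOfUnity n k)) : Prop :=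
  ∃ q : Z.X ⊗ fermat n c ⟶ Q.X,
    IsQuotientBy (fun g : rootsOfUnity n k × rootsOfUnity n k =>
      (Z.act g ⊗ₘ fermatScale c g.1⁻¹ g.2⁻¹).left) q.left ∧
    q ≫ Q.p = fst Z.X (fermat n c) ≫ Z.p ∧
    ∀ t, q ≫ Q.act t = (Z.X ◁ fermatScale c t t) ≫ q

variable [IsAlgClosed k]

/-- `Ψ` is the morphism `K₀(Var_S^{μ_n × μ_n}) ⟶ K₀(Var_S^{μ_n})` that sends the class of `Z` to
`-[(Z ×^{μ_n × μ_n} 𝔾ₘ × 𝔾ₘ)|_{xⁿ + yⁿ = 1}] + [(Z ×^{μ_n × μ_n} 𝔾ₘ × 𝔾ₘ)|_{xⁿ + yⁿ = 0}]`. -/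
def IsPsi (n : ℕ)
    (Ψ : K0 S (rootsOfUnity n k × rootsOfUnity n k) →ₗ[K0Var k] K0 S (rootsOfUnity n k)) : Prop :=
  ∀ Z Q₁ Q₀, IsBalancedProduct n 1 Z Q₁ → IsBalancedProduct n 0 Z Q₀ →
    Ψ (K0.mk Z) = -K0.mk Q₁ + K0.mk Q₀

/-- The convolution product over the affine line: the `K₀(Var_k)`-bilinear composition
`Ψ ∘ add_! ∘ (×)`. -/
def starProduct {n : ℕ} (Ψ : K0 (A1 k) (rootsOfUnity n k × rootsOfUnity n k) →ₗ[K0Var k]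
      K0 (A1 k) (rootsOfUnity n k)) :
    K0 (A1 k) (rootsOfUnity n k) →ₗ[K0Var k] K0 (A1 k) (rootsOfUnity n k) →ₗ[K0Var k]
      K0 (A1 k) (rootsOfUnity n k) :=
  K0.prodₗ.compr₂ (Ψ ∘ₗ K0.pushₗ (A1.add k))

/-- The object `0 : Spec k ⟶ 𝔸¹` with the trivial action. -/
def originVar (k : Type u) [Field k] (n : ℕ) : EqVar (A1 k) (rootsOfUnity n k) :=
  EqVar.triv _ (𝟙_ (Sch k)) inferInstance (A1.zero k)

/-- For `V : X ⟶ 𝔸¹` and `W : Y ⟶ 𝔸¹`, the object `X × Y ⟶ 𝔸¹`, `(x, y) ↦ V(x) + W(y)`. -/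
def thomSebastiani (X Y : EqVar (A1 k) Unit) : EqVar (A1 k) Unit :=
  ((X.prod Y).push (A1.add k)).res (MonoidHom.prod (MonoidHom.id Unit) (MonoidHom.id Unit))

/-- The morphism `K₀(Var_{𝔸¹}) ⟶ K₀(Var_{𝔸¹}^{μ_n})` that equips varieties with the trivial
action. -/
def trivialAction (k : Type u) [Field k] (n : ℕ) :
    K0 (A1 k) Unit →+ K0 (A1 k) (rootsOfUnity n k) :=
  K0.res 1

end convolution

end

end MotConv

open MotConv

namespace MotConv

noncomputable section

/-! ### Actions of finite groups on schemes -/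

/-! A balanced product is the quotient of Z × F_c by μ_n × μ_n, where F_c is the curve xⁿ + yⁿ = c
in the torus. In characteristic zero one can average over a finite group, so quotients behave well:
they exist if every point has a stable affine open neighbourhood (`exists_quotient`), commute with
base change (`IsQuotientBy.of_isPullback`), respect scissor relations (`IsQuot.scissor`) and can be
taken in stages (`IsQuot.comp`). Letting the diagonal μ_n act as well, the balanced product becomes
the quotient of a variety with μ_n³-action by the kernel of a projection to μ_n
(`isBalancedProduct_iff`).

For the existence of Ψ only the relation on affine bundles is delicate: the class of the quotient of
E × F_c must depend on the base Y and the rank alone. The coordinates of E are sums of isotypic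
components for μ_n × μ_n, and multilinearity of the determinant writes 1 as a sum of determinants,
one for each choice of a component of every coordinate. Where such a determinant is invertible, the
chosen components are eigencoordinates; Y is stratified accordingly (`eq_of_isAffineLift`). On E ×
F_c an eigencoordinate times a suitable monomial in the units x and y is invariant under μ_n × μ_n
(`quo_tw_of_eigen`). So the bundle descends to a trivial bundle with linear action, and the affine
relation in the target group applies (`balClass_affine`).

For the unit law, let the first factor act trivially on Z. Dividing F_c by it gives B_c : w + yⁿ =
c. Since 𝔾ₘ is the disjoint union of B_c and M_c : yⁿ = c, the difference -[B₁] + [B₀] contributes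
[M₁] - [M₀]. Here M₀ is empty, M₁ is μ_n, and Z × M₁ divided by μ_n is Z (`psi_res_snd`). The
Thom-Sebastiani formula is the same computation.

For associativity, the product of A, B, C formed along F_c and then F_d is the quotient of A × B × C
× D_{c,d} by μ_n³, with D_{c,d} : xⁿ + yⁿ = c w, w + vⁿ = d (`balClass_addProd`). Let T_d : xⁿ + yⁿ
+ vⁿ = d, E_d : xⁿ + yⁿ = 0, vⁿ = d, and G : xⁿ + yⁿ = 0. Then T_d is the disjoint union of D_{1,d}
and E_d, and G that of D_{0,d} and E_d, so D_{1,1} - D_{1,0} - D_{0,1} + D_{0,0} collapses to T₁ -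
T₀ (`psi_addProd`). This is symmetric in the three variables, so (A ★ B) ★ C = (C ★ B) ★ A, and
commutativity, which comes from the symmetry of F_c, gives associativity. -/

/-- A right action of a group on a scheme. -/
structure IsAct {G : Type*} [Group G] {P : Scheme.{u}} (σ : G → (P ⟶ P)) : Prop where
  one : σ 1 = 𝟙 P
  mul : ∀ g h, σ (g * h) = σ g ≫ σ h

/-- The order of `G` is invertible on `X`. -/
def CardUnit (G : Type*) (X : Scheme.{u}) : Prop := IsUnit ((Nat.card G : ℕ) : Γ(X, ⊤))

theorem CardUnit.of_hom {G : Type*} {X Y : Scheme.{u}} (h : CardUnit G Y) (f : X ⟶ Y) :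
    CardUnit G X := by
  have := IsUnit.map f.appTop.hom h
  rwa [map_natCast] at this

theorem CardUnit.isUnit {G : Type*} {X : Scheme.{u}} (h : CardUnit G X) (U : X.Opens) :
    IsUnit ((Nat.card G : ℕ) : Γ(X, U)) := by
  have := IsUnit.map (X.presheaf.map (homOfLE (le_top : U ≤ ⊤)).op).hom h
  rwa [map_natCast] at this

section sections

variable {P Q : Scheme.{u}} {q : P ⟶ Q}

/-- The pullback of functions on the preimage of `U` along an automorphism over `Q`. -/
def secMap {σ : P ⟶ P} (h : σ ≫ q = q) (U : Q.Opens) : Γ(P, q ⁻¹ᵁ U) →+* Γ(P, q ⁻¹ᵁ U) :=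
  (σ.appLE (q ⁻¹ᵁ U) (q ⁻¹ᵁ U) (by rw [← Scheme.Hom.comp_preimage, h])).hom

theorem secMap_app {σ : P ⟶ P} (h : σ ≫ q = q) (U : Q.Opens) (a : Γ(Q, U)) :
    secMap h U (q.app U a) = q.app U a := by
  refine congr($((Scheme.Hom.comp_appLE σ q U (q ⁻¹ᵁ U)
    (by rw [h])).symm) a).trans ?_
  simp only [h, ← Scheme.Hom.app_eq_appLE]

/-- Restriction of functions between preimages of open subsets. -/
def secRes (q : P ⟶ Q) {U V : Q.Opens} (h : V ≤ U) : Γ(P, q ⁻¹ᵁ U) →+* Γ(P, q ⁻¹ᵁ V) :=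
  (P.presheaf.map (homOfLE (q.preimage_mono h)).op).hom

theorem secMap_res {σ : P ⟶ P} (h : σ ≫ q = q) {U V : Q.Opens} (e : V ≤ U)
    (a : Γ(P, q ⁻¹ᵁ U)) : secMap h V (secRes q e a) = secRes q e (secMap h U a) := by
  change (P.presheaf.map _ ≫ σ.appLE _ _ _) a = (σ.appLE _ _ _ ≫ P.presheaf.map _) a
  rw [Scheme.Hom.map_appLE, Scheme.Hom.appLE_map]

theorem app_res {U V : Q.Opens} (e : V ≤ U) (a : Γ(Q, U)) :
    q.app V (Q.presheaf.map (homOfLE e).op a) = secRes q e (q.app U a) := by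
  change (Q.presheaf.map _ ≫ q.app V) a = (q.app U ≫ P.presheaf.map _) a
  rw [Scheme.Hom.naturality]
  rfl

theorem secMap_comp {σ τ : P ⟶ P} (h : σ ≫ q = q) (h' : τ ≫ q = q) (h'' : (σ ≫ τ) ≫ q = q)
    (U : Q.Opens) (a : Γ(P, q ⁻¹ᵁ U)) : secMap h'' U a = secMap h U (secMap h' U a) := by
  change _ = (τ.appLE _ _ _ ≫ σ.appLE _ _ _) a
  rw [Scheme.Hom.appLE_comp_appLE]
  rfl

theorem secMap_id (h : 𝟙 P ≫ q = q) (U : Q.Opens) (a : Γ(P, q ⁻¹ᵁ U)) : secMap h U a = a := by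
  change (Scheme.Hom.appLE (𝟙 P) _ _ _) a = _
  exact congr($(P.presheaf.map_id (.op (q ⁻¹ᵁ U))) a)

variable {G : Type*} [Group G] {σ : G → (P ⟶ P)}

/-- The left action on functions induced by a right action. -/
@[reducible]
def IsAct.mulSemiringAction (hσ : IsAct σ) (h : ∀ g, σ g ≫ q = q) (U : Q.Opens) :
    MulSemiringAction G Γ(P, q ⁻¹ᵁ U) where
  smul g a := secMap (h g) U a
  one_smul a := by
    change secMap (h 1) U a = a
    have := hσ.one
    generalize h 1 = h1
    generalize σ 1 = s at *
    subst this
    exact secMap_id h1 U a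
  mul_smul g g' a := by
    change secMap (h (g * g')) U a = secMap (h g) U (secMap (h g') U a)
    have := hσ.mul g g'
    generalize h (g * g') = h1
    generalize σ (g * g') = s at *
    subst this
    exact secMap_comp _ _ _ U a
  smul_zero g := map_zero _
  smul_add g := map_add _
  smul_one g := map_one _
  smul_mul g := map_mul _

/-- The Reynolds operator: `w` is the average of `z`. The inverse of the group order is taken on
`Q`, so that it is visibly invariant upstairs. -/
theorem IsAct.exists_sum_eq [Finite G] (hσ : IsAct σ) (h : ∀ g, σ g ≫ q = q)
    (hn : CardUnit G Q) (U : Q.Opens) (z : Γ(P, q ⁻¹ᵁ U)) :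
    ∃ w, (∀ g, secMap (h g) U w = w) ∧
      (Nat.card G : Γ(P, q ⁻¹ᵁ U)) * w = ∑ᶠ g, secMap (h g) U z := by
  let _ := hσ.mulSemiringAction h U
  have := Fintype.ofFinite G
  obtain ⟨c, hc⟩ := (hn.isUnit U).exists_right_inv
  have hc' := congr(q.app U $hc)
  rw [map_mul, map_natCast, map_one] at hc'
  refine ⟨q.app U c * ∑ᶠ g, secMap (h g) U z, fun g => ?_, by rw [← mul_assoc, hc', one_mul]⟩
  rw [map_mul, secMap_app]
  congr 1
  rw [finsum_eq_sum_of_fintype]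
  change g • (∑ g' : G, g' • z) = _
  rw [Finset.smul_sum]
  simp only [← mul_smul]
  exact Fintype.sum_equiv (Equiv.mulLeft g) _ _ fun _ => rfl

/-- The functions on `U` are the invariant functions on its preimage. -/
structure IsInvOn (h : ∀ g, σ g ≫ q = q) (U : Q.Opens) : Prop where
  inj : Function.Injective (q.app U)
  surj : ∀ f : Γ(P, q ⁻¹ᵁ U), (∀ g, secMap (h g) U f = f) → ∃ a, q.app U a = f

/-- Taking invariants commutes with localisation at an invariant function. The numerator of an
invariant fraction is invariant only after restriction, but its average is invariant on `U` and has
the same restriction. -/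
theorem IsInvOn.basicOpen [Finite G] (hσ : IsAct σ) [IsAffineHom q] {h : ∀ g, σ g ≫ q = q}
    (hn : CardUnit G Q) {U : Q.Opens} (hU : IsAffineOpen U) (H : IsInvOn h U) (f : Γ(Q, U)) :
    IsInvOn h (Q.basicOpen f) := by
  have hle := Q.basicOpen_le f
  have hloc := hU.isLocalization_basicOpen f
  let _ : Algebra Γ(P, q ⁻¹ᵁ U) Γ(P, q ⁻¹ᵁ Q.basicOpen f) := (secRes q hle).toAlgebra
  have hloc' : IsLocalization.Away (q.app U f) Γ(P, q ⁻¹ᵁ Q.basicOpen f) := (hU.preimage q).isLocalization_of_eq_basicOpen (q.app U f)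
    (homOfLE (q.preimage_mono hle)) (Scheme.preimage_basicOpen q f)
  have key (x : Γ(Q, Q.basicOpen f)) : ∃ (n : ℕ) (a : Γ(Q, U)),
      x * Q.presheaf.map (homOfLE hle).op f ^ n = Q.presheaf.map (homOfLE hle).op a := by
    obtain ⟨⟨a, ⟨_, n, rfl⟩⟩, ha⟩ := IsLocalization.surj (Submonoid.powers f) x
    exact ⟨n, a, by simpa [RingHom.algebraMap_toAlgebra] using ha⟩
  have key' (x : Γ(P, q ⁻¹ᵁ Q.basicOpen f)) : ∃ (n : ℕ) (a : Γ(P, q ⁻¹ᵁ U)),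
      x * secRes q hle (q.app U f) ^ n = secRes q hle a := by
    obtain ⟨⟨a, ⟨_, n, rfl⟩⟩, ha⟩ := IsLocalization.surj (Submonoid.powers (q.app U f)) x
    exact ⟨n, a, by simpa [RingHom.algebraMap_toAlgebra, secRes] using ha⟩
  have key₀ (a : Γ(Q, U)) (ha : Q.presheaf.map (homOfLE hle).op a = 0) :
      ∃ n : ℕ, f ^ n * a = 0 := by
    obtain ⟨⟨_, n, rfl⟩, ha⟩ := (IsLocalization.map_eq_zero_iff (Submonoid.powers f) _ a).1 ha
    exact ⟨n, ha⟩
  have key₀' (a : Γ(P, q ⁻¹ᵁ U)) (ha : secRes q hle a = 0) :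
      ∃ n : ℕ, q.app U f ^ n * a = 0 := by
    obtain ⟨⟨_, n, rfl⟩, ha⟩ :=
      (IsLocalization.map_eq_zero_iff (Submonoid.powers (q.app U f)) _ a).1 ha
    exact ⟨n, ha⟩
  have hunit : IsUnit (Q.presheaf.map (homOfLE hle).op f) :=
    IsLocalization.map_units (M := Submonoid.powers f) Γ(Q, Q.basicOpen f) ⟨f, 1, pow_one f⟩
  refine ⟨(injective_iff_map_eq_zero _).2 fun x hx => ?_, fun x hx => ?_⟩
  · obtain ⟨n, a, ha⟩ := key x
    have := congr(q.app _ $ha)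
    rw [map_mul, hx, zero_mul, app_res] at this
    obtain ⟨m, hm⟩ := key₀' _ this.symm
    rw [← map_pow, ← map_mul] at hm
    have h0 := H.inj (hm.trans (map_zero _).symm)
    have h1 := congr(Q.presheaf.map (homOfLE hle).op $h0)
    rw [map_mul, map_pow, ← ha, map_zero] at h1
    exact ((hunit.pow n).mul_left_eq_zero).1 (((hunit.pow m).mul_right_eq_zero).1 h1)
  · obtain ⟨n, a, ha⟩ := key' x
    obtain ⟨w, hw, hw'⟩ := hσ.exists_sum_eq h hn U a
    obtain ⟨b, rfl⟩ := H.surj w hw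
    obtain ⟨v, hv⟩ := (hunit.pow n).exists_right_inv
    have e1 : (Nat.card G : Γ(P, q ⁻¹ᵁ Q.basicOpen f)) * secRes q hle (q.app U b) =
        Nat.card G * (x * secRes q hle (q.app U f) ^ n) := by
      have := Fintype.ofFinite G
      rw [← map_natCast (secRes q hle), ← map_mul, hw', finsum_eq_sum_of_fintype, map_sum]
      simp_rw [← secMap_res, ← ha, map_mul, map_pow, hx, ← app_res, secMap_app]
      simp
    have e2 := ((hn.of_hom q).isUnit (q ⁻¹ᵁ Q.basicOpen f)).mul_left_cancel e1
    refine ⟨Q.presheaf.map (homOfLE hle).op b * v, ?_⟩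
    rw [map_mul, app_res, e2, ← app_res, mul_assoc, ← map_pow, ← map_mul, hv, map_one, mul_one]

/-- The quotient property can be checked on an affine open cover. -/
theorem IsQuotientBy.of_cover [Finite G] (hσ : IsAct σ) [IsAffineHom q] (h : ∀ g, σ g ≫ q = q)
    (hn : CardUnit G Q)
    (H : ∀ x : Q, ∃ U : Q.Opens, x ∈ U ∧ IsAffineOpen U ∧ IsInvOn h U) : IsQuotientBy σ q := by
  -- Basic open subsets of the given affine sets form a basis on which the property holds; the sheaf
  -- axioms on `Q` and `P` extend it to all open sets.
  have basis (V : Q.Opens) (x : Q) (hx : x ∈ V) : ∃ W : Q.Opens, x ∈ W ∧ W ≤ V ∧ IsInvOn h W := by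
    obtain ⟨U, hxU, hU, HU⟩ := H x
    obtain ⟨f, hf, hxf⟩ := hU.exists_basicOpen_le ⟨x, hx⟩ hxU
    exact ⟨_, hxf, hf, HU.basicOpen hσ hn hU f⟩
  have inj (V : Q.Opens) : Function.Injective (q.app V) := fun a b hab => by
    choose W hxW hWV HW using fun x : V => basis V x x.2
    refine Q.sheaf.eq_of_locally_eq' W V (fun x => homOfLE (hWV x))
      (fun x hx => TopologicalSpace.Opens.mem_iSup.2 ⟨⟨x, hx⟩, hxW _⟩) a b fun x => ?_
    apply (HW x).inj
    change q.app _ (Q.presheaf.map _ a) = q.app _ (Q.presheaf.map _ b)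
    rw [app_res, app_res, hab]
  refine ⟨inferInstance, h, inj, fun V f hf => ?_⟩
  change ∀ g, secMap (h g) V f = f at hf
  choose W hxW hWV HW using fun x : V => basis V x x.2
  have hf' (x : V) : ∃ a, q.app (W x) a = secRes q (hWV x) f :=
    (HW x).surj _ fun g => by rw [secMap_res, hf]
  choose a ha using hf'
  obtain ⟨s, hs, -⟩ := Q.sheaf.existsUnique_gluing' W V (fun x => homOfLE (hWV x))
    (fun x hx => TopologicalSpace.Opens.mem_iSup.2 ⟨⟨x, hx⟩, hxW _⟩) a (fun x y => by
      apply inj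
      change q.app _ (Q.presheaf.map (homOfLE inf_le_left).op (a x)) =
        q.app _ (Q.presheaf.map (homOfLE inf_le_right).op (a y))
      rw [app_res, app_res, ha, ha]
      simp only [secRes, ← RingHom.comp_apply, ← CommRingCat.hom_comp, ← Functor.map_comp]
      rfl)
  refine ⟨s, P.sheaf.eq_of_locally_eq' (fun x => q ⁻¹ᵁ W x) (q ⁻¹ᵁ V)
    (fun x => homOfLE (q.preimage_mono (hWV x)))
    (fun x hx => TopologicalSpace.Opens.mem_iSup.2 ⟨⟨q x, hx⟩, hxW _⟩) _ _ fun x => ?_⟩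
  exact (app_res (q := q) (hWV x) s).symm.trans (congr(q.app _ $(hs x)).trans (ha x))

end sections

/-! ### Invariants and pushouts of rings -/

section ring

variable {A B C D : CommRingCat.{u}} {a : A ⟶ B} {b : A ⟶ C} {c : B ⟶ D} {d : C ⟶ D}

theorem exists_equiv_tensorProduct (h : IsPushout a b c d) :
    let _ := a.hom.toAlgebra
    let _ := b.hom.toAlgebra
    ∃ e : TensorProduct A B C ≃+* D, (∀ x y, e (x ⊗ₜ y) = c x * d y) := by
  intro _ _
  let i := (CommRingCat.isPushout_tensorProduct A B C).isoIsPushout _ _ h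
  refine ⟨i.commRingCatIsoToRingEquiv, fun x y => ?_⟩
  have h1 := congr($((CommRingCat.isPushout_tensorProduct A B C).inl_isoIsPushout_hom B C h) x)
  have h2 := congr($((CommRingCat.isPushout_tensorProduct A B C).inr_isoIsPushout_hom B C h) y)
  rw [← h1, ← h2]
  change i.commRingCatIsoToRingEquiv (x ⊗ₜ y) = i.commRingCatIsoToRingEquiv (x ⊗ₜ 1) *
    i.commRingCatIsoToRingEquiv (1 ⊗ₜ y)
  rw [← map_mul]
  simp

theorem pushout_induction (h : IsPushout a b c d) {p : D → Prop} (zero : p 0)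
    (add : ∀ x y, p x → p y → p (x + y)) (mul : ∀ x y, p (c x * d y)) (z : D) : p z := by
  let _ := a.hom.toAlgebra
  let _ := b.hom.toAlgebra
  obtain ⟨e, he⟩ := exists_equiv_tensorProduct h
  obtain ⟨z, rfl⟩ := e.surjective z
  induction z with
  | zero => simpa
  | tmul x y => exact he x y ▸ mul x y
  | add x y hx hy => exact map_add e x y ▸ add _ _ hx hy

/-- Invariants commute with arbitrary base change once the order is invertible. The sum over `G` is
an `A`-linear map from `B` to `A` with value the order at 1; after base change it splits `d` up to a
unit, which gives injectivity. Orbit sums of pure tensors come from `C`, and the orbit sum of an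
invariant is a unit multiple of it. -/
theorem isInv_pushout {G : Type*} [Finite G] (h : IsPushout a b c d)
    (σ : G → (B →+* B)) (σ' : G → (D →+* D)) (hc : ∀ g x, σ' g (c x) = c (σ g x))
    (hd : ∀ g x, σ' g (d x) = d x) (ha : ∀ g x, σ g (a x) = a x)
    (hN : IsUnit ((Nat.card G : ℕ) : C)) (inj : Function.Injective a)
    (surj : ∀ x, ∃ y, a y = ∑ᶠ g, σ g x) :
    Function.Injective d ∧ ∀ z, (∀ g, σ' g z = z) → ∃ y, d y = z := by
  have := Fintype.ofFinite G
  obtain ⟨n, hn⟩ := hN.exists_left_inv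
  simp only [finsum_eq_sum_of_fintype] at surj
  let _ := a.hom.toAlgebra
  let _ := b.hom.toAlgebra
  obtain ⟨e, he⟩ := exists_equiv_tensorProduct h
  constructor
  · choose ρ hρ using surj
    let r : B →ₗ[A] A :=
      { toFun := ρ
        map_add' x y := inj <| by
          rw [hρ, map_add, hρ, hρ, ← Finset.sum_add_distrib]
          simp
        map_smul' x y := inj <| by
          change a (ρ (a x * y)) = a (x * ρ y)
          rw [hρ, map_mul, hρ, Finset.mul_sum]
          simp [ha] }
    let F : TensorProduct A B C →ₗ[A] C := TensorProduct.lift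
      ((LinearMap.lsmul A C).comp r)
    have hF (y : C) : F (1 ⊗ₜ y) = Nat.card G * y := by
      change ρ 1 • y = _
      have : ρ 1 = (Nat.card G : ℕ) := inj <| by
        rw [hρ]; simp
      rw [this, Algebra.smul_def, map_natCast]
    refine (injective_iff_map_eq_zero _).2 fun y hy => ?_
    have h1 : (1 : B) ⊗ₜ[A] y = 0 := by
      apply e.injective
      rw [he, map_one, one_mul, hy, map_zero]
    have h2 := hF y
    rw [h1, map_zero] at h2
    calc y = n * (Nat.card G * y) := by rw [← mul_assoc, hn, one_mul]
      _ = 0 := by rw [← h2, mul_zero]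
  · have (z : D) : ∃ y, d y = ∑ g, σ' g z := by
      induction z using pushout_induction h with
      | zero => exact ⟨0, by simp⟩
      | add x y hx hy =>
        obtain ⟨x', hx⟩ := hx
        obtain ⟨y', hy⟩ := hy
        exact ⟨x' + y', by simp [Finset.sum_add_distrib, hx, hy]⟩
      | mul x y =>
        obtain ⟨w, hw⟩ := surj x
        refine ⟨b w * y, ?_⟩
        have : d (b w) = c (a w) := congr($(h.w.symm) w)
        rw [map_mul, this, hw, map_sum, Finset.sum_mul]
        simp [hc, hd]
    intro z hz
    obtain ⟨y, hy⟩ := this z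
    refine ⟨n * y, ?_⟩
    rw [map_mul, hy]
    simp only [hz, Finset.sum_const, Finset.card_univ, nsmul_eq_mul]
    rw [← mul_assoc, Fintype.card_eq_nat_card, ← map_natCast d.hom, ← map_mul, hn, map_one,
      one_mul]

end ring

/-! ### Properties of quotients by finite groups -/

namespace IsQuotientBy

variable {P Q : Scheme.{u}} {q : P ⟶ Q} {G : Type*} {σ : G → (P ⟶ P)}

theorem isInvOn (hq : IsQuotientBy σ q) (U : Q.Opens) : IsInvOn hq.invariant U :=
  ⟨hq.injective U, hq.surjective U⟩

/-- If an open set missed the image, its preimage would be empty, so by injectivity on sections it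
would carry only the zero function and be empty itself. -/
theorem isDominant (hq : IsQuotientBy σ q) : IsDominant q := by
  refine ⟨fun y => mem_closure_iff.2 fun o ho hy => ?_⟩
  by_contra hne
  let U : Q.Opens := ⟨o, ho⟩
  have hU : q ⁻¹ᵁ U = ⊥ := by
    ext x
    simp only [TopologicalSpace.Opens.map_coe, Set.mem_preimage, TopologicalSpace.Opens.coe_bot,
      Set.mem_empty_iff_false, iff_false]
    exact fun hx => hne ⟨_, hx, x, rfl⟩
  have : Subsingleton Γ(P, q ⁻¹ᵁ U) := by
    rw [hU]
    infer_instance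
  have : Subsingleton Γ(Q, U) := (hq.injective U).subsingleton
  have h0 : (1 : Γ(Q, U)) = 0 := Subsingleton.elim _ _
  have h1 : Q.basicOpen (1 : Γ(Q, U)) = U := Scheme.basicOpen_of_isUnit Q isUnit_one
  rw [h0, Scheme.basicOpen_zero] at h1
  have : y ∈ (⊥ : Q.Opens) := by rw [h1]; exact hy
  exact this

variable [Group G]

theorem exists_app_eq_sum [Finite G] (hq : IsQuotientBy σ q) (hσ : IsAct σ) (U : Q.Opens)
    (x : Γ(P, q ⁻¹ᵁ U)) : ∃ y, q.app U y = ∑ᶠ g, secMap (hq.invariant g) U x := by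
  refine (hq.isInvOn U).surj _ fun g => ?_
  let _ := hσ.mulSemiringAction hq.invariant U
  have := Fintype.ofFinite G
  rw [finsum_eq_sum_of_fintype]
  change g • (∑ g' : G, g' • x) = ∑ g' : G, g' • x
  rw [Finset.smul_sum]
  simp only [← mul_smul]
  exact Fintype.sum_equiv (Equiv.mulLeft g) _ _ fun _ => rfl

/-- Quotients by a finite group of invertible order commute with arbitrary base change. -/
theorem of_isPullback [Finite G] (hq : IsQuotientBy σ q) (hσ : IsAct σ) (hn : CardUnit G Q)
    {P' T : Scheme.{u}} {p' : P' ⟶ P} {q' : P' ⟶ T} {t : T ⟶ Q} (h : IsPullback p' q' q t)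
    {σ' : G → (P' ⟶ P')} (h1 : ∀ g, σ' g ≫ p' = p' ≫ σ g) (h2 : ∀ g, σ' g ≫ q' = q') :
    IsQuotientBy σ' q' := by
  have := hq.affine
  have : IsAffineHom q' := MorphismProperty.of_isPullback (P := @IsAffineHom) h ‹_›
  have hσ' : IsAct σ' := by
    refine ⟨h.hom_ext ?_ ?_, fun g g' => h.hom_ext ?_ ?_⟩
    · rw [h1, hσ.one]; simp
    · rw [h2]; simp
    · rw [h1, hσ.mul, Category.assoc, h1, reassoc_of% (h1 g)]
    · rw [h2, Category.assoc, h2, h2]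
  refine of_cover hσ' h2 (hn.of_hom t) fun x => ?_
  obtain ⟨_, ⟨U, hU, rfl⟩, hxU, -⟩ :=
    Q.isBasis_affineOpens.exists_subset_of_mem_open (Set.mem_univ (t x)) isOpen_univ
  obtain ⟨_, ⟨V, hV, rfl⟩, hxV, hVU⟩ :=
    T.isBasis_affineOpens.exists_subset_of_mem_open (show x ∈ t ⁻¹ᵁ U from hxU) (t ⁻¹ᵁ U).2
  refine ⟨V, hxV, hV, ?_⟩
  have e : q' ⁻¹ᵁ V = p' ⁻¹ᵁ q ⁻¹ᵁ U ⊓ q' ⁻¹ᵁ V := by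
    refine le_antisymm (le_inf ?_ le_rfl) inf_le_right
    rw [← Scheme.Hom.comp_preimage, h.w, Scheme.Hom.comp_preimage]
    exact q'.preimage_mono hVU
  -- Over affine opens the fibre square is a pushout of rings of functions, which reduces the claim
  -- to `isInv_pushout`.
  have H := (isIso_pushoutSection_iff h hVU le_rfl e).1
    (isIso_pushoutSection_of_isAffineOpen h hVU le_rfl e hU hV (hU.preimage q))
  simp only [Scheme.Hom.appLE_eq_app] at H
  have comm (g : G) (x : Γ(P, q ⁻¹ᵁ U)) :
      secMap (h2 g) V (p'.appLE (q ⁻¹ᵁ U) (q' ⁻¹ᵁ V) (e.le.trans inf_le_left) x) =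
        p'.appLE (q ⁻¹ᵁ U) (q' ⁻¹ᵁ V) (e.le.trans inf_le_left)
          (secMap (hq.invariant g) U x) := by
    change (p'.appLE (q ⁻¹ᵁ U) (q' ⁻¹ᵁ V) _ ≫ (σ' g).appLE _ _ _) x =
      ((σ g).appLE _ _ _ ≫ p'.appLE _ _ _) x
    rw [Scheme.Hom.appLE_comp_appLE, Scheme.Hom.appLE_comp_appLE]
    simp only [h1]
  obtain ⟨i, s⟩ := isInv_pushout H (fun g => secMap (hq.invariant g) U)
    (fun g => secMap (h2 g) V) comm (fun g x => secMap_app _ _ _)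
    (fun g x => secMap_app _ _ _) ((hn.of_hom t).isUnit V) (hq.injective U)
    (hq.exists_app_eq_sum hσ U)
  exact ⟨i, s⟩

theorem isIntegralHom [Finite G] (hq : IsQuotientBy σ q) (hσ : IsAct σ) : IsIntegralHom q := by
  have := hq.affine
  refine ⟨fun U hU => ?_⟩
  let _ := hσ.mulSemiringAction hq.invariant U
  let _ := (q.app U).hom.toAlgebra
  have : Algebra.IsInvariant Γ(Q, U) Γ(P, q ⁻¹ᵁ U) G := ⟨(hq.isInvOn U).surj⟩
  exact (Algebra.IsInvariant.isIntegral Γ(Q, U) Γ(P, q ⁻¹ᵁ U) G).isIntegral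

theorem surj [Finite G] (hq : IsQuotientBy σ q) (hσ : IsAct σ) : Surjective q := by
  have := hq.isIntegralHom hσ
  have := hq.isDominant
  infer_instance

/-- The fibres of the quotient are the orbits. -/
theorem exists_act_eq [Finite G] (hq : IsQuotientBy σ q) (hσ : IsAct σ) {x y : P}
    (h : q x = q y) : ∃ g, σ g x = y := by
  have := hq.affine
  obtain ⟨_, ⟨U, hU, rfl⟩, hxU, -⟩ :=
    Q.isBasis_affineOpens.exists_subset_of_mem_open (Set.mem_univ (q x)) isOpen_univ
  have hV := hU.preimage q
  have hyU : q y ∈ U := h ▸ hxU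
  obtain ⟨x, rfl⟩ : x ∈ Set.range hV.fromSpec := by rw [hV.range_fromSpec]; exact hxU
  obtain ⟨y, rfl⟩ : y ∈ Set.range hV.fromSpec := by rw [hV.range_fromSpec]; exact hyU
  let _ := hσ.mulSemiringAction hq.invariant U
  let _ := (q.app U).hom.toAlgebra
  have : Algebra.IsInvariant Γ(Q, U) Γ(P, q ⁻¹ᵁ U) G := ⟨(hq.isInvOn U).surj⟩
  have : SMulCommClass G Γ(Q, U) Γ(P, q ⁻¹ᵁ U) := ⟨fun g a b => by
    change secMap _ _ (q.app U a * b) = q.app U a * secMap _ _ b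
    rw [map_mul, secMap_app]⟩
  have h1 : Spec.map (q.app U) x = Spec.map (q.app U) y := by
    have hoi : IsOpenImmersion hU.fromSpec := hU.isOpenImmersion_fromSpec
    apply hU.fromSpec.isOpenEmbedding.injective
    have := hU.SpecMap_appLE_fromSpec q hV le_rfl
    rw [Scheme.Hom.appLE_eq_app] at this
    rwa [← Scheme.Hom.comp_apply, ← Scheme.Hom.comp_apply, this, Scheme.Hom.comp_apply,
      Scheme.Hom.comp_apply]
  have hx : x.asIdeal.IsPrime := PrimeSpectrum.isPrime x
  have hy : y.asIdeal.IsPrime := PrimeSpectrum.isPrime y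
  -- A finite group acts transitively on the primes above a given prime of the ring of invariants.
  -- The inverse below appears because `g • I` is the preimage of `I` under the action of `g⁻¹`.
  obtain ⟨g, hg⟩ := Algebra.IsInvariant.exists_smul_of_under_eq Γ(Q, U) Γ(P, q ⁻¹ᵁ U) G
    x.asIdeal y.asIdeal congr(PrimeSpectrum.asIdeal $h1)
  refine ⟨g⁻¹, ?_⟩
  have h2 := hV.SpecMap_appLE_fromSpec (σ g⁻¹) hV
    (by rw [← Scheme.Hom.comp_preimage, hq.invariant])
  rw [← Scheme.Hom.comp_apply, ← h2, Scheme.Hom.comp_apply]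
  congr 1
  apply PrimeSpectrum.ext
  rw [hg, Ideal.pointwise_smul_eq_comap]
  rfl

end IsQuotientBy

theorem exists_comp_eq_of_injective {A B C : Type*} [CommRing A] [CommRing B] [CommRing C]
    {i : B →+* C} (hi : Function.Injective i) (ψ : A →+* C) (h : ∀ a, ∃ b, i b = ψ a) :
    ∃ χ : A →+* B, i.comp χ = ψ := by
  choose χ hχ using h
  refine ⟨⟨⟨⟨χ, ?_⟩, ?_⟩, ?_, ?_⟩, RingHom.ext hχ⟩
  · apply hi; rw [hχ, map_one, map_one]
  · intro x y; apply hi; rw [hχ, map_mul, map_mul, hχ, hχ]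
  · apply hi; simp [hχ]
  · intro x y; apply hi; simp [hχ]

theorem morphismRestrict_isoSpec {X Y : Scheme.{u}} (f : X ⟶ Y) {U : Y.Opens}
    (hU : IsAffineOpen U) (hV : IsAffineOpen (f ⁻¹ᵁ U)) :
    (f ∣_ U) ≫ hU.isoSpec.hom = hV.isoSpec.hom ≫ Spec.map (f.app U) := by
  have : IsOpenImmersion hU.fromSpec := hU.isOpenImmersion_fromSpec
  rw [← cancel_mono hU.fromSpec, Category.assoc, hU.isoSpec_hom_fromSpec, morphismRestrict_ι,
    Category.assoc, ← Scheme.Hom.appLE_eq_app, hU.SpecMap_appLE_fromSpec f hV,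
    hV.isoSpec_hom_fromSpec_assoc]

/-! ### The universal property and the uniqueness of quotients -/

namespace IsQuotientBy

variable {P Q : Scheme.{u}} {q : P ⟶ Q} {G : Type*} [Group G] {σ : G → (P ⟶ P)}

/-- Surjectivity determines the continuous map out of the quotient, and injectivity on sections
determines the map of sheaves. -/
theorem epi [Finite G] (hq : IsQuotientBy σ q) (hσ : IsAct σ) : Epi q := by
  refine ⟨fun {T} a b hab => ?_⟩
  have hs := (hq.surj hσ).surj
  have hbase : a.base = b.base := by
    ext x
    obtain ⟨y, rfl⟩ := hs x
    exact congr($hab y)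
  refine Scheme.Hom.ext hbase fun U => ?_
  ext s
  apply hq.injective (b ⁻¹ᵁ U)
  have hle : b ⁻¹ᵁ U ≤ a ⁻¹ᵁ U := by
    intro x hx
    change a.base x ∈ U
    rw [hbase]
    exact hx
  have h1 : (q.app (b ⁻¹ᵁ U)) (a.appLE U (b ⁻¹ᵁ U) hle s) = q.app (b ⁻¹ᵁ U) (b.app U s) := by
    rw [← Scheme.Hom.appLE_eq_app, ← Scheme.Hom.appLE_eq_app, ← CommRingCat.comp_apply,
      ← CommRingCat.comp_apply, Scheme.Hom.appLE_comp_appLE, Scheme.Hom.appLE_comp_appLE]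
    simp only [hab]
  exact h1

theorem isQuotientMap [Finite G] (hq : IsQuotientBy σ q) (hσ : IsAct σ) :
    Topology.IsQuotientMap q := by
  have := hq.isIntegralHom hσ
  exact q.isClosedMap.isQuotientMap q.continuous (hq.surj hσ).surj

/-- The action on a base change. -/
def pullbackAct (h : ∀ g, σ g ≫ q = q) {T : Scheme.{u}} (t : T ⟶ Q) (g : G) :
    pullback q t ⟶ pullback q t :=
  pullback.lift (pullback.fst q t ≫ σ g) (pullback.snd q t)
    (by rw [Category.assoc, h, pullback.condition])

omit [Group G] in
theorem pullbackAct_fst (h : ∀ g, σ g ≫ q = q) {T : Scheme.{u}} (t : T ⟶ Q) (g : G) :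
    pullbackAct h t g ≫ pullback.fst q t = pullback.fst q t ≫ σ g := pullback.lift_fst _ _ _

omit [Group G] in
theorem pullbackAct_snd (h : ∀ g, σ g ≫ q = q) {T : Scheme.{u}} (t : T ⟶ Q) (g : G) :
    pullbackAct h t g ≫ pullback.snd q t = pullback.snd q t := pullback.lift_snd _ _ _

theorem baseChange [Finite G] (hq : IsQuotientBy σ q) (hσ : IsAct σ) (hn : CardUnit G Q)
    {T : Scheme.{u}} (t : T ⟶ Q) :
    IsQuotientBy (pullbackAct hq.invariant t) (pullback.snd q t) :=
  hq.of_isPullback hσ hn (IsPullback.of_hasPullback q t) (pullbackAct_fst _ t) (pullbackAct_snd _ t)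

/-- Quotients stay quotients under base change, hence are universal epimorphisms. This is what
allows local descents to be compared on overlaps. -/
theorem epi_snd [Finite G] (hq : IsQuotientBy σ q) (hσ : IsAct σ) (hn : CardUnit G Q)
    {T : Scheme.{u}} (t : T ⟶ Q) : Epi (pullback.snd q t) := by
  refine (hq.baseChange hσ hn t).epi ⟨?_, fun g h => ?_⟩
  · ext1 <;> simp [hσ.one, pullbackAct_fst, pullbackAct_snd]
  · ext1 <;> simp [hσ.mul, reassoc_of% (pullbackAct_fst (σ := σ) hq.invariant t), pullbackAct_fst, pullbackAct_snd]

omit [Group G] in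
theorem exists_local_desc [Finite G] (hq : IsQuotientBy σ q) {T : Scheme.{u}} (f : P ⟶ T)
    (hf : ∀ g, σ g ≫ f = f) {U : T.Opens} (hU : IsAffineOpen U) {W : Q.Opens}
    (hW : IsAffineOpen W) (hle : q ⁻¹ᵁ W ≤ f ⁻¹ᵁ U) :
    ∃ m : W.toScheme ⟶ T, (q ∣_ W) ≫ m = (q ⁻¹ᵁ W).ι ≫ f := by
  have := hq.affine
  have hV := hW.preimage q
  obtain ⟨χ, hχ⟩ := exists_comp_eq_of_injective (hq.injective W) (f.appLE U (q ⁻¹ᵁ W) hle).hom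
    fun a => by
      refine (hq.isInvOn W).surj _ fun g => ?_
      change (f.appLE _ _ _ ≫ (σ g).appLE _ _ _) a = _
      rw [Scheme.Hom.appLE_comp_appLE]
      simp only [hf]
  refine ⟨hW.isoSpec.hom ≫ Spec.map (CommRingCat.ofHom χ) ≫ hU.fromSpec, ?_⟩
  have h1 : CommRingCat.ofHom χ ≫ q.app W = f.appLE U (q ⁻¹ᵁ W) hle := by
    ext x
    exact congr($hχ x)
  rw [← Category.assoc, morphismRestrict_isoSpec q hW hV, Category.assoc, ← Spec.map_comp_assoc,
    h1, hU.SpecMap_appLE_fromSpec f hV, hV.isoSpec_hom_fromSpec_assoc]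

/-- The universal property of the quotient. -/
theorem exists_desc [Finite G] (hq : IsQuotientBy σ q) (hσ : IsAct σ) (hn : CardUnit G Q)
    {T : Scheme.{u}} (f : P ⟶ T) (hf : ∀ g, σ g ≫ f = f) : ∃ m : Q ⟶ T, q ≫ m = f := by
  have hs := (hq.surj hσ).surj
  let φ : Q → T := fun y => f (Function.surjInv hs y)
  -- Since the fibres of `q` are orbits and `f` is invariant, `f` descends as a map of sets; it is
  -- continuous because `q` is a topological quotient map.
  have hφ (x : P) : φ (q x) = f x := by
    obtain ⟨g, hg⟩ := hq.exists_act_eq hσ (Function.surjInv_eq hs (q x))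
    conv_rhs => rw [← hg, ← Scheme.Hom.comp_apply, hf]
  have hφc : Continuous φ := (hq.isQuotientMap hσ).continuous_iff.2 <| by
    convert! f.continuous using 1
    exact funext hφ
  have key (y : Q) : ∃ W : Q.Opens, y ∈ W ∧ ∃ m : W.toScheme ⟶ T,
      (q ∣_ W) ≫ m = (q ⁻¹ᵁ W).ι ≫ f := by
    obtain ⟨_, ⟨U, hU, rfl⟩, hyU, -⟩ :=
      T.isBasis_affineOpens.exists_subset_of_mem_open (Set.mem_univ (φ y)) isOpen_univ
    obtain ⟨_, ⟨W, hW, rfl⟩, hyW, hWU⟩ := Q.isBasis_affineOpens.exists_subset_of_mem_open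
      (show y ∈ φ ⁻¹' U from hyU) (U.isOpen.preimage hφc)
    refine ⟨W, hyW, hq.exists_local_desc f hf hU hW fun x hx => ?_⟩
    have : φ (q x) ∈ U := hWU hx
    rwa [hφ] at this
  choose W hyW m hm using key
  have hcov : TopologicalSpace.IsOpenCover W := by
    rw [TopologicalSpace.IsOpenCover, eq_top_iff]
    exact fun x _ => TopologicalSpace.Opens.mem_iSup.2 ⟨x, hyW x⟩
  let 𝒰 := Q.openCoverOfIsOpenCover W hcov
  have hloc (y : Q) {R : Scheme.{u}} (r : R ⟶ Q) (s : R ⟶ (W y).toScheme)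
      (hs : s ≫ (W y).ι = r) : pullback.snd q r ≫ s ≫ m y = pullback.fst q r ≫ f := by
    let l := (isPullback_morphismRestrict q (W y)).lift (pullback.snd q r ≫ s) (pullback.fst q r)
      (by rw [Category.assoc, hs, pullback.condition])
    have e1 : l ≫ (q ∣_ W y) = pullback.snd q r ≫ s := IsPullback.lift_fst _ _ _ _
    have e2 : l ≫ (q ⁻¹ᵁ W y).ι = pullback.fst q r := IsPullback.lift_snd _ _ _ _
    rw [← reassoc_of% e1, hm, reassoc_of% e2]
  refine ⟨𝒰.glueMorphisms m fun x y => ?_, ?_⟩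
  -- Two local descents agree on an overlap because both become `f` on its preimage in `P`, which
  -- maps epimorphically to it.
  · have := hq.epi_snd hσ hn (pullback.fst (𝒰.f x) (𝒰.f y) ≫ (W x).ι)
    rw [← cancel_epi (pullback.snd q (pullback.fst (𝒰.f x) (𝒰.f y) ≫ (W x).ι))]
    exact (hloc x _ (pullback.fst (𝒰.f x) (𝒰.f y)) rfl).trans
      (hloc y _ (pullback.snd (𝒰.f x) (𝒰.f y)) pullback.condition.symm).symm
  · refine Scheme.Cover.hom_ext (𝒰.pullback₁ q) _ _ fun y => ?_
    have h1 := hloc y (W y).ι (𝟙 _) (Category.id_comp _)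
    rw [Category.id_comp] at h1
    change pullback.fst q (W y).ι ≫ q ≫ _ = pullback.fst q (W y).ι ≫ f
    rw [← h1, pullback.condition_assoc]
    congr 1
    exact 𝒰.ι_glueMorphisms m _ y

/-- Quotients are unique. -/
theorem exists_iso [Finite G] (hq : IsQuotientBy σ q) (hσ : IsAct σ) (hn : CardUnit G Q)
    {Q' : Scheme.{u}} {q' : P ⟶ Q'} (hq' : IsQuotientBy σ q') (hn' : CardUnit G Q') :
    ∃ e : Q ≅ Q', q ≫ e.hom = q' := by
  obtain ⟨a, ha⟩ := hq.exists_desc hσ hn q' hq'.invariant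
  obtain ⟨b, hb⟩ := hq'.exists_desc hσ hn' q hq.invariant
  have := hq.epi hσ
  have := hq'.epi hσ
  refine ⟨⟨a, b, ?_, ?_⟩, ha⟩
  · rw [← cancel_epi q, reassoc_of% ha, hb, Category.comp_id]
  · rw [← cancel_epi q', reassoc_of% hb, ha, Category.comp_id]

omit [Group G] in
theorem comp_iso (hq : IsQuotientBy σ q) {Q' : Scheme.{u}} (e : Q ≅ Q') :
    IsQuotientBy σ (q ≫ e.hom) := by
  have := hq.affine
  refine ⟨inferInstance, fun g => by rw [← Category.assoc, hq.invariant],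
    fun U => ?_, fun U f hf => ?_⟩
  · rw [Scheme.Hom.comp_app]
    exact (hq.injective _).comp (ConcreteCategory.bijective_of_isIso (e.hom.app U)).1
  · obtain ⟨a, ha⟩ := hq.surjective (e.hom ⁻¹ᵁ U) f hf
    obtain ⟨b, rfl⟩ := (ConcreteCategory.bijective_of_isIso (e.hom.app U)).2 a
    refine ⟨b, ?_⟩
    rw [Scheme.Hom.comp_app]
    exact ha

end IsQuotientBy

/-! ### Stable open subsets -/

section res

variable {G : Type*} [Group G] {P : Scheme.{u}} {σ : G → (P ⟶ P)}

/-- The restriction of an action to a stable open subset. -/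
def resAct (σ : G → (P ⟶ P)) (U : P.Opens) (hU : ∀ g, U ≤ σ g ⁻¹ᵁ U) (g : G) :
    U.toScheme ⟶ U.toScheme := (σ g).resLE U U (hU g)

omit [Group G] in
@[simp]
theorem resAct_ι (U : P.Opens) (hU : ∀ g, U ≤ σ g ⁻¹ᵁ U) (g : G) :
    resAct σ U hU g ≫ U.ι = U.ι ≫ σ g := Scheme.Hom.resLE_comp_ι _ _

omit [Group G] in
@[simp]
theorem resAct_ι_assoc (U : P.Opens) (hU : ∀ g, U ≤ σ g ⁻¹ᵁ U) (g : G) {Z : Scheme.{u}}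
    (f : P ⟶ Z) : resAct σ U hU g ≫ U.ι ≫ f = U.ι ≫ σ g ≫ f := by
  rw [← Category.assoc, resAct_ι, Category.assoc]

theorem IsAct.res (hσ : IsAct σ) (U : P.Opens) (hU : ∀ g, U ≤ σ g ⁻¹ᵁ U) :
    IsAct (resAct σ U hU) := by
  refine ⟨?_, fun g h => ?_⟩
  · rw [← cancel_mono U.ι, resAct_ι, hσ.one]; simp
  · rw [← cancel_mono U.ι, resAct_ι, hσ.mul]; simp

omit [Group G] in
theorem IsQuotientBy.stable {Q : Scheme.{u}} {q : P ⟶ Q} (hq : IsQuotientBy σ q) (V : Q.Opens)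
    (g : G) : q ⁻¹ᵁ V ≤ σ g ⁻¹ᵁ q ⁻¹ᵁ V := by
  rw [← Scheme.Hom.comp_preimage, hq.invariant]

theorem IsQuotientBy.restrict [Finite G] {Q : Scheme.{u}} {q : P ⟶ Q} (hq : IsQuotientBy σ q)
    (hσ : IsAct σ) (hn : CardUnit G Q) (V : Q.Opens) :
    IsQuotientBy (resAct σ (q ⁻¹ᵁ V) (hq.stable V)) (q ∣_ V) := by
  refine hq.of_isPullback hσ hn (isPullback_morphismRestrict q V).flip (fun g => by simp)
    fun g => ?_
  rw [← cancel_mono V.ι, Category.assoc, morphismRestrict_ι, resAct_ι_assoc, hq.invariant]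

theorem secMap_top {Q : Scheme.{u}} {q : P ⟶ Q} {τ : P ⟶ P} (h : τ ≫ q = q)
    (x : Γ(P, ⊤)) : secMap h ⊤ x = τ.appTop x := by
  change τ.appLE ⊤ ⊤ _ x = τ.app ⊤ x
  rw [← Scheme.Hom.appLE_eq_app]
  rfl

theorem IsQuotientBy.of_isAffine [Finite G] {Q : Scheme.{u}} [IsAffine P] [IsAffine Q]
    {q : P ⟶ Q} (hσ : IsAct σ) (hn : CardUnit G Q) (hinv : ∀ g, σ g ≫ q = q)
    (hinj : Function.Injective q.appTop)
    (hsurj : ∀ x, (∀ g, (σ g).appTop x = x) → ∃ a, q.appTop a = x) : IsQuotientBy σ q :=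
  .of_cover hσ hinv hn fun _ => ⟨⊤, trivial, isAffineOpen_top Q, hinj, fun f hf =>
    hsurj f fun g => (secMap_top (hinv g) f).symm.trans (hf g)⟩

theorem exists_quotient_of_isAffine [Finite G] [IsAffine P] (hσ : IsAct σ) (hn : CardUnit G P) :
    ∃ (Q : Scheme.{u}) (q : P ⟶ Q), IsAffine Q ∧ CardUnit G Q ∧ IsQuotientBy σ q := by
  let R : Subring Γ(P, ⊤) :=
    { carrier := {x | ∀ g, (σ g).appTop x = x}
      mul_mem' := fun hx hy g => by rw [map_mul, hx, hy]
      one_mem' := fun g => map_one _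
      add_mem' := fun hx hy g => by rw [map_add, hx, hy]
      zero_mem' := fun g => map_zero _
      neg_mem' := fun hx g => by rw [map_neg, hx] }
  let i : CommRingCat.of R ⟶ Γ(P, ⊤) := CommRingCat.ofHom R.subtype
  let q : P ⟶ Spec (.of R) := P.toSpecΓ ≫ Spec.map i
  have hq : q.appTop = (Scheme.ΓSpecIso _).hom ≫ i := by
    simp [q, Scheme.toSpecΓ_appTop, Scheme.ΓSpecIso_naturality]
  -- The inverse of the group order is invariant, so the order is already invertible in the ring of
  -- invariants.
  have hN : IsUnit ((Nat.card G : ℕ) : R) := by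
    obtain ⟨c, hc⟩ := IsUnit.exists_right_inv hn
    refine IsUnit.of_mul_eq_one ⟨c, fun g => ?_⟩ (Subtype.ext (by simpa using hc))
    have := congr((σ g).appTop $hc)
    rw [map_mul, map_natCast, map_one, ← hc] at this
    exact IsUnit.mul_left_cancel hn this
  have hN' : CardUnit G (Spec (.of R)) := by
    have := hN.map (Scheme.ΓSpecIso (.of R)).inv.hom
    rwa [map_natCast] at this
  refine ⟨Spec (.of R), q, inferInstance, hN', .of_isAffine hσ hN' (fun g => ?_) ?_ ?_⟩
  · simp only [q]
    rw [Scheme.toSpecΓ_naturality_assoc, ← Spec.map_comp]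
    congr 2
    ext x
    exact x.2 g
  · rw [hq]
    exact Subtype.val_injective.comp
      (ConcreteCategory.bijective_of_isIso (Scheme.ΓSpecIso (.of R)).hom).1
  · intro x hx
    obtain ⟨a, ha⟩ :=
      (ConcreteCategory.bijective_of_isIso (Scheme.ΓSpecIso (.of R)).hom).2 ⟨x, hx⟩
    refine ⟨a, ?_⟩
    rw [hq]
    exact congr(i $ha)

omit [Group G] in
theorem CardUnit.opens {X : Scheme.{u}} (h : CardUnit G X) (U : X.Opens) :
    CardUnit G U.toScheme := h.of_hom U.ι

/-- A stable open set is saturated because the fibres are orbits, and the topology of `Q` is the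
quotient topology. -/
theorem IsQuotientBy.exists_image [Finite G] {Q : Scheme.{u}} {q : P ⟶ Q}
    (hq : IsQuotientBy σ q) (hσ : IsAct σ) (U : P.Opens) (hU : ∀ g, U ≤ σ g ⁻¹ᵁ U) :
    ∃ V : Q.Opens, q ⁻¹ᵁ V = U := by
  have e : q ⁻¹' (q '' (U : Set P)) = U := by
    refine subset_antisymm ?_ (Set.subset_preimage_image _ _)
    rintro x ⟨y, hy, hxy⟩
    obtain ⟨g, rfl⟩ := hq.exists_act_eq hσ hxy
    exact hU g hy
  refine ⟨⟨q '' U, (hq.isQuotientMap hσ).isOpen_preimage.1 ?_⟩, TopologicalSpace.Opens.ext e⟩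
  rw [e]
  exact U.isOpen

/-- `V` is the quotient of its affine preimage, and by uniqueness of quotients it is isomorphic to
the affine quotient given by the ring of invariants. -/
theorem IsQuotientBy.isAffineOpen [Finite G] {Q : Scheme.{u}} {q : P ⟶ Q}
    (hq : IsQuotientBy σ q) (hσ : IsAct σ) (hn : CardUnit G Q) (V : Q.Opens)
    (hV : IsAffineOpen (q ⁻¹ᵁ V)) : IsAffineOpen V := by
  have : IsAffine (q ⁻¹ᵁ V).toScheme := hV
  have hσ' := hσ.res _ (hq.stable V)
  obtain ⟨Q', q', hQ', hn', hq'⟩ := exists_quotient_of_isAffine hσ' ((hn.of_hom q).opens _)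
  obtain ⟨e, -⟩ := (hq.restrict hσ hn V).exists_iso hσ' (hn.opens V) hq' hn'
  exact IsAffine.of_isIso e.hom

end res

/-! ### Existence of quotients -/

section existence

variable {G : Type*} [Group G] {P Q : Scheme.{u}} {σ : G → (P ⟶ P)} {q : P ⟶ Q}

omit [Group G] in
theorem IsQuotientBy.iso_comp (hq : IsQuotientBy σ q) {P' : Scheme.{u}} (e : P' ≅ P)
    {σ' : G → (P' ⟶ P')} (he : ∀ g, σ' g ≫ e.hom = e.hom ≫ σ g) :
    IsQuotientBy σ' (e.hom ≫ q) := by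
  have := hq.affine
  have hinv (g : G) : σ' g ≫ e.hom ≫ q = e.hom ≫ q := by
    rw [reassoc_of% he, hq.invariant]
  refine ⟨inferInstance, hinv, fun U => ?_, fun U f hf => ?_⟩
  · rw [Scheme.Hom.comp_app]
    exact (ConcreteCategory.bijective_of_isIso (e.hom.app _)).1.comp (hq.injective _)
  · obtain ⟨a, rfl⟩ := (ConcreteCategory.bijective_of_isIso (e.hom.app (q ⁻¹ᵁ U))).2 f
    obtain ⟨b, rfl⟩ := hq.surjective U a fun g => by
      apply (ConcreteCategory.bijective_of_isIso (e.hom.app (q ⁻¹ᵁ U))).1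
      refine Eq.trans ?_ (hf g)
      rw [← Scheme.Hom.appLE_eq_app]
      have hle : e.hom ⁻¹ᵁ q ⁻¹ᵁ U ≤ σ' g ⁻¹ᵁ (e.hom ⁻¹ᵁ q ⁻¹ᵁ U) := by
        rw [← Scheme.Hom.comp_preimage, ← Scheme.Hom.comp_preimage, hinv]
      change ((σ g).appLE _ _ _ ≫ e.hom.appLE _ _ _) a =
        (e.hom.appLE _ _ le_rfl ≫ (σ' g).appLE (e.hom ⁻¹ᵁ q ⁻¹ᵁ U) (e.hom ⁻¹ᵁ q ⁻¹ᵁ U) hle) a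
      rw [Scheme.Hom.appLE_comp_appLE, Scheme.Hom.appLE_comp_appLE]
      simp only [he]
    exact ⟨b, by rw [Scheme.Hom.comp_app]; rfl⟩

/-- A stable open immersion induces an open immersion on quotients. -/
theorem IsQuotientBy.isOpenImmersion [Finite G] (hq : IsQuotientBy σ q) (hσ : IsAct σ)
    (hn : CardUnit G Q) {P' Q' : Scheme.{u}} {σ' : G → (P' ⟶ P')} {q' : P' ⟶ Q'}
    (hq' : IsQuotientBy σ' q') (hσ' : IsAct σ') (hn' : CardUnit G Q') {j : P' ⟶ P}
    [IsOpenImmersion j] (hj : ∀ g, σ' g ≫ j = j ≫ σ g) {m : Q' ⟶ Q} (hm : q' ≫ m = j ≫ q) :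
    ∃ _ : IsOpenImmersion m, q ⁻¹ᵁ m.opensRange = j.opensRange := by
  obtain ⟨V, hV⟩ := hq.exists_image hσ j.opensRange fun g => by
    rintro _ ⟨x, rfl⟩
    exact ⟨σ' g x, by rw [← Scheme.Hom.comp_apply, hj, Scheme.Hom.comp_apply]⟩
  let e := IsOpenImmersion.isoOfRangeEq j (q ⁻¹ᵁ V).ι (by rw [hV]; simp)
  have he : e.hom ≫ (q ⁻¹ᵁ V).ι = j := IsOpenImmersion.isoOfRangeEq_hom_fac _ _ _
  have h1 := (hq.restrict hσ hn V).iso_comp e (σ' := σ') fun g => by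
    rw [← cancel_mono (q ⁻¹ᵁ V).ι, Category.assoc, Category.assoc, he, hj, resAct_ι,
      reassoc_of% he]
  obtain ⟨i, hi⟩ := hq'.exists_iso hσ' hn' h1 (hn.opens V)
  have := hq'.epi hσ'
  have hmi : m = i.hom ≫ V.ι := by
    rw [← cancel_epi q', hm, reassoc_of% hi, morphismRestrict_ι, reassoc_of% he]
  have : IsOpenImmersion m := hmi ▸ inferInstance
  have hr : m.opensRange = V := by
    have h := Scheme.Hom.opensRange_comp_of_isIso i.hom V.ι
    simp only [← hmi, Scheme.Opens.opensRange_ι] at h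
    exact h
  exact ⟨this, by rw [hr, hV]⟩

/-- The quotient property can be checked on an open cover of the target. -/
theorem IsQuotientBy.of_openCover [Finite G] (hσ : IsAct σ) (hn : CardUnit G Q)
    (hinv : ∀ g, σ g ≫ q = q)
    (H : ∀ x : Q, ∃ (P' Q' : Scheme.{u}) (q' : P' ⟶ Q') (j : P' ⟶ P) (m : Q' ⟶ Q)
      (σ' : G → (P' ⟶ P')), x ∈ Set.range m ∧ IsOpenImmersion m ∧ IsPullback j q' q m ∧
        (∀ g, σ' g ≫ j = j ≫ σ g) ∧ IsQuotientBy σ' q') : IsQuotientBy σ q := by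
  have key (x : Q) : ∃ W : Q.Opens, x ∈ W ∧ IsAffineOpen W ∧ IsAffineOpen (q ⁻¹ᵁ W) ∧
      IsInvOn hinv W := by
    obtain ⟨P', Q', q', j, m, σ', hx, hm, hpb, hj, hq'⟩ := H x
    have hjo : IsOpenImmersion j := MorphismProperty.of_isPullback hpb.flip hm
    obtain ⟨_, ⟨W, hW, rfl⟩, hxW, hWm⟩ := Q.isBasis_affineOpens.exists_subset_of_mem_open
      (show x ∈ m.opensRange from hx) m.opensRange.2
    have hrange : q ⁻¹ᵁ m.opensRange = j.opensRange := by
      ext y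
      constructor
      · rintro ⟨z, hz⟩
        obtain ⟨w, hw, -⟩ := Scheme.exists_preimage_of_isPullback hpb y z hz.symm
        exact ⟨w, hw⟩
      · rintro ⟨w, rfl⟩
        refine ⟨q' w, ?_⟩
        rw [← Scheme.Hom.comp_apply, ← hpb.w]
        rfl
    have hle : q ⁻¹ᵁ W ≤ j.opensRange := hrange ▸ q.preimage_mono hWm
    have hW' : IsAffineOpen (m ⁻¹ᵁ W) := hW.preimage_of_isOpenImmersion m hWm
    have hWj : j ⁻¹ᵁ q ⁻¹ᵁ W = q' ⁻¹ᵁ m ⁻¹ᵁ W := by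
      rw [← Scheme.Hom.comp_preimage, ← Scheme.Hom.comp_preimage, hpb.w]
    have := hq'.affine
    have haff : IsAffineOpen (q ⁻¹ᵁ W) := by
      have h1 : IsAffineOpen (j ⁻¹ᵁ q ⁻¹ᵁ W) := hWj ▸ hW'.preimage q'
      have h2 := h1.image_of_isOpenImmersion j
      rwa [Scheme.Hom.image_preimage_eq_opensRange_inf, inf_eq_right.2 hle] at h2
    refine ⟨W, hxW, hW, haff, ?_⟩
    have i1 : IsIso (m.app W) := m.isIso_app W hWm
    have i2 : IsIso (j.app (q ⁻¹ᵁ W)) := j.isIso_app _ hle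
    let α : Γ(P, q ⁻¹ᵁ W) ⟶ Γ(P', q' ⁻¹ᵁ m ⁻¹ᵁ W) := j.appLE _ _ hWj.ge
    have hα : IsIso α := by
      dsimp only [α, Scheme.Hom.appLE]
      have : IsIso (homOfLE hWj.ge) := (eqToIso hWj.symm).isIso_hom
      infer_instance
    have sq (a : Γ(Q, W)) : α (q.app W a) = q'.app _ (m.app W a) := by
      simp only [α, ← Scheme.Hom.appLE_eq_app]
      rw [← CommRingCat.comp_apply, ← CommRingCat.comp_apply, Scheme.Hom.appLE_comp_appLE,
        Scheme.Hom.appLE_comp_appLE]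
      simp only [hpb.w]
    have αinj := (ConcreteCategory.bijective_of_isIso α).1
    have mbij := ConcreteCategory.bijective_of_isIso (m.app W)
    refine ⟨fun a b hab => ?_, fun f hf => ?_⟩
    · have := congr(α $hab)
      rw [sq, sq] at this
      exact mbij.1 (hq'.injective _ this)
    · obtain ⟨a', ha'⟩ := (hq'.isInvOn (m ⁻¹ᵁ W)).surj (α f) fun g => by
        rw [← hf g]
        change (α ≫ (σ' g).appLE _ _ _) _ = ((σ g).appLE _ _ _ ≫ α) _
        rw [hf g]
        dsimp only [α]
        rw [Scheme.Hom.appLE_comp_appLE, Scheme.Hom.appLE_comp_appLE]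
        simp only [hj]
      obtain ⟨a, rfl⟩ := mbij.2 a'
      exact ⟨a, αinj (by rw [sq, ha'])⟩
  have : IsAffineHom q := isAffineHom_of_forall_exists_isAffineOpen q fun x =>
    (key x).imp fun W h => ⟨h.1, h.2.1, h.2.2.1⟩
  exact .of_cover hσ hinv hn fun x => (key x).imp fun W h => ⟨h.1, h.2.1, h.2.2.2⟩

end existence

/-! ### Gluing the quotients of the stable affine open subsets -/

section gluing

variable {G : Type*} [Group G] [Finite G] {P : Scheme.{u}} (σ : G → (P ⟶ P))

/-- The stable affine open subsets. -/
structure StableAffine : Type u where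
  U : P.Opens
  affine : IsAffineOpen U
  stable : ∀ g, U ≤ σ g ⁻¹ᵁ U

variable {σ}

instance : Preorder (StableAffine σ) := Preorder.lift StableAffine.U

theorem exists_quotient_stableAffine (hσ : IsAct σ) (hn : CardUnit G P) (U : StableAffine σ) :
    ∃ (Q : Scheme.{u}) (q : U.U.toScheme ⟶ Q), IsAffine Q ∧ CardUnit G Q ∧
      IsQuotientBy (resAct σ U.U U.stable) q := by
  have : IsAffine U.U.toScheme := U.affine
  exact exists_quotient_of_isAffine (hσ.res _ U.stable) (hn.opens _)

omit [Group G] [Finite G] in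
theorem homOfLE_equivariant {U V : StableAffine σ} (h : U ≤ V) (g : G) :
    resAct σ U.U U.stable g ≫ P.homOfLE h = P.homOfLE h ≫ resAct σ V.U V.stable g := by
  rw [← cancel_mono V.U.ι]
  simp

/-- The affine quotients of the stable affine open subsets form a diagram of open immersions indexed
by a poset, and `Q` is its colimit. Separatedness makes the intersection of two stable affine open
sets affine, so the diagram is locally directed and the colimit is obtained by gluing. -/
theorem exists_quotient [P.IsSeparated] (hσ : IsAct σ) {S : Scheme.{u}} (hn : CardUnit G S)
    (f : P ⟶ S) (hf : ∀ g, σ g ≫ f = f)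
    (good : ∀ x : P, ∃ U : StableAffine σ, x ∈ U.U) :
    ∃ (Q : Scheme.{u}) (q : P ⟶ Q) (m : Q ⟶ S), IsQuotientBy σ q ∧ q ≫ m = f := by
  choose R π _ hR hπ using exists_quotient_stableAffine hσ (hn.of_hom f)
  have hact (U : StableAffine σ) : IsAct (resAct σ U.U U.stable) := hσ.res _ U.stable
  have epi (U : StableAffine σ) : Epi (π U) := (hπ U).epi (hact U)
  have ex {U V : StableAffine σ} (h : U ≤ V) : ∃ m, π U ≫ m = P.homOfLE h ≫ π V :=
    (hπ U).exists_desc (hact U) (hR U) _ fun g => by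
      rw [← Category.assoc, homOfLE_equivariant, Category.assoc, (hπ V).invariant]
  choose r hr using @ex
  let F : StableAffine σ ⥤ Scheme.{u} :=
    { obj := R
      map h := r (leOfHom h)
      map_id U := by
        rw [← cancel_epi (π U), hr]
        simp
      map_comp {U V W} h h' := by
        rw [← cancel_epi (π U), hr, reassoc_of% (hr (leOfHom h)), hr]
        simp }
  have ho {U V : StableAffine σ} (h : U ⟶ V) :=
    (hπ V).isOpenImmersion (hact V) (hR V) (hπ U) (hact U) (hR U)
      (homOfLE_equivariant (leOfHom h)) (hr (leOfHom h))
  have _ {U V : StableAffine σ} (h : U ⟶ V) : IsOpenImmersion (F.map h) := (ho h).1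
  have hpt {U V : StableAffine σ} (h : U ≤ V) (x : U.U.toScheme) :
      r h (π U x) = π V (P.homOfLE h x) := by
    rw [← Scheme.Hom.comp_apply, hr, Scheme.Hom.comp_apply]
  have hval {U V : StableAffine σ} (h : U ≤ V) (x : U.U.toScheme) : (P.homOfLE h x).1 = x.1 := by
    change V.U.ι (P.homOfLE h x) = U.U.ι x
    rw [← Scheme.Hom.comp_apply, Scheme.homOfLE_ι]
  have horb {U : StableAffine σ} {x y : U.U.toScheme} (h : π U x = π U y) : ∃ g, σ g x.1 = y.1 := by
    obtain ⟨g, rfl⟩ := (hπ U).exists_act_eq (hact U) h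
    refine ⟨g, ?_⟩
    change σ g (U.U.ι x) = U.U.ι _
    rw [← Scheme.Hom.comp_apply, ← Scheme.Hom.comp_apply, resAct_ι]
  have horb' {U : StableAffine σ} {x y : U.U.toScheme} (g : G) (h : σ g x.1 = y.1) : π U x = π U y := by
    have : y = resAct σ U.U U.stable g x := by
      apply Subtype.ext
      rw [← h]
      change σ g (U.U.ι x) = U.U.ι _
      rw [← Scheme.Hom.comp_apply, ← Scheme.Hom.comp_apply, resAct_ι]
    rw [this, ← Scheme.Hom.comp_apply, (hπ U).invariant]
  have hs (U : StableAffine σ) := ((hπ U).surj (hact U)).surj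
  -- Points of the quotients of `U` and `V` with equal image in that of `W` come from a single
  -- orbit, which lies in `U ∩ V`; that intersection is the index required by local directedness.
  have : (F ⋙ Scheme.forget).IsLocallyDirected := ⟨by
    intro U V W fU fV xU xV hx
    obtain ⟨y, rfl⟩ := hs U xU
    obtain ⟨z, rfl⟩ := hs V xV
    change r (leOfHom fU) (π U y) = r (leOfHom fV) (π V z) at hx
    rw [hpt, hpt] at hx
    obtain ⟨g, hg⟩ := horb hx
    rw [hval, hval] at hg
    have hzU : z.1 ∈ U.U := hg ▸ U.stable g y.2
    let L : StableAffine σ := ⟨U.1 ⊓ V.U, U.affine.inf V.affine, fun g x hx =>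
      ⟨U.stable g hx.1, V.stable g hx.2⟩⟩
    have hLU : L ≤ U := (inf_le_left : U.U ⊓ V.U ≤ _)
    have hLV : L ≤ V := (inf_le_right : U.U ⊓ V.U ≤ _)
    let t : L.U.toScheme := ⟨z.1, hzU, z.2⟩
    refine ⟨L, homOfLE hLU, homOfLE hLV, π L t, ?_, ?_⟩
    · change r hLU (π L t) = π U y
      rw [hpt]
      exact (horb' g (by rw [hval, hg])).symm
    · change r hLV (π L t) = π V z
      rw [hpt]
      congr 1
      exact Subtype.ext (hval hLV t)⟩
  let Q := colimit F
  have hcov : TopologicalSpace.IsOpenCover fun U : StableAffine σ => U.U := by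
    rw [TopologicalSpace.IsOpenCover, eq_top_iff]
    exact fun x _ => TopologicalSpace.Opens.mem_iSup.2 (good x)
  let 𝒰 := P.openCoverOfIsOpenCover _ hcov
  have hglue (U V : StableAffine σ) : pullback.fst U.U.ι V.U.ι ≫ π U ≫ colimit.ι F U =
      pullback.snd U.U.ι V.U.ι ≫ π V ≫ colimit.ι F V := by
    let L : StableAffine σ := ⟨U.1 ⊓ V.U, U.affine.inf V.affine, fun g x hx =>
      ⟨U.stable g hx.1, V.stable g hx.2⟩⟩
    have hLU : L ≤ U := (inf_le_left : U.U ⊓ V.U ≤ _)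
    have hLV : L ≤ V := (inf_le_right : U.U ⊓ V.U ≤ _)
    let l : pullback U.U.ι V.U.ι ⟶ L.U.toScheme :=
      IsOpenImmersion.lift L.U.ι (pullback.fst U.U.ι V.U.ι ≫ U.U.ι) <| by
        rw [Scheme.Opens.range_ι]
        rintro _ ⟨x, rfl⟩
        refine ⟨?_, ?_⟩
        · rw [Scheme.Hom.comp_apply]
          exact (pullback.fst U.U.ι V.U.ι x).2
        · rw [pullback.condition, Scheme.Hom.comp_apply]
          exact (pullback.snd U.U.ι V.U.ι x).2
    have hl : l ≫ L.U.ι = pullback.fst U.U.ι V.U.ι ≫ U.U.ι := IsOpenImmersion.lift_fac _ _ _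
    have e1 : l ≫ P.homOfLE hLU = pullback.fst U.U.ι V.U.ι := by
      rw [← cancel_mono U.U.ι, Category.assoc, Scheme.homOfLE_ι, hl]
    have e2 : l ≫ P.homOfLE hLV = pullback.snd U.U.ι V.U.ι := by
      rw [← cancel_mono V.U.ι, Category.assoc, Scheme.homOfLE_ι, hl, pullback.condition]
    have w1 : r hLU ≫ colimit.ι F U = colimit.ι F L := colimit.w F (homOfLE hLU)
    have w2 : r hLV ≫ colimit.ι F V = colimit.ι F L := colimit.w F (homOfLE hLV)
    rw [← e1, ← e2, Category.assoc, Category.assoc, ← reassoc_of% (hr hLU),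
      ← reassoc_of% (hr hLV), w1, w2]
  let q : P ⟶ Q := 𝒰.glueMorphisms (fun U => π U ≫ colimit.ι F U) fun U V => hglue U V
  have hq (U : StableAffine σ) : U.U.ι ≫ q = π U ≫ colimit.ι F U :=
    𝒰.ι_glueMorphisms _ _ U
  have hinv (g : G) : σ g ≫ q = q := by
    refine Scheme.Cover.hom_ext 𝒰 _ _ fun (U : StableAffine σ) => ?_
    change U.U.ι ≫ _ = U.U.ι ≫ _
    rw [← resAct_ι_assoc U.U U.stable, hq, ← Category.assoc, (hπ U).invariant]
  have hS (U : StableAffine σ) : ∃ m, π U ≫ m = U.U.ι ≫ f :=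
    (hπ U).exists_desc (hact U) (hR U) _ fun g => by rw [resAct_ι_assoc, hf]
  choose s hs' using hS
  let m : Q ⟶ S := colimit.desc F
    { pt := S
      ι :=
        { app := s
          naturality U V h := by
            dsimp
            rw [Category.comp_id, ← cancel_epi (π U), hs', ← Category.assoc]
            change (π U ≫ r (leOfHom h)) ≫ _ = _
            rw [hr, Category.assoc, hs', Scheme.homOfLE_ι_assoc] } }
  have hm (U : StableAffine σ) : colimit.ι F U ≫ m = s U := colimit.ι_desc _ _
  refine ⟨Q, q, m, .of_openCover hσ (hn.of_hom m) hinv fun x => ?_, ?_⟩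
  · obtain ⟨U, y, hy⟩ := Scheme.IsLocallyDirected.ι_jointly_surjective F x
    refine ⟨_, _, π U, U.U.ι, colimit.ι F U, resAct σ U.U U.stable, ⟨y, hy⟩, inferInstance, ?_,
      resAct_ι _ _, hπ U⟩
    -- The square is cartesian because the preimage of the chart of `U` is exactly `U`: a point with
    -- image in the chart is a translate of a point of `U`.
    refine (IsOpenImmersion.isPullback _ _ _ _ (hq U) ?_).flip
    ext z
    simp only [Scheme.Opens.opensRange_ι, SetLike.mem_coe]
    constructor
    · rintro ⟨y, hy⟩
      obtain ⟨V, hzV⟩ := good z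
      let z' : V.U.toScheme := ⟨z, hzV⟩
      have h1 : q z = colimit.ι F V (π V z') := by
        change q (V.U.ι z') = _
        rw [← Scheme.Hom.comp_apply, hq, Scheme.Hom.comp_apply]
      rw [h1] at hy
      obtain ⟨L, hLU, hLV, w, hwU, hwV⟩ := Scheme.IsLocallyDirected.ι_eq_ι_iff F |>.1 hy
      obtain ⟨w, rfl⟩ := hs L w
      change r (leOfHom hLV) (π L w) = _ at hwV
      rw [hpt] at hwV
      obtain ⟨g, hg⟩ := horb hwV
      rw [hval] at hg
      change σ g w.1 = z at hg
      rw [← hg]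
      exact U.stable g ((leOfHom hLU : L.U ≤ U.U) w.2)
    · intro hz
      let z' : U.U.toScheme := ⟨z, hz⟩
      refine ⟨π U z', ?_⟩
      rw [← Scheme.Hom.comp_apply, ← hq]
      rfl
  · refine Scheme.Cover.hom_ext 𝒰 _ _ fun (U : StableAffine σ) => ?_
    change U.U.ι ≫ _ = U.U.ι ≫ _
    rw [reassoc_of% (hq U), hm, hs']

end gluing

/-! ### Quotients of varieties -/

section variety

/-- The diagonal of `Y` is the image of the closed diagonal of `X` under the product of `q` with
itself, and that product is integral, hence closed. -/
theorem isSeparated_of_surjective {X Y S : Scheme.{u}} (q : X ⟶ Y) (g : Y ⟶ S) [IsIntegralHom q]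
    [Surjective q] [IsSeparated (q ≫ g)] : IsSeparated g := by
  refine ⟨.of_isPreimmersion _ ?_⟩
  let r := pullback.map (q ≫ g) (q ≫ g) g g q q (𝟙 S) (by simp) (by simp)
  have hr : IsIntegralHom r := by
    have h : IsIntegralHom q := inferInstance
    exact MorphismProperty.pullbackMap (P := @IsIntegralHom) h h rfl rfl
  have r1 : r ≫ pullback.fst g g = pullback.fst _ _ ≫ q := pullback.lift_fst _ _ _
  have r2 : r ≫ pullback.snd g g = pullback.snd _ _ ≫ q := pullback.lift_snd _ _ _
  have h1 : pullback.diagonal (q ≫ g) ≫ r = q ≫ pullback.diagonal g := by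
    ext1
    · rw [Category.assoc, r1, pullback.diagonal_fst_assoc, Category.assoc, pullback.diagonal_fst,
        Category.comp_id]
    · rw [Category.assoc, r2, pullback.diagonal_snd_assoc, Category.assoc, pullback.diagonal_snd,
        Category.comp_id]
  have h2 : Set.range (pullback.diagonal g) = r '' Set.range (pullback.diagonal (q ≫ g)) := by
    rw [← Set.range_comp]
    have e1 : r ∘ pullback.diagonal (q ≫ g) = pullback.diagonal g ∘ q := by
      ext x
      simp only [Function.comp_apply]
      rw [← Scheme.Hom.comp_apply, h1, Scheme.Hom.comp_apply]
    rw [e1]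
    exact (Function.Surjective.range_comp (Surjective.surj (f := q)) _).symm
  rw [h2]
  exact r.isClosedMap _ (pullback.diagonal (q ≫ g)).isClosedEmbedding.isClosed_range

variable {k : Type u} [Field k]

/-- The Artin-Tate lemma: functions on `X` are of finite type over a noetherian ring and integral,
hence finite, over the functions on `Y`, so the latter are of finite type. -/
theorem locallyOfFiniteType_of_injective {X Y : Scheme.{u}} (q : X ⟶ Y) [IsIntegralHom q]
    (hq : ∀ U, Function.Injective (q.app U)) (g : Y ⟶ Spec (.of k))
    [LocallyOfFiniteType (q ≫ g)] : LocallyOfFiniteType g := by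
  refine HasRingHomProperty.of_iSup_eq_top (P := @LocallyOfFiniteType) (fun U : Y.affineOpens => U)
    (iSup_affineOpens_eq_top Y) fun U => ?_
  let A := Γ(Spec (.of k), ⊤)
  let φ : A →+* Γ(Y, U) := (g.appLE ⊤ U le_top).hom
  let ψ : A →+* Γ(X, q ⁻¹ᵁ U) := ((q ≫ g).appLE ⊤ (q ⁻¹ᵁ U) le_top).hom
  let _ : Algebra A Γ(Y, U) := φ.toAlgebra
  let _ : Algebra A Γ(X, q ⁻¹ᵁ U) := ψ.toAlgebra
  let _ : Algebra Γ(Y, U) Γ(X, q ⁻¹ᵁ U) := (q.app U).hom.toAlgebra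
  have hψ : ψ.FiniteType := (q ≫ g).finiteType_appLE (isAffineOpen_top _) (U.2.preimage q) _
  have htow : IsScalarTower A Γ(Y, U) Γ(X, q ⁻¹ᵁ U) := by
    refine .of_algebraMap_eq fun a => ?_
    have h := Scheme.Hom.appLE_comp_appLE q g ⊤ U (q ⁻¹ᵁ U) le_top le_rfl
    rw [Scheme.Hom.appLE_eq_app] at h
    exact congr($h.symm a)
  have hint : Algebra.IsIntegral Γ(Y, U) Γ(X, q ⁻¹ᵁ U) :=
    ⟨IsIntegralHom.isIntegral_app q U U.2⟩
  have hft : Algebra.FiniteType A Γ(X, q ⁻¹ᵁ U) := hψ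
  have hft' : Algebra.FiniteType Γ(Y, U) Γ(X, q ⁻¹ᵁ U) := .of_restrictScalars_finiteType A _ _
  have hfin : Module.Finite Γ(Y, U) Γ(X, q ⁻¹ᵁ U) := Algebra.IsIntegral.finite
  have hA : IsNoetherianRing A :=
    isNoetherianRing_of_ringEquiv k (Scheme.ΓSpecIso (.of k)).symm.commRingCatIsoToRingEquiv
  exact ⟨fg_of_fg_of_fg A Γ(Y, U) Γ(X, q ⁻¹ᵁ U) hft.1 hfin.1 (hq U)⟩

/-- Quotients of varieties by finite groups are varieties. -/
theorem IsVariety.quotient {G : Type*} [Group G] [Finite G] {X Y : Sch k} (hX : IsVariety X)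
    (q : X ⟶ Y) {σ : G → (X.left ⟶ X.left)} (hσ : IsAct σ) (hq : IsQuotientBy σ q.left) :
    IsVariety Y := by
  obtain ⟨_, hs, hf, hc⟩ := hX
  rw [← Over.w q] at hs hf hc
  have := hq.isIntegralHom hσ
  have := hq.surj hσ
  refine ⟨⟨fun U => ?_⟩, isSeparated_of_surjective q.left Y.hom,
    locallyOfFiniteType_of_injective q.left hq.injective Y.hom, ?_⟩
  · exact isReduced_of_injective (q.left.app U).hom (hq.injective U)
  · have h1 : CompactSpace X.left := by
      have := (quasiCompact_iff_compactSpace (f := q.left ≫ Y.hom)).1 hc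
      exact this
    have h2 : CompactSpace Y.left :=
      ⟨by
        rw [← (Surjective.surj (f := q.left)).range_eq]
        exact isCompact_range q.left.continuous⟩
    exact (quasiCompact_iff_compactSpace (f := Y.hom)).2 h2

end variety

/-! ### Quotients of varieties by the kernel of a morphism of finite groups -/

section eqvar

variable {k : Type u} [Field k] {S T : Sch k} {H Γ : Type*} [Group H] [Group Γ]

theorem EqVar.isAct {N : Type*} [Group N] (P : EqVar S H) (φ : N →* H) :
    IsAct fun g : N => (P.act (φ g)).left :=
  ⟨by simp [P.act_one], fun g h => by simp [P.act_mul]⟩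

theorem IsVariety.isSeparated_left {X : Sch k} (hX : IsVariety X) : X.left.IsSeparated := by
  have := hX.separated
  constructor
  rw [← terminal.comp_from X.hom]
  infer_instance

theorem EqVar.act_isIso (P : EqVar S H) (h : H) : IsIso (P.act h) :=
  ⟨P.act h⁻¹, by rw [← P.act_mul, mul_inv_cancel, P.act_one],
    by rw [← P.act_mul, inv_mul_cancel, P.act_one]⟩

/-- Every point has a stable affine open neighbourhood. -/
theorem EqVar.exists_stable_affine [Finite H] (P : EqVar S H) (x : P.X.left) :
    ∃ V : P.X.left.Opens, x ∈ V ∧ IsAffineOpen V ∧ ∀ h, V ≤ (P.act h).left ⁻¹ᵁ V := by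
  have := P.isVariety.isSeparated_left
  have := Fintype.ofFinite H
  obtain ⟨U, hU, hxU⟩ := P.good x
  have hiso (h : H) : IsIso (P.act h).left := by
    have := P.act_isIso h
    exact inferInstanceAs (IsIso ((Over.forget _).map (P.act h)))
  have mem (y : P.X.left) : y ∈ (Finset.univ.inf fun h => (P.act h).left ⁻¹ᵁ U) ↔
      ∀ h, (P.act h).left y ∈ U := by
    rw [← SetLike.mem_coe, TopologicalSpace.Opens.coe_finset_inf, Finset.inf_set_eq_iInter]
    simp
  -- The stable neighbourhood is the intersection of all translates of `U`, affine by separatedness.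
  -- The index set must be nonempty because an empty intersection is the whole variety, which need
  -- not be affine.
  have key (s : Finset H) (hs : s.Nonempty) :
      IsAffineOpen (s.inf fun h => (P.act h).left ⁻¹ᵁ U) := by
    induction hs using Finset.Nonempty.cons_induction with
    | singleton a => simpa using hU.preimage_of_isIso (P.act a).left
    | cons a s ha hs ih =>
      rw [Finset.inf_cons]
      exact (hU.preimage_of_isIso (P.act a).left).inf ih
  refine ⟨_, ?_, key Finset.univ ⟨1, Finset.mem_univ _⟩, fun h => ?_⟩
  · exact (mem x).2 hxU
  · intro y hy
    refine (mem _).2 fun h' => ?_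
    have := (mem y).1 hy (h * h')
    rw [P.act_mul] at this
    exact this

variable [CharZero k]

theorem cardUnit (N : Type*) [Group N] [Finite N] (X : Sch k) : CardUnit N X.left := by
  refine CardUnit.of_hom (Y := Spec (.of k)) ?_ X.hom
  have h1 : IsUnit ((Nat.card N : ℕ) : k) :=
    (Nat.cast_ne_zero.2 Nat.card_pos.ne').isUnit
  have := h1.map (Scheme.ΓSpecIso (.of k)).inv.hom
  rwa [map_natCast] at this

/-- `Q` is the quotient of `P` by the kernel of `π`, with the induced action. -/
def IsQuot (π : H →* Γ) (P : EqVar S H) (Q : EqVar S Γ) : Prop :=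
  ∃ q : P.X ⟶ Q.X, IsQuotientBy (fun h : π.ker => (P.act h).left) q.left ∧ q ≫ Q.p = P.p ∧
    ∀ h, q ≫ Q.act (π h) = P.act h ≫ q

variable {π : H →* Γ} {P : EqVar S H}

omit [CharZero k] in
theorem EqVar.isAct_ker (π : H →* Γ) (P : EqVar S H) :
    IsAct fun h : π.ker => (P.act h).left := P.isAct π.ker.subtype

/-- The universal property of the quotient, over `k`. -/
theorem IsQuotientBy.exists_over {N : Type*} [Group N] [Finite N] {X Y Z : Sch k} {q : X ⟶ Y}
    {σ : N → (X ⟶ X)}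
    (hq : IsQuotientBy (fun g => (σ g).left) q.left) (hσ : IsAct fun g => (σ g).left)
    (f : X ⟶ Z) (hf : ∀ g, σ g ≫ f = f) : ∃ m : Y ⟶ Z, q ≫ m = f := by
  obtain ⟨m, hm⟩ := hq.exists_desc hσ (cardUnit N Y) f.left fun g => by
    rw [← Over.comp_left, hf]
  have := hq.epi hσ
  refine ⟨Over.homMk m ?_, by ext1; exact hm⟩
  rw [← cancel_epi q.left, reassoc_of% hm, Over.w, Over.w]

omit [CharZero k] in
theorem IsQuotientBy.epi_over {N : Type*} [Group N] [Finite N] {X Y : Sch k} {q : X ⟶ Y}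
    {σ : N → (X ⟶ X)}
    (hq : IsQuotientBy (fun g => (σ g).left) q.left) (hσ : IsAct fun g => (σ g).left) : Epi q := by
  have := hq.epi hσ
  exact (Over.forget _).epi_of_epi_map this

/-- The kernel is normal, so the action of each `h` descends to the quotient; kernel elements become
trivial there, so the descended map depends only on `π h`. Stable affine open sets descend to stable
affine ones, so the residual action is good. -/
theorem exists_isQuot [Finite H] (hπ : Function.Surjective π) (P : EqVar S H) :
    ∃ Q : EqVar S Γ, IsQuot π P Q := by
  have hsep := P.isVariety.isSeparated_left
  have hact := P.isAct_ker π
  obtain ⟨Q, q, m, hq, hm⟩ := exists_quotient hact (cardUnit π.ker (𝟙_ (Sch k))) P.X.hom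
    (fun g => Over.w _) fun x => by
      obtain ⟨V, h1, h2, h3⟩ := P.exists_stable_affine x
      exact ⟨⟨V, h2, fun g => h3 g⟩, h1⟩
  let Y : Sch k := Over.mk m
  let q' : P.X ⟶ Y := Over.homMk q hm
  have hq' : IsQuotientBy (fun h : π.ker => (P.act h).left) q'.left := hq
  have inv (g : π.ker) : P.act g ≫ q' = q' := by ext1; exact hq.invariant g
  have := hq'.epi_over hact
  obtain ⟨p, hp⟩ := hq'.exists_over hact P.p fun g => P.act_p g
  have ha (γ : Γ) : ∃ a : Y ⟶ Y, ∀ h, π h = γ → q' ≫ a = P.act h ≫ q' := by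
    obtain ⟨h, rfl⟩ := hπ γ
    obtain ⟨a, ha⟩ := hq'.exists_over hact (P.act h ≫ q') fun g => by
      have e : (g : H) * h = h * (h⁻¹ * g * h) := by group
      rw [← Category.assoc, ← P.act_mul, e, P.act_mul, Category.assoc]
      congr 1
      exact inv ⟨h⁻¹ * g * h, by simp [MonoidHom.mem_ker, (MonoidHom.mem_ker).1 g.2]⟩
    refine ⟨a, fun h' hh' => ?_⟩
    have e : h' = (h' * h⁻¹) * h := by group
    rw [ha, e, P.act_mul, Category.assoc, ← ha, ← Category.assoc]
    congr 1
    exact (inv ⟨h' * h⁻¹, by simp [MonoidHom.mem_ker, hh']⟩).symm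
  choose a ha using ha
  have hsurj := (hq.surj hact).surj
  let Qv : EqVar S Γ :=
    { X := Y
      isVariety := P.isVariety.quotient q' hact hq'
      p := p
      act := a
      act_one := by rw [← cancel_epi q', ha 1 1 (map_one _), P.act_one, Category.id_comp,
        Category.comp_id]
      act_mul g h := by
        obtain ⟨g, rfl⟩ := hπ g
        obtain ⟨h, rfl⟩ := hπ h
        rw [← cancel_epi q', ha _ (g * h) (map_mul _ _ _), reassoc_of% (ha _ g rfl), ha _ h rfl,
          P.act_mul, Category.assoc]
      act_p g := by
        obtain ⟨g, rfl⟩ := hπ g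
        rw [← cancel_epi q', reassoc_of% (ha _ g rfl), hp, P.act_p]
      good x := by
        obtain ⟨y, rfl⟩ := hsurj x
        obtain ⟨V, h1, h2, h3⟩ := P.exists_stable_affine y
        obtain ⟨W, rfl⟩ := hq.exists_image hact V fun g => h3 g
        refine ⟨W, hq.isAffineOpen hact (cardUnit _ Y) W h2, fun g => ?_⟩
        obtain ⟨g, rfl⟩ := hπ g
        have : (a (π g)).left (q y) = q ((P.act g).left y) := by
          have := congr(($(ha _ g rfl)).left)
          rw [Over.comp_left, Over.comp_left] at this
          exact congr($this y)
        rw [this]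
        exact h3 g h1 }
  exact ⟨Qv, q', hq, hp, fun h => ha _ h rfl⟩

end eqvar

/-! ### Calculus of quotients -/

section scheme

variable {P Q R : Scheme.{u}}

/-- Only the set of automorphisms matters, not its indexing; in particular the acting group may be
enlarged by elements that act trivially. -/
theorem IsQuotientBy.congr {ι ι' : Type*} {σ : ι → (P ⟶ P)} {σ' : ι' → (P ⟶ P)} {q : P ⟶ Q}
    (hq : IsQuotientBy σ q) (h : ∀ i, ∃ j, σ' j = σ i) (h' : ∀ j, ∃ i, σ i = σ' j) :
    IsQuotientBy σ' q := by
  have hinv (j) : σ' j ≫ q = q := by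
    obtain ⟨i, hi⟩ := h' j
    rw [← hi, hq.invariant]
  refine ⟨hq.affine, hinv, hq.injective, fun U f hf => hq.surjective U f fun i => ?_⟩
  obtain ⟨j, hj⟩ := h i
  refine Eq.trans ?_ (hf j)
  simp only [hj]

/-- Quotients in stages. An invariant function descends along `q₁` because `σ` contains `σ₁`; the
descended function is invariant under `σ₂` because `σ` lifts `σ₂` and `q₁` is injective on
functions. -/
theorem IsQuotientBy.comp {ι₁ ι₂ ι : Type*} {σ₁ : ι₁ → (P ⟶ P)} {σ₂ : ι₂ → (Q ⟶ Q)}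
    {σ : ι → (P ⟶ P)} {q₁ : P ⟶ Q} {q₂ : Q ⟶ R} (h₁ : IsQuotientBy σ₁ q₁)
    (h₂ : IsQuotientBy σ₂ q₂) (hinv : ∀ i, σ i ≫ q₁ ≫ q₂ = q₁ ≫ q₂)
    (H₁ : ∀ i, ∃ j, σ j = σ₁ i) (H₂ : ∀ i, ∃ j, σ j ≫ q₁ = q₁ ≫ σ₂ i) :
    IsQuotientBy σ (q₁ ≫ q₂) := by
  have := h₁.affine
  have := h₂.affine
  refine ⟨inferInstance, hinv, fun U => ?_, fun U f hf => ?_⟩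
  · rw [Scheme.Hom.comp_app]
    exact (h₁.injective _).comp (h₂.injective U)
  · obtain ⟨g, rfl⟩ := h₁.surjective (q₂ ⁻¹ᵁ U) f fun i => by
      obtain ⟨j, hj⟩ := H₁ i
      refine Eq.trans ?_ (hf j)
      simp only [hj]
      rfl
    obtain ⟨a, rfl⟩ := h₂.surjective U g fun i => by
      apply h₁.injective
      obtain ⟨j, hj⟩ := H₂ i
      refine Eq.trans ?_ (hf j)
      rw [← Scheme.Hom.appLE_eq_app]
      have hle₂ : q₂ ⁻¹ᵁ U ≤ σ₂ i ⁻¹ᵁ q₂ ⁻¹ᵁ U := by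
        rw [← Scheme.Hom.comp_preimage, h₂.invariant]
      have hle : q₁ ⁻¹ᵁ q₂ ⁻¹ᵁ U ≤ σ j ⁻¹ᵁ q₁ ⁻¹ᵁ q₂ ⁻¹ᵁ U := by
        rw [← Scheme.Hom.comp_preimage, ← Scheme.Hom.comp_preimage, hinv]
      have e₁ := Scheme.Hom.appLE_comp_appLE q₁ (σ₂ i) (q₂ ⁻¹ᵁ U) _ (q₁ ⁻¹ᵁ q₂ ⁻¹ᵁ U) hle₂ le_rfl
      have e₂ := Scheme.Hom.appLE_comp_appLE (σ j) q₁ (q₂ ⁻¹ᵁ U) (q₁ ⁻¹ᵁ q₂ ⁻¹ᵁ U) _ le_rfl hle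
      simp only [hj] at e₂
      exact congr($(e₁.trans e₂.symm) g)
    exact ⟨a, by rw [Scheme.Hom.comp_app]; rfl⟩

/-- A stable closed immersion induces a closed immersion on quotients. -/
theorem IsQuotientBy.isClosedImmersion {G : Type*} [Group G] [Finite G] {σ : G → (P ⟶ P)}
    {q : P ⟶ Q} (hq : IsQuotientBy σ q) (hσ : IsAct σ) (hn : CardUnit G Q)
    {P' Q' : Scheme.{u}} {σ' : G → (P' ⟶ P')} {q' : P' ⟶ Q'}
    (hq' : IsQuotientBy σ' q') (hσ' : IsAct σ') {i : P' ⟶ P}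
    [IsClosedImmersion i] (hi : ∀ g, σ' g ≫ i = i ≫ σ g) {m : Q' ⟶ Q} (hm : q' ≫ m = i ≫ q) :
    IsClosedImmersion m := by
  have := hq.affine
  have e (U : Q.Opens) : i ⁻¹ᵁ q ⁻¹ᵁ U = q' ⁻¹ᵁ m ⁻¹ᵁ U := by
    rw [← Scheme.Hom.comp_preimage, ← Scheme.Hom.comp_preimage, hm]
  have haff : IsAffineHom m := ⟨fun U hU => hq'.isAffineOpen hσ' (hn.of_hom m) _ <| by
    rw [← e]
    exact (hU.preimage q).preimage i⟩
  refine isClosedImmersion_iff_isAffineHom.2 ⟨haff, fun U hU f => ?_⟩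
  let r : Γ(P, q ⁻¹ᵁ U) ⟶ Γ(P', q' ⁻¹ᵁ m ⁻¹ᵁ U) := i.appLE _ _ (e U).ge
  have hr : Function.Surjective r := by
    have h1 := i.app_surjective (q ⁻¹ᵁ U) (hU.preimage q)
    dsimp only [r, Scheme.Hom.appLE]
    have : IsIso (P'.presheaf.map (homOfLE (e U).ge).op) := by
      have : IsIso (homOfLE (e U).ge) := (eqToIso (e U).symm).isIso_hom
      infer_instance
    exact (ConcreteCategory.bijective_of_isIso (P'.presheaf.map (homOfLE (e U).ge).op)).2.comp h1
  have hrs (g : G) (x) : r (secMap (hq.invariant g) U x) =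
      secMap (hq'.invariant g) (m ⁻¹ᵁ U) (r x) := by
    change ((σ g).appLE _ _ _ ≫ i.appLE _ _ _) x = (i.appLE _ _ _ ≫ (σ' g).appLE _ _ _) x
    rw [Scheme.Hom.appLE_comp_appLE, Scheme.Hom.appLE_comp_appLE]
    simp only [hi]
  have hrq (x) : r (q.app U x) = q'.app _ (m.app U x) := by
    rw [← Scheme.Hom.appLE_eq_app, ← Scheme.Hom.appLE_eq_app, ← Scheme.Hom.appLE_eq_app]
    change (q.appLE _ _ _ ≫ i.appLE _ _ _) x = (m.appLE _ _ _ ≫ q'.appLE _ _ _) x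
    rw [Scheme.Hom.appLE_comp_appLE, Scheme.Hom.appLE_comp_appLE]
    simp only [hm]
  -- Functions on `P` restrict onto functions on `P'`; averaging an arbitrary extension of an
  -- invariant function gives an invariant extension, up to the order of the group.
  obtain ⟨x, hx⟩ := hr (q'.app _ f)
  obtain ⟨a, ha⟩ := hq.exists_app_eq_sum hσ U x
  obtain ⟨c, hc⟩ := (hn.isUnit U).exists_right_inv
  have := Fintype.ofFinite G
  have key : m.app U a = Nat.card G * f := by
    apply hq'.injective
    rw [← hrq, ha, finsum_eq_sum_of_fintype, map_sum, map_mul, map_natCast]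
    simp only [hrs, hx, secMap_app]
    simp
  refine ⟨c * a, ?_⟩
  have hc' := congr(m.app U $hc)
  rw [map_mul, map_natCast, map_one] at hc'
  rw [map_mul, key, ← mul_assoc, mul_comm (m.app U c), hc', one_mul]

end scheme

/-! ### Functoriality of equivariant quotients -/

section eqvar

variable {k : Type u} [Field k] {S T : Sch k} {H Γ Δ H' Γ' : Type*} [Group H] [Group Γ]
  [Group Δ] [Group H'] [Group Γ'] {π : H →* Γ} {P : EqVar S H} {Q Q' : EqVar S Γ}

theorem IsQuot.push (h : IsQuot π P Q) (f : S ⟶ T) : IsQuot π (P.push f) (Q.push f) := by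
  obtain ⟨q, h1, h2, h3⟩ := h
  exact ⟨q, h1, by simp [EqVar.push, ← h2], h3⟩

/-- If `φ'` maps the kernel of `π'` onto that of `π`, both kernels give the same set of
automorphisms, so the same morphism is a quotient for the new groups. All later changes of groups go
through this. -/
theorem IsQuot.res (h : IsQuot π P Q) {π' : H' →* Γ'} (φ' : H' →* H) (φ : Γ' →* Γ)
    (e : ∀ h, π (φ' h) = φ (π' h)) (e' : ∀ h, π h = 1 → ∃ h', π' h' = 1 ∧ φ' h' = h) :
    IsQuot π' (P.res φ') (Q.res φ) := by
  obtain ⟨q, h1, h2, h3⟩ := h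
  refine ⟨q, h1.congr ?_ ?_, h2, fun g => ?_⟩
  · rintro ⟨g, hg⟩
    obtain ⟨g', hg', rfl⟩ := e' g hg
    exact ⟨⟨g', hg'⟩, rfl⟩
  · rintro ⟨g, hg⟩
    exact ⟨⟨φ' g, by rw [MonoidHom.mem_ker, e, (MonoidHom.mem_ker).1 hg, map_one]⟩, rfl⟩
  · change q ≫ Q.act (φ (π' g)) = P.act (φ' g) ≫ q
    rw [← e, h3]

theorem IsQuot.comp {Q₂ : EqVar S Δ} {π₂ : Γ →* Δ} (h : IsQuot π P Q) (h₂ : IsQuot π₂ Q Q₂)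
    (hπ : Function.Surjective π) : IsQuot (π₂.comp π) P Q₂ := by
  obtain ⟨q, a1, a2, a3⟩ := h
  obtain ⟨r, b1, b2, b3⟩ := h₂
  refine ⟨q ≫ r, ?_, by rw [Category.assoc, b2, a2], fun g => ?_⟩
  · rw [Over.comp_left]
    refine a1.comp b1 ?_ ?_ ?_
    · rintro ⟨g, hg⟩
      rw [← Over.comp_left, ← Over.comp_left]
      congr 1
      rw [← Category.assoc, ← a3, Category.assoc]
      congr 1
      ext1
      exact b1.invariant ⟨π g, hg⟩
    · rintro ⟨g, hg⟩
      exact ⟨⟨g, by rw [MonoidHom.mem_ker, MonoidHom.comp_apply, (MonoidHom.mem_ker).1 hg,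
        map_one]⟩, rfl⟩
    · rintro ⟨g, hg⟩
      obtain ⟨g, rfl⟩ := hπ g
      refine ⟨⟨g, hg⟩, ?_⟩
      rw [← Over.comp_left, ← Over.comp_left]
      congr 1
      exact (a3 g).symm
  · rw [MonoidHom.comp_apply, Category.assoc, b3, ← Category.assoc, a3, Category.assoc]

theorem IsQuot.of_iso {P' : EqVar S H} (h : IsQuot π P Q) (e : P'.Iso P) : IsQuot π P' Q := by
  obtain ⟨q, h1, h2, h3⟩ := h
  obtain ⟨e, he, he'⟩ := e
  refine ⟨e.hom ≫ q, ?_, by rw [Category.assoc, h2, he], fun g => ?_⟩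
  · exact h1.iso_comp ((Over.forget _).mapIso e) fun g => by
      change _ ≫ e.hom.left = e.hom.left ≫ _
      rw [← Over.comp_left, ← Over.comp_left, he']
  · rw [Category.assoc, h3, ← Category.assoc, ← he', Category.assoc]

theorem exists_isHom_of_isQuotientBy [CharZero k] [Finite H] (hπ : Function.Surjective π)
    {P' : EqVar S H} {f : P.X ⟶ P'.X} (hf : EqVar.IsHom P P' f) {q : P.X ⟶ Q.X} {r : P'.X ⟶ Q'.X}
    (hq : IsQuotientBy (fun h : π.ker => (P.act h).left) q.left) (hq₁ : q ≫ Q.p = P.p)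
    (hq₂ : ∀ h, q ≫ Q.act (π h) = P.act h ≫ q)
    (hr : IsQuotientBy (fun h : π.ker => (P'.act h).left) r.left) (hr₁ : r ≫ Q'.p = P'.p)
    (hr₂ : ∀ h, r ≫ Q'.act (π h) = P'.act h ≫ r) :
    ∃ m : Q.X ⟶ Q'.X, EqVar.IsHom Q Q' m ∧ q ≫ m = f ≫ r := by
  have hact := P.isAct_ker π
  have := hq.epi_over hact
  obtain ⟨m, hm⟩ := hq.exists_over hact (f ≫ r) fun g => by
    rw [← Category.assoc, hf.equivariant, Category.assoc]
    congr 1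
    ext1
    exact hr.invariant g
  refine ⟨m, ⟨?_, fun g => ?_⟩, hm⟩
  · rw [← cancel_epi q, reassoc_of% hm, hr₁, hq₁, hf.comm]
  · obtain ⟨g, rfl⟩ := hπ g
    rw [← cancel_epi q, reassoc_of% hm, hr₂, reassoc_of% hq₂, hm, ← Category.assoc, hf.equivariant,
      Category.assoc]

theorem IsQuot.unique [CharZero k] [Finite H] (h : IsQuot π P Q) (h' : IsQuot π P Q')
    (hπ : Function.Surjective π) : Q.Iso Q' := by
  obtain ⟨q, a1, a2, a3⟩ := h
  obtain ⟨r, b1, b2, b3⟩ := h'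
  have hact := P.isAct_ker π
  have := a1.epi_over hact
  have := b1.epi_over hact
  obtain ⟨m, hm⟩ := a1.exists_over hact r fun g => by ext1; exact b1.invariant g
  obtain ⟨m', hm'⟩ := b1.exists_over hact q fun g => by ext1; exact a1.invariant g
  refine ⟨⟨m, m', ?_, ?_⟩, ?_, fun g => ?_⟩
  · rw [← cancel_epi q, reassoc_of% hm, hm', Category.comp_id]
  · rw [← cancel_epi r, reassoc_of% hm', hm, Category.comp_id]
  · rw [← cancel_epi q, reassoc_of% hm, b2, a2]
  · obtain ⟨g, rfl⟩ := hπ g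
    change Q.act (π g) ≫ m = m ≫ Q'.act (π g)
    rw [← cancel_epi q, reassoc_of% hm, b3, reassoc_of% a3, hm]

/-- Open and closed immersions pass to the quotient, and the images remain complementary because a
fibre, being an orbit, cannot meet both the stable closed part and its complement. -/
theorem IsQuot.scissor [CharZero k] [Finite H] (hπ : Function.Surjective π)
    {X Y U : EqVar S H} {QX QY QU : EqVar S Γ} (h : X.IsScissor Y U) (hX : IsQuot π X QX)
    (hY : IsQuot π Y QY) (hU : IsQuot π U QU) : QX.IsScissor QY QU := by
  obtain ⟨i, j, hi, hj, ci, oj, hr⟩ := h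
  obtain ⟨qX, x1, x2, x3⟩ := hX
  obtain ⟨qY, y1, y2, y3⟩ := hY
  obtain ⟨qU, u1, u2, u3⟩ := hU
  obtain ⟨i', hi', ei⟩ := exists_isHom_of_isQuotientBy hπ hi y1 y2 y3 x1 x2 x3
  obtain ⟨j', hj', ej⟩ := exists_isHom_of_isQuotientBy hπ hj u1 u2 u3 x1 x2 x3
  have ei₀ : qY.left ≫ i'.left = i.left ≫ qX.left := by rw [← Over.comp_left, ei, Over.comp_left]
  have ej₀ : qU.left ≫ j'.left = j.left ≫ qX.left := by rw [← Over.comp_left, ej, Over.comp_left]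
  have equi {A : EqVar S H} {f : A.X ⟶ X.X} (hf : EqVar.IsHom A X f) (g : H) :
      (A.act g).left ≫ f.left = f.left ≫ (X.act g).left := by
    rw [← Over.comp_left, hf.equivariant, Over.comp_left]
  obtain ⟨oj', -⟩ := x1.isOpenImmersion (X.isAct_ker π) (cardUnit _ _) u1 (U.isAct_ker π)
    (cardUnit _ _) (fun g => equi hj g) ej₀
  refine ⟨i', j', hi', hj', x1.isClosedImmersion (X.isAct_ker π) (cardUnit _ _) y1
    (Y.isAct_ker π) (fun g => equi hi g) ei₀, oj', ?_⟩
  have sX := (x1.surj (X.isAct_ker π)).surj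
  have sY := (y1.surj (Y.isAct_ker π)).surj
  have sU := (u1.surj (U.isAct_ker π)).surj
  have pi (y) : i'.left (qY.left y) = qX.left (i.left y) := congr($ei₀ y)
  have pj (y) : j'.left (qU.left y) = qX.left (j.left y) := congr($ej₀ y)
  ext x
  constructor
  · rintro ⟨z, rfl⟩ ⟨w, hw⟩
    obtain ⟨z, rfl⟩ := sU z
    obtain ⟨w, rfl⟩ := sY w
    rw [pi, pj] at hw
    obtain ⟨g, hg⟩ := x1.exists_act_eq (X.isAct_ker π) hw
    have h1 : j.left z ∈ Set.range i.left := ⟨(Y.act g).left w, by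
      rw [← hg]
      exact congr($(equi hi g) w)⟩
    have h2 : j.left z ∈ Set.range j.left := ⟨z, rfl⟩
    rw [hr] at h2
    exact h2 h1
  · intro hx
    obtain ⟨y, rfl⟩ := sX x
    by_cases hy : y ∈ Set.range i.left
    · obtain ⟨w, rfl⟩ := hy
      exact absurd ⟨qY.left w, pi w⟩ hx
    · rw [← Set.mem_compl_iff, ← hr] at hy
      obtain ⟨z, rfl⟩ := hy
      exact ⟨qU.left z, pj z⟩

variable [IsAlgClosed k]

/-- The map `P × B → Q × B` is a base change of the quotient map of `P`, so it is again a quotient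
map. -/
theorem IsQuot.prod [CharZero k] [Finite H] (h : IsQuot π P Q) (B : EqVar T Δ) :
    IsQuot (π.prodMap (.id Δ)) (P.prod B) (Q.prod B) := by
  obtain ⟨q, h1, h2, h3⟩ := h
  refine ⟨q ▷ B.X, ?_, ?_, fun g => ?_⟩
  · have h0 : IsQuotientBy (fun g : π.ker => ((P.prod B).act (g, 1)).left) (q ▷ B.X).left := by
      refine h1.of_isPullback (P.isAct_ker π) (cardUnit _ _) (isPullback_whiskerRight q B.X) ?_ ?_
      · intro g
        rw [← Over.comp_left, ← Over.comp_left, tensorHom_fst]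
      · intro g
        rw [← Over.comp_left]
        congr 1
        have : P.act g ≫ q = q := by ext1; exact h1.invariant g
        simp [B.act_one, ← tensorHom_id, this]
    refine h0.congr ?_ ?_
    · rintro ⟨g, hg⟩
      exact ⟨⟨(g, 1), by simpa [MonoidHom.mem_ker] using hg⟩, rfl⟩
    · rintro ⟨⟨g, d⟩, hg⟩
      have hg' : π g = 1 ∧ d = 1 := by simpa [MonoidHom.mem_ker] using hg
      obtain ⟨hg₁, rfl⟩ := hg'
      exact ⟨⟨g, hg₁⟩, rfl⟩
  · simp [← tensorHom_id, h2]
  · simp [← tensorHom_id, h3]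

omit [IsAlgClosed k] in
theorem IsQuot.trans_iso (h : IsQuot π P Q) (e : Q.Iso Q') : IsQuot π P Q' := by
  obtain ⟨q, h1, h2, h3⟩ := h
  obtain ⟨e, he, he'⟩ := e
  refine ⟨q ≫ e.hom, ?_, by rw [Category.assoc, he, h2], fun g => ?_⟩
  · exact h1.comp_iso ((Over.forget _).mapIso e)
  · rw [Category.assoc, ← he', reassoc_of% (h3 g)]

theorem EqVar.prod_swap_iso (A : EqVar S Γ) (B : EqVar T Δ) :
    (A.prod B).Iso (((B.prod A).push (β_ T S).hom).res
      (MonoidHom.prod (MonoidHom.snd Γ Δ) (MonoidHom.fst Γ Δ))) := by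
  refine ⟨β_ A.X B.X, ?_, fun g => ?_⟩
  · ext <;> simp
  · ext <;> simp

omit [IsAlgClosed k] in
theorem EqVar.Iso.symm {A B : EqVar S Γ} (h : A.Iso B) : B.Iso A := by
  obtain ⟨e, h1, h2⟩ := h
  refine ⟨e.symm, ?_, fun g => ?_⟩
  · rw [Iso.symm_hom, Iso.inv_comp_eq, h1]
  · rw [Iso.symm_hom, Iso.eq_inv_comp, ← Category.assoc, ← h2, Category.assoc, e.hom_inv_id,
      Category.comp_id]

omit [IsAlgClosed k] in
theorem EqVar.Iso.trans {A B C : EqVar S Γ} (h : A.Iso B) (h' : B.Iso C) : A.Iso C := by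
  obtain ⟨e, h1, h2⟩ := h
  obtain ⟨f, h3, h4⟩ := h'
  refine ⟨e ≪≫ f, ?_, fun g => ?_⟩
  · rw [Iso.trans_hom, Category.assoc, h3, h1]
  · rw [Iso.trans_hom, ← Category.assoc, h2, Category.assoc, h4, Category.assoc]

theorem IsQuot.prod_left [CharZero k] [Finite H] (h : IsQuot π P Q) (B : EqVar T Δ) :
    IsQuot (MonoidHom.prodMap (.id Δ) π) (B.prod P) (B.prod Q) := by
  refine ((((h.prod B).push (β_ S T).hom).res
    (MonoidHom.prod (MonoidHom.snd Δ H) (MonoidHom.fst Δ H))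
    (MonoidHom.prod (MonoidHom.snd Δ Γ) (MonoidHom.fst Δ Γ)) ?_ ?_).of_iso
    (EqVar.prod_swap_iso B P)).trans_iso (EqVar.prod_swap_iso B Q).symm
  · rintro ⟨a, b⟩
    rfl
  · rintro ⟨a, b⟩ hab
    exact ⟨(b, a), by simpa [and_comm] using hab, rfl⟩

end eqvar

/-! ### The class of a quotient -/

section quo

variable {k : Type u} [Field k] [IsAlgClosed k] [CharZero k] {S T : Sch k} {H Γ Δ H' Γ' : Type*}
  [Group H] [Group Γ] [Group Δ] [Group H'] [Group Γ'] [Finite H] [Finite H']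
  {π : H →* Γ} {P P' : EqVar S H} {Q Q' : EqVar S Γ}

/-- The class of the quotient of `P` by the kernel of `π`. -/
def quo (π : H →* Γ) (hπ : Function.Surjective π) (P : EqVar S H) : K0 S Γ :=
  K0.mk (exists_isQuot hπ P).choose

omit [IsAlgClosed k] in
theorem quo_eq (hπ : Function.Surjective π) (h : IsQuot π P Q) : quo π hπ P = K0.mk Q :=
  K0.mk_iso ((exists_isQuot hπ P).choose_spec.unique h hπ)

omit [IsAlgClosed k] in
theorem quo_iso (hπ : Function.Surjective π) (h : P.Iso P') : quo π hπ P = quo π hπ P' := by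
  obtain ⟨Q, hQ⟩ := exists_isQuot hπ P'
  rw [quo_eq hπ hQ, quo_eq hπ (hQ.of_iso h)]

omit [IsAlgClosed k] in
theorem quo_scissor (hπ : Function.Surjective π) {X Y U : EqVar S H} (h : X.IsScissor Y U) :
    quo π hπ X = quo π hπ U + quo π hπ Y := by
  obtain ⟨QX, hX⟩ := exists_isQuot hπ X
  obtain ⟨QY, hY⟩ := exists_isQuot hπ Y
  obtain ⟨QU, hU⟩ := exists_isQuot hπ U
  rw [quo_eq hπ hX, quo_eq hπ hY, quo_eq hπ hU]
  exact K0.mk_scissor (hX.scissor hπ h hY hU)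

omit [IsAlgClosed k] in
theorem quo_comp [Finite Γ] (hπ : Function.Surjective π) (h : IsQuot π P Q) (π₂ : Γ →* Δ)
    (hπ₂ : Function.Surjective π₂) (π₃ : H →* Δ) (hπ₃ : Function.Surjective π₃)
    (e : ∀ h, π₃ h = π₂ (π h)) : quo π₃ hπ₃ P = quo π₂ hπ₂ Q := by
  obtain ⟨R, hR⟩ := exists_isQuot hπ₂ Q
  obtain rfl : π₃ = π₂.comp π := MonoidHom.ext e
  rw [quo_eq hπ₂ hR, quo_eq hπ₃ (h.comp hR hπ)]

omit [IsAlgClosed k] in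
theorem quo_res (hπ : Function.Surjective π) (P : EqVar S H) (π' : H' →* Γ)
    (hπ' : Function.Surjective π') (φ : H' →* H) (e : ∀ h, π (φ h) = π' h)
    (e' : ∀ h, π h = 1 → ∃ h', π' h' = 1 ∧ φ h' = h) : quo π' hπ' (P.res φ) = quo π hπ P := by
  obtain ⟨Q, hQ⟩ := exists_isQuot hπ P
  rw [quo_eq hπ hQ]
  exact quo_eq hπ' (hQ.res φ (.id Γ) e e')

theorem quo_smul (hπ : Function.Surjective π) (R : EqVar (𝟙_ (Sch k)) Unit) (P : EqVar S H) :
    quo π hπ (R.smul P) = (K0.mk R : K0Var k) • quo π hπ P := by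
  obtain ⟨Q, hQ⟩ := exists_isQuot hπ P
  rw [quo_eq hπ hQ, K0.mk_smul]
  refine quo_eq hπ (((hQ.prod_left R).push (λ_ S).hom).res (MonoidHom.inr Unit H)
    (MonoidHom.inr Unit Γ) (fun h => rfl) ?_)
  rintro ⟨a, b⟩ hab
  exact ⟨b, by simpa using hab, rfl⟩

end quo

/-! ### Global functions and morphisms to affine schemes -/

section points

variable {k : Type u} [Field k]

/-- The ring of global functions. -/
abbrev Gl (X : Sch k) : CommRingCat.{u} := Γ(X.left, ⊤)

/-- The pullback of global functions. -/
def pb {X Y : Sch k} (f : X ⟶ Y) : Gl Y →+* Gl X := f.left.appTop.hom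

@[simp]
theorem pb_id (X : Sch k) (a : Gl X) : pb (𝟙 X) a = a := by simp [pb]

@[simp]
theorem pb_comp {X Y Z : Sch k} (f : X ⟶ Y) (g : Y ⟶ Z) (a : Gl Z) :
    pb (f ≫ g) a = pb f (pb g a) := by
  change (f.left ≫ g.left).appTop a = _
  rw [Scheme.Hom.comp_appTop]
  rfl

/-- The constant functions. -/
def cst (X : Sch k) : k →+* Gl X :=
  X.hom.appTop.hom.comp (Scheme.ΓSpecIso (.of k)).inv.hom

@[simp]
theorem pb_cst {X Y : Sch k} (f : X ⟶ Y) (a : k) : pb f (cst Y a) = cst X a := by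
  change (Y.hom.appTop ≫ f.left.appTop) _ = _
  rw [← Scheme.Hom.comp_appTop, Over.w]
  rfl

theorem pb_eval₂ {X Y : Sch k} (f : X ⟶ Y) {σ : Type*} (p : MvPolynomial σ k) (v : σ → Gl Y) :
    pb f (p.eval₂ (cst Y) v) = p.eval₂ (cst X) fun i => pb f (v i) := by
  rw [← MvPolynomial.coe_eval₂Hom, ← MvPolynomial.coe_eval₂Hom, ← RingHom.comp_apply]
  congr 1
  ext <;> simp

/-- The affine scheme of a `k`-algebra. -/
def specOver (k : Type u) [Field k] (A : Type u) [CommRing A] [Algebra k A] : Sch k :=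
  Over.mk (Spec.map (CommRingCat.ofHom (algebraMap k A)))

variable {A : Type u} [CommRing A] [Algebra k A]

instance : IsAffine (specOver k A).left := inferInstanceAs (IsAffine (Spec _))

variable (k A) in
/-- The functions given by elements of the algebra. -/
def gen : A →+* Gl (specOver k A) := (Scheme.ΓSpecIso (.of A)).inv.hom

variable (k A) in
theorem gen_bijective : Function.Bijective (gen k A) :=
  ConcreteCategory.bijective_of_isIso (Scheme.ΓSpecIso (.of A)).inv

theorem gen_algebraMap (a : k) : gen k A (algebraMap k A a) = cst _ a := by
  have := Scheme.ΓSpecIso_inv_naturality (CommRingCat.ofHom (algebraMap k A))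
  exact congr($this a)

theorem specOver_hom_ext {T : Sch k} {f g : T ⟶ specOver k A}
    (h : ∀ a, pb f (gen k A a) = pb g (gen k A a)) : f = g := by
  ext1
  refine ext_of_isAffine ?_
  ext x
  obtain ⟨a, rfl⟩ := (gen_bijective k A).2 x
  exact h a

theorem exists_toSpecOver {T : Sch k} (φ : A →+* Gl T)
    (hφ : ∀ a, φ (algebraMap k A a) = cst T a) :
    ∃ f : T ⟶ specOver k A, ∀ a, pb f (gen k A a) = φ a := by
  let f : T.left ⟶ Spec (.of A) := T.left.toSpecΓ ≫ Spec.map (CommRingCat.ofHom φ)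
  refine ⟨Over.homMk f ?_, fun a => ?_⟩
  · change (T.left.toSpecΓ ≫ Spec.map (CommRingCat.ofHom φ)) ≫
      Spec.map (CommRingCat.ofHom (algebraMap k A)) = T.hom
    have h1 : CommRingCat.ofHom (algebraMap k A) ≫ CommRingCat.ofHom φ =
        (Scheme.ΓSpecIso (.of k)).inv ≫ T.hom.appTop := by
      ext a
      exact hφ a
    rw [Category.assoc, ← Spec.map_comp, h1, Spec.map_comp, ← Scheme.toSpecΓ_naturality_assoc,
      toSpecΓ_SpecMap_ΓSpecIso_inv, Category.comp_id]
  · change ((Scheme.ΓSpecIso (.of A)).inv ≫ f.appTop) a = φ a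
    simp [f, Scheme.toSpecΓ_appTop, Scheme.ΓSpecIso_naturality]

theorem A1.hom_ext {T : Sch k} {f g : T ⟶ A1 k}
    (h : pb f (A1.coord k) = pb g (A1.coord k)) : f = g := by
  ext1
  refine AffineSpace.hom_ext ?_ fun _ => h
  exact (Over.w f).trans (Over.w g).symm

@[simp]
theorem A1.pb_ofFun {T : Sch k} (a : Gl T) : pb (A1.ofFun a) (A1.coord k) = a :=
  AffineSpace.homOfVector_appTop_coord _ _ _

@[simp]
theorem A1.comp_ofFun {T T' : Sch k} (f : T' ⟶ T) (a : Gl T) :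
    f ≫ A1.ofFun a = A1.ofFun (pb f a) := A1.hom_ext (by simp)

/-! ### Loci where a function is invertible or zero -/

/-- `j` represents the points at which `f` is invertible. -/
structure IsNonvanishing {D T : Sch k} (j : D ⟶ T) (f : Gl T) : Prop where
  unit : IsUnit (pb j f)
  lift : ∀ (Z : Sch k) (g : Z ⟶ T), IsUnit (pb g f) → ∃ l, l ≫ j = g
  ext : ∀ (Z : Sch k) (l l' : Z ⟶ D), l ≫ j = l' ≫ j → l = l'

/-- `i` represents the points at which `f` is zero. -/
structure IsVanishing {E T : Sch k} (i : E ⟶ T) (f : Gl T) : Prop where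
  zero : pb i f = 0
  lift : ∀ (Z : Sch k) (g : Z ⟶ T), pb g f = 0 → ∃ l, l ≫ i = g
  ext : ∀ (Z : Sch k) (l l' : Z ⟶ E), l ≫ i = l' ≫ i → l = l'

/-- The inclusion of the basic open set of `f` has the same universal property, so `j` differs from
it by an isomorphism. -/
theorem IsNonvanishing.spec {D T : Sch k} {j : D ⟶ T} {f : Gl T} (h : IsNonvanishing j f) :
    ∃ _ : IsOpenImmersion j.left, j.left.opensRange = T.left.basicOpen f := by
  let U := T.left.basicOpen f
  let V : Sch k := Over.mk (U.ι ≫ T.hom)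
  let ι : V ⟶ T := Over.homMk U.ι rfl
  have hι : IsUnit (pb ι f) := by
    have h1 := T.left.toRingedSpace.isUnit_res_basicOpen f
    have hle : U.ι ''ᵁ ⊤ ≤ U := by simp
    have h2 := h1.map (T.left.presheaf.map (homOfLE hle).op).hom
    change IsUnit (U.ι.appTop f)
    rw [Scheme.Opens.ι_appTop]
    convert! h2 using 1
    have h3 := T.left.presheaf.map_comp (homOfLE (T.left.basicOpen_le f)).op (homOfLE hle).op
    exact congr($h3 f)
  obtain ⟨l, hl⟩ := h.lift V ι hι
  have hpre : j.left ⁻¹ᵁ U = ⊤ := by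
    rw [Scheme.preimage_basicOpen]
    exact Scheme.basicOpen_of_isUnit _ h.unit
  let m₀ := IsOpenImmersion.lift U.ι j.left <| by
    rw [Scheme.Opens.range_ι]
    rintro _ ⟨x, rfl⟩
    exact hpre.ge trivial
  have hm₀ : m₀ ≫ U.ι = j.left := IsOpenImmersion.lift_fac _ _ _
  let m : D ⟶ V := Over.homMk m₀ (by
    change m₀ ≫ U.ι ≫ T.hom = _
    rw [reassoc_of% hm₀, Over.w])
  have hm : m ≫ ι = j := by ext1; exact hm₀
  have e1 : m ≫ l = 𝟙 D := h.ext _ _ _ (by rw [Category.assoc, hl, hm, Category.id_comp])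
  have e2 : l ≫ m = 𝟙 V := by
    ext1
    rw [← cancel_mono U.ι]
    have := congr(($hl).left)
    rw [← hm, Over.comp_left, Over.comp_left] at this
    exact (Category.assoc _ _ _).trans (this.trans (Category.id_comp _).symm)
  have hiso : IsIso m₀ := by
    refine ⟨l.left, ?_, ?_⟩
    · exact congr(($e1).left)
    · exact congr(($e2).left)
  have : IsOpenImmersion j.left := hm₀ ▸ inferInstance
  refine ⟨this, ?_⟩
  have h := Scheme.Hom.opensRange_comp_of_isIso m₀ U.ι
  simp only [hm₀, Scheme.Opens.opensRange_ι] at h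
  exact h

theorem isClosedImmersion_zero : IsClosedImmersion (A1.zero k).left := by
  have h : (A1.zero k).left ≫ (A1 k).hom = 𝟙 _ := Over.w (A1.zero k)
  have h1 : IsClosedImmersion ((A1.zero k).left ≫ (A1 k).hom) := by rw [h]; infer_instance
  have h2 : IsSeparated (A1 k).hom := by
    change IsSeparated (𝔸(PUnit.{u + 1}; Spec (CommRingCat.of k)) ↘ Spec (CommRingCat.of k))
    infer_instance
  exact .of_comp (A1.zero k).left (A1 k).hom

theorem isUnit_or_eq_zero_of_specField {K : Type u} [Field K] {a : Γ(Spec (.of K), ⊤)}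
    (h : ¬ IsUnit a) : a = 0 := by
  let e := (Scheme.ΓSpecIso (.of K)).commRingCatIsoToRingEquiv
  by_contra ha
  apply h
  have : e a ≠ 0 := fun h0 => ha (by simpa using h0)
  simpa using (isUnit_iff_ne_zero.2 this).map e.symm

/-- By its universal property `E` is the fibre over the origin of the map to the line given by `f`,
so `i` is a closed immersion. At a point outside the basic open set `f` is zero in the residue
field, so the spectrum of that field factors through `E`. -/
theorem IsVanishing.spec {E T : Sch k} {i : E ⟶ T} {f : Gl T} (h : IsVanishing i f) :
    IsClosedImmersion i.left ∧ Set.range i.left = (T.left.basicOpen f : Set T.left)ᶜ := by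
  constructor
  · have sq : IsPullback i (toUnit E) (A1.ofFun f) (A1.zero k) := by
      refine ⟨⟨A1.hom_ext ?_⟩, ⟨PullbackCone.IsLimit.mk _ (fun s => (h.lift _ s.fst ?_).choose)
        (fun s => (h.lift _ s.fst ?_).choose_spec) (fun s => toUnit_unique _ _)
        fun s m hm _ => h.ext _ _ _ (hm.trans (h.lift _ s.fst ?_).choose_spec.symm)⟩⟩
      · simp [h.zero, A1.zero]
      all_goals
        have := congr(pb $(s.condition) (A1.coord k))
        simpa [A1.zero] using this
    exact MorphismProperty.of_isPullback (P := @IsClosedImmersion)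
      (sq.map (Over.forget _)).flip isClosedImmersion_zero
  · ext x
    constructor
    · rintro ⟨y, rfl⟩ hy
      have : y ∈ i.left ⁻¹ᵁ T.left.basicOpen f := hy
      rw [Scheme.preimage_basicOpen] at this
      have h0 : i.left.appTop f = 0 := h.zero
      change y ∈ E.left.basicOpen (i.left.appTop f) at this
      rw [h0, Scheme.basicOpen_zero] at this
      exact this
    · intro hx
      let z : Spec (T.left.residueField x) := IsLocalRing.closedPoint (T.left.residueField x)
      let Z : Sch k := Over.mk (T.left.fromSpecResidueField x ≫ T.hom)
      let g : Z ⟶ T := Over.homMk (T.left.fromSpecResidueField x) rfl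
      have hg : pb g f = 0 := by
        refine isUnit_or_eq_zero_of_specField fun hu => hx ?_
        have h1 : (T.left.fromSpecResidueField x) ⁻¹ᵁ T.left.basicOpen f = ⊤ := by
          rw [Scheme.preimage_basicOpen]
          exact Scheme.basicOpen_of_isUnit _ hu
        have h2 : z ∈ (T.left.fromSpecResidueField x) ⁻¹ᵁ T.left.basicOpen f := h1.ge trivial
        have h3 : T.left.fromSpecResidueField x z ∈ T.left.basicOpen f := h2
        rwa [Scheme.fromSpecResidueField_apply] at h3
      obtain ⟨l, hl⟩ := h.lift Z g hg
      refine ⟨l.left z, ?_⟩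
      rw [← Scheme.Hom.comp_apply, ← Over.comp_left, hl]
      exact Scheme.fromSpecResidueField_apply _ _

/-- With both loci described by functors of points, scissor decompositions of explicit varieties
become manipulations of equations. -/
theorem isScissor_of_locus {S : Sch k} {Δ : Type*} [Group Δ] {X Y U : EqVar S Δ} {i : Y.X ⟶ X.X}
    {j : U.X ⟶ X.X} {f : Gl X.X} (hi : EqVar.IsHom Y X i) (hj : EqVar.IsHom U X j)
    (hi' : IsVanishing i f) (hj' : IsNonvanishing j f) : X.IsScissor Y U := by
  obtain ⟨h1, h2⟩ := hj'.spec
  obtain ⟨h3, h4⟩ := hi'.spec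
  refine ⟨i, j, hi, hj, h3, h1, ?_⟩
  rw [h4, compl_compl, ← h2]
  rfl

end points

/-! ### Kummer covers -/

section ring

variable {k : Type u} [Field k] {n : ℕ}

theorem root_pow (s : rootsOfUnity n k) : ((s : kˣ) : k) ^ n = 1 := by
  rw [← Units.val_pow_eq_pow_val, (mem_rootsOfUnity n _).1 s.2, Units.val_one]

theorem sum_pow_root [NeZero n] (s : rootsOfUnity n k) (hs : s ≠ 1) :
    ∑ j ∈ Finset.range n, ((s : kˣ) : k) ^ j = 0 := by
  have h1 : ((s : kˣ) : k) ≠ 1 := fun h => hs (Subtype.ext (Units.ext h))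
  have := geom_sum_mul ((s : kˣ) : k) n
  rw [root_pow, sub_self] at this
  exact (mul_eq_zero.1 this).resolve_right (sub_ne_zero.2 h1)

variable [NeZero n] [IsAlgClosed k] [CharZero k]

theorem exists_primitive (n : ℕ) [NeZero n] (k : Type u) [Field k] [IsAlgClosed k] [CharZero k] :
    ∃ s : rootsOfUnity n k, IsPrimitiveRoot ((s : kˣ) : k) n := by
  obtain ⟨ζ, hζ⟩ := HasEnoughRootsOfUnity.exists_primitiveRoot k n
  refine ⟨⟨(hζ.isUnit (NeZero.ne n)).unit, ?_⟩, hζ⟩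
  rw [mem_rootsOfUnity]
  ext
  exact hζ.pow_eq_one

/-- Polynomials that are invariant under multiplication of the variable by roots of unity are
polynomials in the `n`-th power of the variable. -/
theorem exists_expand_eq (p : Polynomial k)
    (hp : ∀ s : rootsOfUnity n k, p.comp (.C ((s : kˣ) : k) * .X) = p) :
    ∃ q, Polynomial.expand k n q = p := by
  obtain ⟨s, hs⟩ := exists_primitive n k
  refine ⟨Polynomial.contract n p, Polynomial.ext fun i => ?_⟩
  rw [Polynomial.coeff_expand (NeZero.pos n)]
  split_ifs with h
  · rw [Polynomial.coeff_contract (NeZero.ne n), Nat.div_mul_cancel h]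
  · have h1 := congr(Polynomial.coeff $(hp s) i)
    rw [Polynomial.comp_C_mul_X_coeff] at h1
    by_contra h2
    refine h (hs.dvd_of_pow_eq_one i ?_)
    exact mul_left_cancel₀ (Ne.symm h2) (h1.trans (mul_one _).symm)

/-- If a ring with an action of the roots of unity has a unit on which the roots of unity act by
multiplication, then it is reduced as soon as its ring of invariants is. -/
theorem isReduced_of_eigen {A B : Type*} [CommRing A] [CommRing B] (φ : A →+* B)
    [_root_.IsReduced A] (c : k →+* B) (τ : rootsOfUnity n k → B →+* B)
    (hτ : ∀ s t b, τ (s * t) b = τ s (τ t b)) (hτ₁ : ∀ b, τ 1 b = b)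
    (hφ : Function.Injective φ) (hφ' : ∀ b, (∀ s, τ s b = b) → ∃ a, φ a = b)
    (hc : ∀ s a, τ s (c a) = c a) (y : B) (hy : IsUnit y)
    (hτy : ∀ s, τ s y = c ((s : kˣ) : k) * y) : _root_.IsReduced B := by
  have := Fintype.ofFinite (rootsOfUnity n k)
  refine ⟨fun f hf => ?_⟩
  -- Up to a factor `n`, these are the isotypic components of `f`. Multiplied by the `j`-th power of
  -- the unit `y`, a component becomes invariant and stays nilpotent, so it comes from a nilpotent
  -- of `A` and vanishes. Summing over `j` recovers `n * f`.
  let F (j : ℕ) : B := ∑ s : rootsOfUnity n k, c ((s : kˣ) : k) ^ j * τ s f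
  have hF (j : ℕ) : F j = 0 := by
    have h1 (t : rootsOfUnity n k) : c ((t : kˣ) : k) ^ j * τ t (F j) = F j := by
      simp only [F, map_sum, map_mul, map_pow, hc, Finset.mul_sum, ← hτ]
      refine Fintype.sum_equiv (Equiv.mulLeft t) _ _ fun s => ?_
      simp [mul_pow, mul_assoc]
    have h2 : IsNilpotent (F j) := isNilpotent_sum fun s _ =>
      Commute.isNilpotent_mul_left (Commute.all _ _) (hf.map (τ s))
    obtain ⟨a, ha⟩ := hφ' (y ^ j * F j) fun t => by
      rw [map_mul, map_pow, hτy, mul_pow]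
      conv_rhs => rw [← h1 t]
      ring
    have h3 : IsNilpotent (φ a) := by
      rw [ha]
      exact Commute.isNilpotent_mul_left (Commute.all _ _) h2
    have h4 : IsNilpotent a := by
      obtain ⟨m, hm⟩ := h3
      exact ⟨m, hφ (by rw [map_pow, hm, map_zero])⟩
    rw [h4.eq_zero, map_zero] at ha
    exact ((hy.pow j).mul_right_eq_zero).1 ha.symm
  have h5 : (n : B) * f = 0 := by
    have h6 : ∑ j ∈ Finset.range n, F j = 0 := Finset.sum_eq_zero fun j _ => hF j
    simp only [F] at h6
    rw [Finset.sum_comm] at h6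
    rw [← h6, Finset.sum_eq_single 1]
    · simp [hτ₁]
    · intro s _ hs
      rw [← Finset.sum_mul]
      simp only [← map_pow]
      rw [← map_sum, sum_pow_root s hs, map_zero, zero_mul]
    · simp
  have h7 : IsUnit (n : B) := by
    have : IsUnit ((n : ℕ) : k) := (Nat.cast_ne_zero.2 (NeZero.ne n)).isUnit
    simpa using this.map c
  exact (h7.mul_right_eq_zero).1 h5

end ring

/-! ### Kummer covers as base changes of the power map on the line -/

section kummer

variable {k : Type u} [Field k] {n : ℕ}

/-- `K` is the cover of `X` obtained by adjoining an `n`-th root `y` of the function `w`. -/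
structure IsKummer (n : ℕ) {K X : Sch k} (p : K ⟶ X) (y : Gl K) (w : Gl X) : Prop where
  pow : y ^ n = pb p w
  lift : ∀ (T : Sch k) (f : T ⟶ X) (v : Gl T), v ^ n = pb f w → ∃ g : T ⟶ K, g ≫ p = f ∧ pb g y = v
  ext : ∀ (T : Sch k) (g g' : T ⟶ K), g ≫ p = g' ≫ p → pb g y = pb g' y → g = g'

variable (k) in
/-- The affine line, as the spectrum of the polynomial ring. -/
abbrev L1 : Sch k := specOver k (Polynomial k)

variable (k) in
/-- The coordinate on the affine line. -/
def L1.coord : Gl (L1 k) := gen k (Polynomial k) .X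

theorem L1.exists_lift {T : Sch k} (a : Gl T) : ∃ f : T ⟶ L1 k, pb f (L1.coord k) = a := by
  obtain ⟨f, hf⟩ := exists_toSpecOver (A := Polynomial k) (Polynomial.eval₂RingHom (cst T) a)
    fun c => by simp
  exact ⟨f, by simp [L1.coord, hf]⟩

theorem L1.hom_ext {T : Sch k} {f g : T ⟶ L1 k} (h : pb f (L1.coord k) = pb g (L1.coord k)) :
    f = g := by
  refine specOver_hom_ext fun a => ?_
  suffices (pb f).comp (gen k _) = (pb g).comp (gen k _) from congr($this a)
  refine Polynomial.ringHom_ext (fun c => ?_) h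
  have : gen k (Polynomial k) (.C c) = cst _ c := gen_algebraMap c
  simp [this]

theorem L1.pb_gen {T : Sch k} (f : T ⟶ L1 k) (p : Polynomial k) :
    pb f (gen k _ p) = p.eval₂ (cst T) (pb f (L1.coord k)) := by
  suffices (pb f).comp (gen k _) = Polynomial.eval₂RingHom (cst T) (pb f (L1.coord k)) from
    congr($this p)
  refine Polynomial.ringHom_ext (fun c => ?_) ?_
  · have : gen k (Polynomial k) (.C c) = cst _ c := gen_algebraMap c
    simp [this]
  · simp [L1.coord]

theorem L1.gen_eval₂ (p q : Polynomial k) :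
    p.eval₂ (cst (L1 k)) (gen k _ q) = gen k _ (p.comp q) := by
  rw [Polynomial.comp, Polynomial.hom_eval₂]
  congr 1
  ext c
  exact (gen_algebraMap c).symm

variable (n) in
/-- The `n`-th power map on the affine line. -/
def L1.pow : L1 k ⟶ L1 k := (L1.exists_lift (L1.coord k ^ n)).choose

theorem L1.pb_pow : pb (L1.pow n) (L1.coord k) = L1.coord k ^ n :=
  (L1.exists_lift (L1.coord k ^ n)).choose_spec

/-- Multiplication by a scalar on the affine line. -/
def L1.scale (s : k) : L1 k ⟶ L1 k := (L1.exists_lift (cst _ s * L1.coord k)).choose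

theorem L1.pb_scale (s : k) : pb (L1.scale s) (L1.coord k) = cst _ s * L1.coord k :=
  (L1.exists_lift (cst _ s * L1.coord k)).choose_spec

theorem L1.isAct : IsAct fun s : rootsOfUnity n k => (L1.scale ((s : kˣ) : k)).left := by
  refine ⟨?_, fun s t => ?_⟩
  · have : L1.scale (1 : k) = 𝟙 _ := L1.hom_ext (by simp [L1.pb_scale])
    simp [this]
  · rw [← Over.comp_left]
    congr 1
    refine L1.hom_ext ?_
    simp [L1.pb_scale, mul_left_comm, mul_assoc]

theorem L1.scale_pow (s : rootsOfUnity n k) : L1.scale ((s : kˣ) : k) ≫ L1.pow n = L1.pow n := by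
  refine L1.hom_ext ?_
  rw [pb_comp, L1.pb_pow, map_pow, L1.pb_scale, mul_pow, ← map_pow, root_pow, map_one, one_mul]

variable [NeZero n] [IsAlgClosed k] [CharZero k]

/-- The universal Kummer cover: a polynomial invariant under scaling the variable by `n`-th roots of
unity is a polynomial in its `n`-th power. -/
theorem L1.isQuotientBy_pow :
    IsQuotientBy (fun s : rootsOfUnity n k => (L1.scale ((s : kˣ) : k)).left)
      (L1.pow (k := k) n).left := by
  have e (p : Polynomial k) : pb (L1.pow n) (gen k _ p) = gen k _ (Polynomial.expand k n p) := by
    rw [L1.pb_gen, L1.pb_pow, L1.coord, ← map_pow, L1.gen_eval₂, Polynomial.expand_eq_comp_X_pow]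
  have e' (s : k) (p : Polynomial k) :
      pb (L1.scale s) (gen k _ p) = gen k _ (p.comp (.C s * .X)) := by
    have : gen k (Polynomial k) (.C s) = cst _ s := gen_algebraMap s
    rw [L1.pb_gen, L1.pb_scale, ← this, L1.coord, ← map_mul, L1.gen_eval₂]
  refine .of_isAffine L1.isAct (cardUnit _ _) (fun s => ?_) ?_ ?_
  · rw [← Over.comp_left, L1.scale_pow]
  · change Function.Injective (pb (L1.pow n))
    intro a b hab
    obtain ⟨a, rfl⟩ := (gen_bijective k _).2 a
    obtain ⟨b, rfl⟩ := (gen_bijective k _).2 b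
    rw [e, e] at hab
    exact congr(gen k _ $(Polynomial.expand_injective (NeZero.pos n) ((gen_bijective k _).1 hab)))
  · change ∀ x, (∀ s : rootsOfUnity n k, pb (L1.scale ((s : kˣ) : k)) x = x) → ∃ a, pb (L1.pow n) a = x
    intro x hx
    obtain ⟨p, rfl⟩ := (gen_bijective k _).2 x
    obtain ⟨q, rfl⟩ := exists_expand_eq p fun s => (gen_bijective k _).1 ((e' _ _).symm.trans (hx s))
    exact ⟨_, e q⟩

omit [NeZero n] [IsAlgClosed k] [CharZero k] in
theorem isReduced_of_isAffineHom {K X : Scheme.{u}} (p : K ⟶ X) [IsAffineHom p]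
    (h : ∀ U, _root_.IsReduced Γ(K, p ⁻¹ᵁ U)) : IsReduced K := by
  have hcov : TopologicalSpace.IsOpenCover fun U : X.affineOpens => p ⁻¹ᵁ U.1 := by
    rw [TopologicalSpace.IsOpenCover, eq_top_iff]
    intro x _
    have : p x ∈ (⨆ U : X.affineOpens, U.1) := by rw [iSup_affineOpens_eq_top]; trivial
    obtain ⟨U, hU⟩ := TopologicalSpace.Opens.mem_iSup.1 this
    exact TopologicalSpace.Opens.mem_iSup.2 ⟨U, hU⟩
  have H (U : X.affineOpens) : IsReduced (p ⁻¹ᵁ U.1).toScheme := by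
    have : IsAffine (p ⁻¹ᵁ U.1).toScheme := U.2.preimage p
    have := h U.1
    have : _root_.IsReduced Γ((p ⁻¹ᵁ U.1).toScheme, ⊤) :=
      isReduced_of_injective (p ⁻¹ᵁ U.1).topIso.hom.hom
        (ConcreteCategory.bijective_of_isIso (p ⁻¹ᵁ U.1).topIso.hom).1
    exact isReduced_of_isAffine_isReduced _
  exact @IsReduced.of_openCover _ (K.openCoverOfIsOpenCover _ hcov) H

namespace IsKummer

variable {K X : Sch k} {p : K ⟶ X} {y : Gl K} {w : Gl X}

omit [NeZero n] [IsAlgClosed k] [CharZero k] in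
theorem exists_isPullback (h : IsKummer n p y w) : ∃ (f : K ⟶ L1 k) (g : X ⟶ L1 k),
    pb f (L1.coord k) = y ∧ pb g (L1.coord k) = w ∧ IsPullback f p (L1.pow n) g := by
  obtain ⟨f, hf⟩ := L1.exists_lift y
  obtain ⟨g, hg⟩ := L1.exists_lift w
  have key (s : PullbackCone (L1.pow n) g) : ∃ l : s.pt ⟶ K, l ≫ p = s.snd ∧
      pb l y = pb s.fst (L1.coord k) := by
    refine h.lift _ _ _ ?_
    have := congr(pb $(s.condition) (L1.coord k))
    rwa [pb_comp, pb_comp, L1.pb_pow, hg, map_pow] at this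
  refine ⟨f, g, hf, hg, ⟨L1.hom_ext ?_⟩, ⟨PullbackCone.IsLimit.mk _ (fun s => (key s).choose)
    (fun s => L1.hom_ext ?_) (fun s => (key s).choose_spec.1) fun s m h1 h2 => h.ext _ _ _ ?_ ?_⟩⟩
  · rw [pb_comp, pb_comp, L1.pb_pow, map_pow, hf, hg, h.pow]
  · rw [pb_comp, hf, (key s).choose_spec.2]
  · rw [h2, (key s).choose_spec.1]
  · rw [(key s).choose_spec.2, ← h1, pb_comp, hf]

/-- Every Kummer cover is a base change of the power map, and quotients commute with base change;
neither reducedness of the cover nor invertibility of `w` is involved. -/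
theorem isQuotientBy (h : IsKummer n p y w) (τ : rootsOfUnity n k → (K ⟶ K))
    (hτ : ∀ s, τ s ≫ p = p) (hτy : ∀ s, pb (τ s) y = cst K ((s : kˣ) : k) * y) :
    IsQuotientBy (fun s => (τ s).left) p.left := by
  obtain ⟨f, g, hf, hg, sq⟩ := h.exists_isPullback
  refine L1.isQuotientBy_pow.of_isPullback L1.isAct (cardUnit _ _) (sq.map (Over.forget _))
    (fun s => ?_) fun s => ?_
  · change (τ s).left ≫ f.left = f.left ≫ _
    rw [← Over.comp_left, ← Over.comp_left]
    congr 1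
    refine L1.hom_ext ?_
    rw [pb_comp, pb_comp, hf, hτy, L1.pb_scale, map_mul, hf, pb_cst]
  · change (τ s).left ≫ p.left = p.left
    rw [← Over.comp_left, hτ]

omit [NeZero n] [IsAlgClosed k] [CharZero k] in
theorem exists_act (h : IsKummer n p y w) : ∃ τ : rootsOfUnity n k → (K ⟶ K),
    (∀ s, τ s ≫ p = p) ∧ (∀ s, pb (τ s) y = cst K ((s : kˣ) : k) * y) ∧
      IsAct fun s => (τ s).left := by
  have key (s : rootsOfUnity n k) : ∃ g : K ⟶ K, g ≫ p = p ∧ pb g y = cst K ((s : kˣ) : k) * y :=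
    h.lift _ _ _ (by rw [mul_pow, ← map_pow, root_pow, map_one, one_mul, h.pow])
  choose τ h1 h2 using key
  refine ⟨τ, h1, h2, ⟨?_, fun s t => ?_⟩⟩
  · have : τ 1 = 𝟙 K := h.ext _ _ _ (by rw [h1, Category.id_comp]) (by rw [h2]; simp)
    simp [this]
  · rw [← Over.comp_left]
    congr 1
    refine h.ext _ _ _ (by rw [Category.assoc, h1, h1, h1]) ?_
    rw [pb_comp, h2, h2, map_mul, h2, pb_cst]
    simp [mul_left_comm, mul_assoc]

/-- Invertibility of `w` makes the root `y` a unit of weight one, so `isReduced_of_eigen` applies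
over each open subset of `X`. -/
theorem isReduced (h : IsKummer n p y w) (hw : IsUnit w) (hX : IsReduced X.left) :
    IsReduced K.left := by
  obtain ⟨τ, h1, h2, h3⟩ := h.exists_act
  have hq := h.isQuotientBy τ h1 h2
  have := hq.affine
  have hy : IsUnit y := by
    refine (isUnit_pow_iff (NeZero.ne n)).1 ?_
    rw [h.pow]
    exact hw.map (pb p)
  have key (U : X.left.Opens) : _root_.IsReduced Γ(K.left, p.left ⁻¹ᵁ U) := by
    let res : Gl K →+* Γ(K.left, p.left ⁻¹ᵁ U) :=
      secRes p.left (le_top : U ≤ ⊤)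
    have hres (s) (x : Gl K) : secMap (hq.invariant s) U (res x) = res (pb (τ s) x) := by
      refine (secMap_res (hq.invariant s) (le_top : U ≤ ⊤) x).trans ?_
      rw [secMap_top]
      rfl
    let _ := h3.mulSemiringAction hq.invariant U
    refine isReduced_of_eigen (n := n) (k := k) (p.left.app U).hom (res.comp (cst K))
      (fun s => secMap (hq.invariant s) U) (fun s t b => mul_smul s t b) (fun b => one_smul (rootsOfUnity n k) b)
      (hq.injective U) (hq.isInvOn U).surj (fun s a => ?_) (res y) (hy.map res) fun s => ?_
    · rw [RingHom.comp_apply, hres, pb_cst]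
    · rw [hres, h2, map_mul]
      rfl
  exact isReduced_of_isAffineHom p.left key

end IsKummer

end kummer

/-! ### Subschemes of tori -/

section torus

variable {k : Type u} [Field k] {σ τ : Type}

/-- An affine scheme of finite type over `k`. -/
structure IsAffineFT (X : Sch k) : Prop where
  affine : IsAffine X.left
  locallyOfFiniteType : LocallyOfFiniteType X.hom

theorem IsAffineFT.isVariety {X : Sch k} (h : IsAffineFT X) (h' : IsReduced X.left) :
    IsVariety X := by
  obtain ⟨h1, h2⟩ := h
  exact ⟨h', inferInstance, h2, inferInstance⟩

theorem isAffineFT_specOver (A : Type u) [CommRing A] [Algebra k A] [h : Algebra.FiniteType k A] :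
    IsAffineFT (specOver k A) := by
  refine ⟨inferInstance, ?_⟩
  refine (HasRingHomProperty.Spec_iff (P := @LocallyOfFiniteType)).2 ?_
  change (algebraMap k A).FiniteType
  rwa [RingHom.finiteType_algebraMap]

/-- The coordinates on the zero locus of an ideal in an affine space. -/
def affCoord (I : Ideal (MvPolynomial τ k)) (i : τ) : Gl (specOver k (MvPolynomial τ k ⧸ I)) :=
  gen k _ (Ideal.Quotient.mk I (.X i))

theorem pb_gen_mk {I : Ideal (MvPolynomial τ k)} {T : Sch k}
    (f : T ⟶ specOver k (MvPolynomial τ k ⧸ I)) (p : MvPolynomial τ k) :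
    pb f (gen k _ (Ideal.Quotient.mk I p)) = p.eval₂ (cst T) fun i => pb f (affCoord I i) := by
  suffices ((pb f).comp (gen k _)).comp (Ideal.Quotient.mk I) =
    MvPolynomial.eval₂Hom (cst T) (fun i => pb f (affCoord I i)) from congr($this p)
  refine MvPolynomial.ringHom_ext (fun c => ?_) fun i => ?_
  · have : gen k (MvPolynomial τ k ⧸ I) (Ideal.Quotient.mk I (.C c)) = cst _ c := gen_algebraMap c
    simp [this]
  · simp [affCoord]

theorem affCoord_eqn (I : Ideal (MvPolynomial τ k)) (p : MvPolynomial τ k) (hp : p ∈ I) :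
    p.eval₂ (cst _) (affCoord I) = 0 := by
  have := pb_gen_mk (𝟙 (specOver k (MvPolynomial τ k ⧸ I))) p
  simp only [pb_id] at this
  rw [← this, Ideal.Quotient.eq_zero_iff_mem.2 hp, map_zero]

theorem exists_affCoord_lift (G : Set (MvPolynomial τ k)) {T : Sch k} (v : τ → Gl T)
    (hv : ∀ p ∈ G, p.eval₂ (cst T) v = 0) :
    ∃ f : T ⟶ specOver k (MvPolynomial τ k ⧸ Ideal.span G),
      ∀ i, pb f (affCoord (Ideal.span G) i) = v i := by
  have hle : ∀ p ∈ Ideal.span G, MvPolynomial.eval₂Hom (cst T) v p = 0 := by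
    intro p hp
    have : Ideal.span G ≤ RingHom.ker (MvPolynomial.eval₂Hom (cst T) v) :=
      Ideal.span_le.2 fun p hp => hv p hp
    exact this hp
  obtain ⟨f, hf⟩ := exists_toSpecOver (A := MvPolynomial τ k ⧸ Ideal.span G)
    (Ideal.Quotient.lift _ _ hle) fun a => by
      change MvPolynomial.eval₂Hom (cst T) v (.C a) = _
      simp
  refine ⟨f, fun i => ?_⟩
  rw [affCoord, hf, Ideal.Quotient.lift_mk]
  simp

theorem affCoord_ext {I : Ideal (MvPolynomial τ k)} {T : Sch k}
    {f g : T ⟶ specOver k (MvPolynomial τ k ⧸ I)}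
    (h : ∀ i, pb f (affCoord I i) = pb g (affCoord I i)) : f = g := by
  refine specOver_hom_ext fun a => ?_
  obtain ⟨p, rfl⟩ := Ideal.Quotient.mk_surjective a
  rw [pb_gen_mk, pb_gen_mk]
  simp only [h]

/-- The functions `u` exhibit `X` as the subscheme of a torus that is defined by the equations
`E`. -/
structure TorusRep (X : Sch k) (u : σ → Gl X) (E : Set (MvPolynomial σ k)) : Prop where
  unit : ∀ i, IsUnit (u i)
  eqn : ∀ p ∈ E, p.eval₂ (cst X) u = 0
  lift : ∀ (T : Sch k) (v : σ → Gl T), (∀ i, IsUnit (v i)) → (∀ p ∈ E, p.eval₂ (cst T) v = 0) →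
    ∃ f : T ⟶ X, ∀ i, pb f (u i) = v i
  ext : ∀ (T : Sch k) (f g : T ⟶ X), (∀ i, pb f (u i) = pb g (u i)) → f = g

/-- The equations of a subscheme of a torus in the affine space with coordinates the coordinates of
the torus and their inverses. -/
def torusEqs (E : Set (MvPolynomial σ k)) : Set (MvPolynomial (σ ⊕ σ) k) :=
  Set.range (fun i => .X (.inl i) * .X (.inr i) - 1) ∪ (MvPolynomial.rename Sum.inl) '' E

/-- The subscheme of a torus that is defined by the equations `E`. -/
abbrev torus (E : Set (MvPolynomial σ k)) : Sch k :=
  specOver k (MvPolynomial (σ ⊕ σ) k ⧸ Ideal.span (torusEqs E))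

/-- The coordinates. -/
abbrev torusCoord (E : Set (MvPolynomial σ k)) (i : σ) : Gl (torus E) :=
  affCoord (Ideal.span (torusEqs E)) (.inl i)

theorem isAffineFT_torus [Finite σ] (E : Set (MvPolynomial σ k)) : IsAffineFT (torus E) :=
  isAffineFT_specOver _

theorem eq_of_mul_eq_one {R : Type*} [CommRing R] {a b c : R} (h : a * b = 1) (h' : a * c = 1) :
    b = c := by
  rw [← one_mul c, ← h, mul_comm a b, mul_assoc, h', mul_one]

theorem mul_eq_one_of_eval₂ {R : Type*} [CommRing R] {f : k →+* R} {v : τ → R} {i j : τ}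
    (h : (MvPolynomial.X i * MvPolynomial.X j - 1 : MvPolynomial τ k).eval₂ f v = 0) :
    v i * v j = 1 := by
  simpa [sub_eq_zero] using h

theorem affCoord_mul {I : Ideal (MvPolynomial τ k)} {i j : τ} (h : .X i * .X j - 1 ∈ I) :
    affCoord I i * affCoord I j = 1 :=
  mul_eq_one_of_eval₂ (affCoord_eqn I _ h)

theorem torusCoord_mul (E : Set (MvPolynomial σ k)) (i : σ) :
    affCoord (Ideal.span (torusEqs E)) (.inl i) * affCoord (Ideal.span (torusEqs E)) (.inr i) =
      1 :=
  affCoord_mul (Ideal.subset_span (Set.mem_union_left _ (Set.mem_range_self i)))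

theorem torusRep_torus (E : Set (MvPolynomial σ k)) : TorusRep (torus E) (torusCoord E) E := by
  constructor
  · exact fun i => .of_mul_eq_one _ (torusCoord_mul E i)
  · intro p hp
    have := affCoord_eqn (Ideal.span (torusEqs E)) _ (Ideal.subset_span (Or.inr ⟨p, hp, rfl⟩))
    rwa [MvPolynomial.eval₂_rename] at this
  · intro T v hv hE
    choose w hw using fun i => (hv i).exists_right_inv
    obtain ⟨f, hf⟩ := exists_affCoord_lift (torusEqs E) (Sum.elim v w) <| by
      rintro _ (⟨i, rfl⟩ | ⟨p, hp, rfl⟩)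
      · simp [hw]
      · rw [MvPolynomial.eval₂_rename]
        exact hE p hp
    exact ⟨f, fun i => hf _⟩
  · intro T f g h
    refine affCoord_ext ?_
    rintro (i | i)
    · exact h i
    · have hf : pb f (affCoord (Ideal.span (torusEqs E)) (.inl i)) *
          pb f (affCoord (Ideal.span (torusEqs E)) (.inr i)) = 1 := by
        rw [← map_mul, torusCoord_mul, map_one]
      have hg : pb g (affCoord (Ideal.span (torusEqs E)) (.inl i)) *
          pb g (affCoord (Ideal.span (torusEqs E)) (.inr i)) = 1 := by
        rw [← map_mul, torusCoord_mul, map_one]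
      rw [← h i] at hg
      exact eq_of_mul_eq_one hf hg

namespace TorusRep

variable {X : Sch k} {u : σ → Gl X} {E : Set (MvPolynomial σ k)} {Δ : Type*} [Group Δ]

theorem exists_scale (h : TorusRep X u E) (s : σ → kˣ)
    (hs : ∀ p ∈ E, p.eval₂ (cst X) (fun i => cst X (s i : k) * u i) = 0) :
    ∃ f : X ⟶ X, ∀ i, pb f (u i) = cst X (s i : k) * u i :=
  h.lift _ _ (fun i => ((s i).isUnit.map (cst X)).mul (h.unit i)) hs

/-- A subvariety of a torus, with a linear action. -/
def eqVar (h : TorusRep X u E) (hX : IsVariety X) (hA : IsAffine X.left) (χ : Δ →* (σ → kˣ))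
    (hχ : ∀ δ, ∀ p ∈ E, p.eval₂ (cst X) (fun i => cst X (χ δ i : k) * u i) = 0) :
    EqVar (𝟙_ (Sch k)) Δ where
  X := X
  isVariety := hX
  p := toUnit X
  act δ := (h.exists_scale (χ δ) (hχ δ)).choose
  act_one := h.ext _ _ _ fun i => by
    rw [(h.exists_scale (χ 1) (hχ 1)).choose_spec]
    simp
  act_mul δ ε := h.ext _ _ _ fun i => by
    have h1 := (h.exists_scale (χ (δ * ε)) (hχ (δ * ε))).choose_spec i
    have h2 := (h.exists_scale (χ ε) (hχ ε)).choose_spec i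
    have h3 := (h.exists_scale (χ δ) (hχ δ)).choose_spec i
    rw [pb_comp, h1, h2, map_mul (pb _), pb_cst, h3, map_mul, Pi.mul_apply,
      Units.val_mul, map_mul]
    ring
  act_p _ := toUnit_unique _ _
  good x := ⟨⊤, isAffineOpen_top _, fun _ => trivial⟩

@[simp]
theorem pb_act (h : TorusRep X u E) (hX : IsVariety X) (hA : IsAffine X.left) (χ : Δ →* (σ → kˣ))
    (hχ) (δ : Δ) (i : σ) : pb ((h.eqVar hX hA χ hχ).act δ) (u i) = cst X (χ δ i : k) * u i :=
  (h.exists_scale (χ δ) (hχ δ)).choose_spec i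

end TorusRep

end torus

/-! ### The curves `xⁿ + yⁿ = c` and related varieties -/

section fermat

variable {k : Type u} [Field k] (n : ℕ) (c : k)

/-- The equation `xⁿ + yⁿ = c`. -/
def eqF : Set (MvPolynomial (Fin 2) k) := {.X 0 ^ n + .X 1 ^ n - .C c}

/-- The equation `yⁿ = c`. -/
def eqM : Set (MvPolynomial (Fin 1) k) := {.X 0 ^ n - .C c}

/-- The equation `w + yⁿ = c`. -/
def eqB : Set (MvPolynomial (Fin 2) k) := {.X 0 + .X 1 ^ n - .C c}

/-- The equation `xⁿ + yⁿ + vⁿ = c`. -/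
def eqT : Set (MvPolynomial (Fin 3) k) := {.X 0 ^ n + .X 1 ^ n + .X 2 ^ n - .C c}

/-- The equations `xⁿ + yⁿ = 0`, `vⁿ = c`. -/
def eqE : Set (MvPolynomial (Fin 3) k) := {.X 0 ^ n + .X 1 ^ n, .X 2 ^ n - .C c}

variable (k) in
/-- The equation `xⁿ + yⁿ = 0` in three variables. -/
def eqG : Set (MvPolynomial (Fin 3) k) := {.X 0 ^ n + .X 1 ^ n}

/-- The equations `xⁿ + yⁿ = c w`, `w + vⁿ = d`. -/
def eqD (d : k) : Set (MvPolynomial (Fin 4) k) :=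
  {.X 0 ^ n + .X 1 ^ n - .C c * .X 2, .X 2 + .X 3 ^ n - .C d}

/-- The coordinates on `fermat n c`. -/
def fermatCoord (i : Fin 2) : Gl (fermat n c) :=
  affCoord (fermatIdeal n c) (![0, 1] i)

theorem isAffineFT_fermat : IsAffineFT (fermat n c) := isAffineFT_specOver (FermatRing n c)

theorem fermat_mul (i : Fin 2) : affCoord (fermatIdeal n c) (![0, 1] i) *
    affCoord (fermatIdeal n c) (![2, 3] i) = 1 :=
  affCoord_mul (Ideal.subset_span (by revert i; rw [Fin.forall_fin_two]; simp))

/-- The variables 2 and 3 are the inverses of the variables 0 and 1, so a morphism to this scheme is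
a pair of units that satisfies the equation. -/
theorem torusRep_specOver_fermatRing : TorusRep (specOver k (FermatRing n c))
    (fun i : Fin 2 => affCoord (fermatIdeal n c) (![0, 1] i)) (eqF n c) := by
  constructor
  · exact fun i => .of_mul_eq_one _ (fermat_mul n c i)
  · rintro _ rfl
    have := affCoord_eqn (fermatIdeal n c) (.X 0 ^ n + .X 1 ^ n - .C c)
      (Ideal.subset_span (by simp))
    simpa using this
  · intro T v hv hE
    choose w hw using fun i => (hv i).exists_right_inv
    obtain ⟨f, hf⟩ := exists_affCoord_lift {.X 0 * .X 2 - 1, .X 1 * .X 3 - 1,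
      .X 0 ^ n + .X 1 ^ n - .C c} ![v 0, v 1, w 0, w 1] <| by
        rintro _ (rfl | rfl | rfl)
        · simp [hw]
        · simp [hw]
        · simpa [eqF] using hE _ rfl
    refine ⟨f, ?_⟩
    rw [Fin.forall_fin_two]
    exact ⟨hf 0, hf 1⟩
  · intro T f g h
    have key (i : Fin 2) : pb f (affCoord (fermatIdeal n c) (![2, 3] i)) =
        pb g (affCoord (fermatIdeal n c) (![2, 3] i)) := by
      have hf : pb f (affCoord (fermatIdeal n c) (![0, 1] i)) *
          pb f (affCoord (fermatIdeal n c) (![2, 3] i)) = 1 := by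
        rw [← map_mul, fermat_mul, map_one]
      have hg : pb g (affCoord (fermatIdeal n c) (![0, 1] i)) *
          pb g (affCoord (fermatIdeal n c) (![2, 3] i)) = 1 := by
        rw [← map_mul, fermat_mul, map_one]
      rw [← h i] at hg
      exact eq_of_mul_eq_one hf hg
    refine affCoord_ext fun i => ?_
    fin_cases i
    exacts [h 0, h 1, key 0, key 1]

theorem torusRep_fermat : TorusRep (fermat n c) (fermatCoord n c) (eqF n c) :=
  torusRep_specOver_fermatRing n c

theorem pb_fermatScale (s t : rootsOfUnity n k) (i : Fin 2) :
    pb (fermatScale c s t) (fermatCoord n c i) =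
      cst _ ((![s.1, t.1] i : kˣ) : k) * fermatCoord n c i := by
  have key (a : FermatRing n c) : pb (fermatScale c s t) (gen k (FermatRing n c) a) =
      gen k (FermatRing n c) (FermatRing.scale c s t a) := by
    have := Scheme.ΓSpecIso_inv_naturality (CommRingCat.ofHom (FermatRing.scale c s t).toRingHom)
    exact congr($this.symm a)
  have hC (a : k) : gen k (FermatRing n c) (Ideal.Quotient.mk _ (.C a)) = cst _ a :=
    gen_algebraMap a
  have h2 (p : MvPolynomial (Fin 4) k) : FermatRing.scale c s t (Ideal.Quotient.mk _ p) =
    Ideal.Quotient.mk _ (scalePoly s.1 t.1 p) := rfl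
  revert i
  rw [Fin.forall_fin_two]
  constructor
  · refine (key _).trans ?_
    change gen k _ (FermatRing.scale c s t (Ideal.Quotient.mk _ (.X 0))) = _
    rw [h2]
    rw [show scalePoly s.1 t.1 (.X 0) = .C (s.1 : k) * .X 0 from MvPolynomial.aeval_X _ _,
      map_mul, map_mul, hC]
    rfl
  · refine (key _).trans ?_
    change gen k _ (FermatRing.scale c s t (Ideal.Quotient.mk _ (.X 1))) = _
    rw [h2]
    rw [show scalePoly s.1 t.1 (.X 1) = .C (t.1 : k) * .X 1 from MvPolynomial.aeval_X _ _,
      map_mul, map_mul, hC]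
    rfl

end fermat

/-! ### Reducedness of some subschemes of tori -/

section reduced

variable {k : Type u} [Field k]

theorem exists_isNonvanishing {T : Sch k} (f : Gl T) :
    ∃ (D : Sch k) (j : D ⟶ T), IsNonvanishing j f := by
  let U := T.left.basicOpen f
  let V : Sch k := Over.mk (U.ι ≫ T.hom)
  let ι : V ⟶ T := Over.homMk U.ι rfl
  have hι : IsUnit (pb ι f) := by
    have h1 := T.left.toRingedSpace.isUnit_res_basicOpen f
    have hle : U.ι ''ᵁ ⊤ ≤ U := by simp
    have h2 := h1.map (T.left.presheaf.map (homOfLE hle).op).hom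
    change IsUnit (U.ι.appTop f)
    rw [Scheme.Opens.ι_appTop]
    convert! h2 using 1
    have h3 := T.left.presheaf.map_comp (homOfLE (T.left.basicOpen_le f)).op (homOfLE hle).op
    exact congr($h3 f)
  refine ⟨V, ι, hι, fun Z g hg => ?_, fun Z l l' h => ?_⟩
  · have hpre : g.left ⁻¹ᵁ U = ⊤ := by
      rw [Scheme.preimage_basicOpen]
      exact Scheme.basicOpen_of_isUnit _ hg
    let m₀ := IsOpenImmersion.lift U.ι g.left <| by
      rw [Scheme.Opens.range_ι]
      rintro _ ⟨x, rfl⟩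
      exact hpre.ge trivial
    have hm₀ : m₀ ≫ U.ι = g.left := IsOpenImmersion.lift_fac _ _ _
    refine ⟨Over.homMk m₀ ?_, ?_⟩
    · change m₀ ≫ U.ι ≫ T.hom = _
      rw [reassoc_of% hm₀, Over.w]
    · ext1
      exact hm₀
  · ext1
    rw [← cancel_mono U.ι]
    exact congr(($h).left)

theorem IsNonvanishing.isReduced {D T : Sch k} {j : D ⟶ T} {f : Gl T} (h : IsNonvanishing j f)
    (hT : IsReduced T.left) : IsReduced D.left := by
  obtain ⟨_, -⟩ := h.spec
  exact isReduced_of_isOpenImmersion j.left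

/-- The scheme `K` represents the invertible `n`-th roots `y` of the function `w`. -/
structure IsUnitRoot (n : ℕ) {K X : Sch k} (p : K ⟶ X) (y : Gl K) (w : Gl X) : Prop where
  unit : IsUnit y
  pow : y ^ n = pb p w
  lift : ∀ (T : Sch k) (f : T ⟶ X) (v : Gl T), IsUnit v → v ^ n = pb f w →
    ∃ g : T ⟶ K, g ≫ p = f ∧ pb g y = v
  ext : ∀ (T : Sch k) (g g' : T ⟶ K), g ≫ p = g' ≫ p → pb g y = pb g' y → g = g'

/-- An invertible root exists only over the locus where `w` is invertible, and over that open locus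
`K` is a Kummer cover of a unit. -/
theorem IsUnitRoot.isReduced [IsAlgClosed k] [CharZero k] {n : ℕ} [NeZero n] {K X : Sch k}
    {p : K ⟶ X} {y : Gl K} {w : Gl X} (h : IsUnitRoot n p y w) (hX : IsReduced X.left) :
    IsReduced K.left := by
  obtain ⟨D, j, hj⟩ := exists_isNonvanishing w
  obtain ⟨q, hq⟩ := hj.lift _ p (by rw [← h.pow]; exact h.unit.pow n)
  have hK : IsKummer n q y (pb j w) := by
    refine ⟨by rw [h.pow, ← hq, pb_comp], fun T f v hv => ?_, fun T g g' h1 h2 => ?_⟩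
    · rw [← pb_comp] at hv
      have hvu : IsUnit v := by
        rw [← isUnit_pow_iff (NeZero.ne n), hv, pb_comp]
        exact hj.unit.map _
      obtain ⟨g, h1, h2⟩ := h.lift T (f ≫ j) v hvu hv
      exact ⟨g, hj.ext _ _ _ (by rw [Category.assoc, hq, h1]), h2⟩
    · exact h.ext _ _ _ (by rw [← hq, reassoc_of% h1]) h2
  exact hK.isReduced hj.unit (hj.isReduced hX)

theorem isReduced_specOver {A : Type u} [CommRing A] [Algebra k A] [_root_.IsReduced A] :
    IsReduced (specOver k A).left := by
  change IsReduced (Spec (.of A))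
  infer_instance

theorem exists_toAffineSpace {σ : Type} {T : Sch k} (v : σ → Gl T) :
    ∃ f : T ⟶ specOver k (MvPolynomial σ k), ∀ i, pb f (gen k _ (.X i)) = v i := by
  obtain ⟨f, hf⟩ := exists_toSpecOver (A := MvPolynomial σ k)
    (MvPolynomial.eval₂Hom (cst T) v) fun a => by
      change MvPolynomial.eval₂Hom (cst T) v (.C a) = _
      simp
  exact ⟨f, fun i => by rw [hf]; simp⟩

theorem affineSpace_ext {σ : Type} {T : Sch k} {f g : T ⟶ specOver k (MvPolynomial σ k)}
    (h : ∀ i, pb f (gen k _ (.X i)) = pb g (gen k _ (.X i))) : f = g := by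
  refine specOver_hom_ext fun a => ?_
  suffices (pb f).comp (gen k _) = (pb g).comp (gen k _) from congr($this a)
  refine MvPolynomial.ringHom_ext (fun c => ?_) h
  have : gen k (MvPolynomial σ k) (.C c) = cst _ c := gen_algebraMap c
  simp [this]

namespace TorusRep

/-- The full torus is the locus in affine space where the product of the coordinates is invertible.
-/
theorem isReduced_of_empty {σ : Type} [Fintype σ] {X : Sch k} {u : σ → Gl X}
    (h : TorusRep X u ∅) : IsReduced X.left := by
  obtain ⟨j, hj⟩ := exists_toAffineSpace u
  have hN : IsNonvanishing j (∏ i, gen k _ (MvPolynomial.X i)) := by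
    refine ⟨?_, fun Z g hg => ?_, fun Z l l' hl => ?_⟩
    · rw [map_prod]
      exact IsUnit.prod_univ_iff.2 fun i => by rw [hj]; exact h.unit i
    · rw [map_prod, IsUnit.prod_univ_iff] at hg
      obtain ⟨l, hl⟩ := h.lift Z _ hg (by simp)
      exact ⟨l, affineSpace_ext fun i => by rw [pb_comp, hj, hl]⟩
    · refine h.ext _ _ _ fun i => ?_
      rw [← hj, ← pb_comp, ← pb_comp, hl]
  exact hN.isReduced isReduced_specOver

variable [IsAlgClosed k] [CharZero k] {n : ℕ} [NeZero n] {m : ℕ} {X Y : Sch k}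
  {u : Fin (m + 1) → Gl X} {E : Set (MvPolynomial (Fin (m + 1)) k)} {v : Fin m → Gl Y}
  {E' : Set (MvPolynomial (Fin m) k)}

/-- If the equations present the `i`-th coordinate as an invertible `n`-th root of a polynomial in
the others, reducedness follows from that of the scheme of the remaining coordinates. Stating `H`
for all rings turns it into an equality of functors of points. -/
theorem isReduced_of_root (hX : TorusRep X u E) (hY : TorusRep Y v E')
    (hr : IsReduced Y.left) (i : Fin (m + 1)) (f : MvPolynomial (Fin m) k)
    (H : ∀ (R : Type u) [CommRing R] (φ : k →+* R) (a : Fin (m + 1) → R),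
      (∀ p ∈ E, p.eval₂ φ a = 0) ↔ (∀ p ∈ E', p.eval₂ φ (fun j => a (i.succAbove j)) = 0) ∧
        a i ^ n = f.eval₂ φ fun j => a (i.succAbove j)) : IsReduced X.left := by
  obtain ⟨h1, h2⟩ := (H _ (cst X) u).1 hX.eqn
  obtain ⟨p, hp⟩ := hY.lift X (fun j => u (i.succAbove j)) (fun j => hX.unit _) h1
  have h : IsUnitRoot n p (u i) (f.eval₂ (cst Y) v) := by
    refine ⟨hX.unit i, ?_, fun T g w hw hg => ?_, fun T g g' h3 h4 => hX.ext _ _ _ fun l => ?_⟩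
    · rw [h2, pb_eval₂]
      simp only [hp]
    · have h3 : ∀ l, IsUnit (i.insertNth (α := fun _ => Gl T) w (fun j => pb g (v j)) l) := by
        rw [Fin.forall_iff_succAbove i]
        simp only [Fin.insertNth_apply_succAbove, Fin.insertNth_apply_same]
        exact ⟨hw, fun j => (hY.unit j).map _⟩
      have h4 := (H _ (cst T) (i.insertNth (α := fun _ => Gl T) w fun j => pb g (v j))).2 <| by
        simp only [Fin.insertNth_apply_succAbove, Fin.insertNth_apply_same]
        refine ⟨fun p hp => ?_, ?_⟩
        · rw [← pb_eval₂, hY.eqn p hp, map_zero]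
        · rw [hg, pb_eval₂]
      obtain ⟨l, hl⟩ := hX.lift T _ h3 h4
      refine ⟨l, hY.ext _ _ _ fun j => ?_, ?_⟩
      · rw [pb_comp, hp, hl, Fin.insertNth_apply_succAbove]
      · rw [hl, Fin.insertNth_apply_same]
    · obtain rfl | ⟨j, rfl⟩ := Fin.eq_self_or_eq_succAbove i l
      · exact h4
      · rw [← hp, ← pb_comp, ← pb_comp, h3]
  exact h.isReduced hr

end TorusRep

/-! ### The systems of equations evaluated in a ring -/

section eqs

variable (n : ℕ) (c d : k) {R : Type u} [CommRing R] (φ : k →+* R)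

theorem eqF_iff (a : Fin 2 → R) :
    (∀ p ∈ eqF n c, p.eval₂ φ a = 0) ↔ a 0 ^ n + a 1 ^ n = φ c := by
  simp [eqF, sub_eq_zero]

theorem eqM_iff (a : Fin 1 → R) : (∀ p ∈ eqM n c, p.eval₂ φ a = 0) ↔ a 0 ^ n = φ c := by
  simp [eqM, sub_eq_zero]

theorem eqB_iff (a : Fin 2 → R) :
    (∀ p ∈ eqB n c, p.eval₂ φ a = 0) ↔ a 0 + a 1 ^ n = φ c := by
  simp [eqB, sub_eq_zero]

theorem eqT_iff (a : Fin 3 → R) :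
    (∀ p ∈ eqT n c, p.eval₂ φ a = 0) ↔ a 0 ^ n + a 1 ^ n + a 2 ^ n = φ c := by
  simp [eqT, sub_eq_zero]

theorem eqE_iff (a : Fin 3 → R) :
    (∀ p ∈ eqE n c, p.eval₂ φ a = 0) ↔ a 0 ^ n + a 1 ^ n = 0 ∧ a 2 ^ n = φ c := by
  simp [eqE, sub_eq_zero]

theorem eqG_iff (a : Fin 3 → R) :
    (∀ p ∈ eqG k n, p.eval₂ φ a = 0) ↔ a 0 ^ n + a 1 ^ n = 0 := by
  simp [eqG]

theorem eqD_iff (a : Fin 4 → R) :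
    (∀ p ∈ eqD n c d, p.eval₂ φ a = 0) ↔
      a 0 ^ n + a 1 ^ n = φ c * a 2 ∧ a 2 + a 3 ^ n = φ d := by
  simp [eqD, sub_eq_zero]

end eqs

namespace TorusRep

variable [IsAlgClosed k] [CharZero k] {n : ℕ} [NeZero n] {X : Sch k}

theorem isReduced_eqF {u : Fin 2 → Gl X} {c : k} (h : TorusRep X u (eqF n c)) :
    IsReduced X.left := by
  have h' := torusRep_torus (k := k) (σ := Fin 1) ∅
  refine h.isReduced_of_root (n := n) h' h'.isReduced_of_empty 0 (.C c - .X 0 ^ n)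
    fun R _ φ a => ?_
  rw [eqF_iff]
  simp [eq_sub_iff_add_eq]

theorem isReduced_eqM {u : Fin 1 → Gl X} {c : k} (h : TorusRep X u (eqM n c)) :
    IsReduced X.left := by
  have h' := torusRep_torus (k := k) (σ := Fin 0) ∅
  refine h.isReduced_of_root (n := n) h' h'.isReduced_of_empty 0 (.C c) fun R _ φ a => ?_
  rw [eqM_iff]
  simp

theorem isReduced_eqT {u : Fin 3 → Gl X} {c : k} (h : TorusRep X u (eqT n c)) :
    IsReduced X.left := by
  have h' := torusRep_torus (k := k) (σ := Fin 2) ∅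
  refine h.isReduced_of_root (n := n) h' h'.isReduced_of_empty 0 (.C c - .X 0 ^ n - .X 1 ^ n)
    fun R _ φ a => ?_
  rw [eqT_iff]
  simp [eq_sub_iff_add_eq, add_assoc, add_comm (a 1 ^ n)]

theorem isReduced_eqG {u : Fin 3 → Gl X} (h : TorusRep X u (eqG k n)) :
    IsReduced X.left := by
  have h' := torusRep_torus (k := k) (σ := Fin 2) ∅
  refine h.isReduced_of_root (n := n) h' h'.isReduced_of_empty 0 (- .X 0 ^ n)
    fun R _ φ a => ?_
  rw [eqG_iff]
  simp [eq_neg_iff_add_eq_zero]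

theorem isReduced_eqE {u : Fin 3 → Gl X} {c : k} (h : TorusRep X u (eqE n c)) :
    IsReduced X.left := by
  have h' := torusRep_torus (k := k) (eqF n 0)
  refine h.isReduced_of_root (n := n) h' h'.isReduced_eqF 2 (.C c) fun R _ φ a => ?_
  rw [eqE_iff, eqF_iff, map_zero]
  simp [Fin.succAbove]

omit [NeZero n] in
theorem isReduced_eqB {u : Fin 2 → Gl X} {c : k} (h : TorusRep X u (eqB n c)) :
    IsReduced X.left := by
  have h' := torusRep_torus (k := k) (σ := Fin 1) ∅
  -- The coordinate `w` is determined by `y`, so it is adjoined as a first root.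
  refine h.isReduced_of_root (n := 1) h' h'.isReduced_of_empty 0 (.C c - .X 0 ^ n)
    fun R _ φ a => ?_
  rw [eqB_iff]
  simp [eq_sub_iff_add_eq]

theorem isReduced_eqD {u : Fin 4 → Gl X} {c d : k} (h : TorusRep X u (eqD n c d)) :
    IsReduced X.left := by
  have h₂ := torusRep_torus (k := k) (σ := Fin 2) ∅
  -- Intermediate scheme with coordinates `y, w, v`: first `w` is adjoined to the torus of `y, v` as
  -- a first root of `d - vⁿ`, then `x` as an `n`-th root of `c w - yⁿ`.
  let E : Set (MvPolynomial (Fin 3) k) := {.X 1 + .X 2 ^ n - .C d}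
  have hE (R : Type u) [CommRing R] (φ : k →+* R) (a : Fin 3 → R) :
      (∀ p ∈ E, p.eval₂ φ a = 0) ↔ a 1 + a 2 ^ n = φ d := by
    rw [← sub_eq_zero]
    simp only [E, Set.mem_singleton_iff, forall_eq]
    simp
  have h₁ := torusRep_torus E
  have hr := h₁.isReduced_of_root (n := 1) h₂ h₂.isReduced_of_empty 1 (.C d - .X 1 ^ n)
    fun R _ φ a => by
      rw [hE]
      simp [Fin.succAbove, eq_sub_iff_add_eq]
  refine h.isReduced_of_root (n := n) h₁ hr 0 (.C c * .X 1 - .X 0 ^ n) fun R _ φ a => ?_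
  rw [eqD_iff, hE, and_comm]
  simp [eq_sub_iff_add_eq, Fin.succAbove]

end TorusRep

end reduced

/-! ### Subvarieties of tori with an action through roots of unity -/

section torusVar

variable {k : Type u} [Field k]

/-- The group `μ_n × μ_n`. -/
abbrev RootPair (n : ℕ) (k : Type u) [Field k] := rootsOfUnity n k × rootsOfUnity n k

/-- The group `(μ_n × μ_n) × μ_n`. -/
abbrev RootTriple (n : ℕ) (k : Type u) [Field k] := RootPair n k × rootsOfUnity n k

/-- The diagonal action given by a family of morphisms to the group of roots of unity. -/
def rootDiag {n : ℕ} {σ Δ : Type*} [Group Δ] (f : σ → (Δ →* rootsOfUnity n k)) :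
    Δ →* (σ → kˣ) :=
  MonoidHom.pi fun i => (rootsOfUnity n k).subtype.comp (f i)

@[simp]
theorem rootDiag_apply {n : ℕ} {σ Δ : Type*} [Group Δ] (f : σ → (Δ →* rootsOfUnity n k)) (δ : Δ)
    (i : σ) : rootDiag f δ i = (f i δ : kˣ) := rfl

theorem root_smul_pow {n : ℕ} {R : Type*} [CommRing R] (φ : k →+* R) (s : rootsOfUnity n k)
    (a : R) : (φ ((s : kˣ) : k) * a) ^ n = a ^ n := by
  rw [mul_pow, ← map_pow, root_pow, map_one, one_mul]

/-- The functions `u` exhibit `A` as the subscheme of a torus that is defined by the equations `E`,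
with the diagonal action through the characters `χ`. -/
structure TorusAct {σ : Type} {Δ : Type*} [Group Δ] (A : EqVar (𝟙_ (Sch k)) Δ) (u : σ → Gl A.X)
    (E : Set (MvPolynomial σ k)) (χ : σ → Δ → k) : Prop where
  rep : TorusRep A.X u E
  act : ∀ δ i, pb (A.act δ) (u i) = cst A.X (χ i δ) * u i

theorem TorusAct.isHom {σ : Type} {Δ : Type*} [Group Δ] {A B : EqVar (𝟙_ (Sch k)) Δ}
    {u : σ → Gl B.X} {E : Set (MvPolynomial σ k)} {χ : σ → Δ → k} (h : TorusAct B u E χ)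
    (f : A.X ⟶ B.X)
    (hf : ∀ δ i, pb (A.act δ) (pb f (u i)) = cst A.X (χ i δ) * pb f (u i)) : A.IsHom B f := by
  refine ⟨toUnit_unique _ _, fun δ => h.rep.ext _ _ _ fun i => ?_⟩
  rw [pb_comp, hf, pb_comp, h.act, map_mul, pb_cst]

/-- The subvariety of the torus defined by `E`, with a diagonal action through roots of unity. -/
def torusVar {σ : Type} [Finite σ] {Δ : Type*} [Group Δ] (E : Set (MvPolynomial σ k))
    (hr : IsReduced (torus E).left) {n : ℕ} (f : σ → (Δ →* rootsOfUnity n k))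
    (hχ : ∀ (δ : Δ) (R : Type u) [CommRing R] (φ : k →+* R) (a : σ → R),
      (∀ p ∈ E, p.eval₂ φ a = 0) → ∀ p ∈ E, p.eval₂ φ (fun i => φ (f i δ : kˣ) * a i) = 0) :
    EqVar (𝟙_ (Sch k)) Δ :=
  (torusRep_torus E).eqVar ((isAffineFT_torus E).isVariety hr) (isAffineFT_torus E).affine
    (rootDiag f) fun δ => hχ δ _ _ _ (torusRep_torus E).eqn

theorem torusAct_torusVar {σ : Type} [Finite σ] {Δ : Type*} [Group Δ] (E : Set (MvPolynomial σ k))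
    (hr : IsReduced (torus E).left) {n : ℕ} (f : σ → (Δ →* rootsOfUnity n k)) (hχ) :
    TorusAct (torusVar E hr f hχ) (torusCoord E) E fun i δ => ((f i δ : kˣ) : k) :=
  ⟨torusRep_torus E, fun _ _ => TorusRep.pb_act ..⟩

variable [IsAlgClosed k] [CharZero k] (n : ℕ) [NeZero n] (c d : k)

theorem isReduced_fermat : IsReduced (fermat n c).left := (torusRep_fermat n c).isReduced_eqF

theorem isVariety_fermat : IsVariety (fermat n c) :=
  (isAffineFT_fermat n c).isVariety (isReduced_fermat n c)

/-- The curve `xⁿ + yⁿ = c` in the torus with the action `(x, y) ↦ (s x, t y)`. -/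
def fermatVar : EqVar (𝟙_ (Sch k)) (RootPair n k) :=
  (torusRep_fermat n c).eqVar (isVariety_fermat n c) (isAffineFT_fermat n c).affine
    (rootDiag ![MonoidHom.fst _ _, MonoidHom.snd _ _]) fun δ => by
      have := (torusRep_fermat n c).eqn
      rw [eqF_iff] at this ⊢
      simp only [rootDiag_apply, root_smul_pow, this]

theorem torusAct_fermatVar : TorusAct (fermatVar n c) (fermatCoord n c) (eqF n c)
    fun i δ => ((![MonoidHom.fst _ _, MonoidHom.snd _ _] i δ : rootsOfUnity n k) : kˣ) :=
  ⟨torusRep_fermat n c, fun _ _ => TorusRep.pb_act ..⟩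

theorem fermatVar_act (s t : rootsOfUnity n k) :
    (fermatVar n c).act (s, t) = fermatScale c s t := by
  refine (torusRep_fermat n c).ext _ _ _ fun i => ?_
  refine ((torusAct_fermatVar n c).act (s, t) i).trans (.trans ?_ (pb_fermatScale n c s t i).symm)
  revert i
  rw [Fin.forall_fin_two]
  exact ⟨rfl, rfl⟩

variable (k) in
/-- The multiplicative group with the action of `μ_n` by multiplication. -/
def gmVar : EqVar (𝟙_ (Sch k)) (rootsOfUnity n k) :=
  torusVar (σ := Fin 1) ∅ (torusRep_torus ∅).isReduced_of_empty (fun _ => MonoidHom.id _) (by simp)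

omit [IsAlgClosed k] [CharZero k] [NeZero n] in
theorem torusAct_gmVar : TorusAct (gmVar k n) (torusCoord ∅) ∅
    fun _ δ => ((δ : kˣ) : k) := torusAct_torusVar ..

/-- The variety `yⁿ = c` in the torus with the action `y ↦ t y`. -/
def rootVar : EqVar (𝟙_ (Sch k)) (rootsOfUnity n k) :=
  torusVar (eqM n c) (torusRep_torus _).isReduced_eqM (fun _ => MonoidHom.id _)
    fun δ R _ φ a h => by
      rw [eqM_iff] at h ⊢
      rwa [root_smul_pow]

theorem torusAct_rootVar : TorusAct (rootVar n c) (torusCoord (eqM n c)) (eqM n c)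
    fun _ δ => ((δ : kˣ) : k) := torusAct_torusVar ..

/-- The variety `w + yⁿ = c` in the torus with the action `(w, y) ↦ (w, t y)`. -/
def fermatQuot : EqVar (𝟙_ (Sch k)) (rootsOfUnity n k) :=
  torusVar (eqB n c) (torusRep_torus _).isReduced_eqB ![1, MonoidHom.id _]
    fun δ R _ φ a h => by
      rw [eqB_iff] at h ⊢
      rw [root_smul_pow]
      simpa using h

omit [NeZero n] in
theorem torusAct_fermatQuot : TorusAct (fermatQuot n c) (torusCoord (eqB n c)) (eqB n c)
    fun i δ => ((![1, MonoidHom.id _] i δ : rootsOfUnity n k) : kˣ) := torusAct_torusVar ..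

variable (k) in
/-- The coordinate characters of `(μ_n × μ_n) × μ_n`. -/
def tripleChar : Fin 3 → (RootTriple n k →* rootsOfUnity n k) :=
  ![(MonoidHom.fst _ _).comp (MonoidHom.fst _ _), (MonoidHom.snd _ _).comp (MonoidHom.fst _ _),
    MonoidHom.snd _ _]

/-- The surface `xⁿ + yⁿ + vⁿ = c` in the torus with the diagonal action of `μ_n³`. -/
def fermatSurface : EqVar (𝟙_ (Sch k)) (RootTriple n k) :=
  torusVar (eqT n c) (torusRep_torus _).isReduced_eqT (tripleChar k n)
    fun δ R _ φ a h => by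
      rw [eqT_iff] at h ⊢
      simpa only [root_smul_pow] using h

theorem torusAct_fermatSurface : TorusAct (fermatSurface n c) (torusCoord (eqT n c)) (eqT n c)
    fun i δ => ((tripleChar k n i δ : kˣ) : k) := torusAct_torusVar ..

/-- The curve `xⁿ + yⁿ = 0`, `vⁿ = c` in the torus with the diagonal action of `μ_n³`. -/
def fermatZeroRoot : EqVar (𝟙_ (Sch k)) (RootTriple n k) :=
  torusVar (eqE n c) (torusRep_torus _).isReduced_eqE (tripleChar k n)
    fun δ R _ φ a h => by
      rw [eqE_iff] at h ⊢
      simpa only [root_smul_pow] using h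

theorem torusAct_fermatZeroRoot : TorusAct (fermatZeroRoot n c) (torusCoord (eqE n c)) (eqE n c)
    fun i δ => ((tripleChar k n i δ : kˣ) : k) := torusAct_torusVar ..

variable (k) in
/-- The surface `xⁿ + yⁿ = 0` in the three-dimensional torus with the diagonal action of `μ_n³`. -/
def fermatZeroGm : EqVar (𝟙_ (Sch k)) (RootTriple n k) :=
  torusVar (eqG k n) (torusRep_torus _).isReduced_eqG (tripleChar k n)
    fun δ R _ φ a h => by
      rw [eqG_iff] at h ⊢
      simpa only [root_smul_pow] using h

theorem torusAct_fermatZeroGm : TorusAct (fermatZeroGm k n) (torusCoord (eqG k n)) (eqG k n)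
    fun i δ => ((tripleChar k n i δ : kˣ) : k) := torusAct_torusVar ..

/-- The surface `xⁿ + yⁿ = c w`, `w + vⁿ = d` in the torus with the action of `μ_n³` on `x, y, v`.
-/
def fermatComp : EqVar (𝟙_ (Sch k)) (RootTriple n k) :=
  torusVar (eqD n c d) (torusRep_torus _).isReduced_eqD
    ![tripleChar k n 0, tripleChar k n 1, 1, tripleChar k n 2]
    fun δ R _ φ a h => by
      rw [eqD_iff] at h ⊢
      simpa [root_smul_pow] using h

theorem torusAct_fermatComp :
    TorusAct (fermatComp n c d) (torusCoord (eqD n c d)) (eqD n c d) fun i δ =>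
      ((![tripleChar k n 0, tripleChar k n 1, 1, tripleChar k n 2] i δ : rootsOfUnity n k) : kˣ) :=
  torusAct_torusVar ..

/-! ### Decompositions -/

section scissor

variable {σ ρ : Type} {Δ : Type*} [Group Δ] {X Y U : EqVar (𝟙_ (Sch k)) Δ}
  {a : σ → Gl X.X} {b : σ → Gl Y.X} {e : ρ → Gl U.X} {A B : Set (MvPolynomial σ k)}
  {C : Set (MvPolynomial ρ k)} {χ : σ → Δ → k} {χ' : ρ → Δ → k}

omit [IsAlgClosed k] [CharZero k] in
/-- The decomposition of a subscheme of a torus by the vanishing of a function `f`. -/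
theorem TorusAct.isScissor (hX : TorusAct X a A χ) (hY : TorusAct Y b B χ)
    (hU : TorusAct U e C χ') (f : MvPolynomial σ k) (s : σ → ρ) (g : ρ → MvPolynomial σ k)
    (hs : ∀ i, χ' (s i) = χ i)
    (hB : ∀ (R : Type u) [CommRing R] (φ : k →+* R) (x : σ → R),
      (∀ p ∈ B, p.eval₂ φ x = 0) ↔ (∀ p ∈ A, p.eval₂ φ x = 0) ∧ f.eval₂ φ x = 0)
    (hC : ∀ (R : Type u) [CommRing R] (φ : k →+* R) (x : ρ → R), (∀ i, IsUnit (x i)) →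
      (∀ p ∈ C, p.eval₂ φ x = 0) → (∀ p ∈ A, p.eval₂ φ (fun i => x (s i)) = 0) ∧
        IsUnit (f.eval₂ φ fun i => x (s i)) ∧ ∀ l, x l = (g l).eval₂ φ fun i => x (s i))
    (hC' : ∀ (R : Type u) [CommRing R] (φ : k →+* R) (x : σ → R), (∀ i, IsUnit (x i)) →
      (∀ p ∈ A, p.eval₂ φ x = 0) → IsUnit (f.eval₂ φ x) →
        (∀ l, IsUnit ((g l).eval₂ φ x)) ∧ (∀ p ∈ C, p.eval₂ φ (fun l => (g l).eval₂ φ x) = 0) ∧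
          ∀ i, (g (s i)).eval₂ φ x = x i) : X.IsScissor Y U := by
  -- `Y` is the locus where `f` vanishes and `U` the locus where it is invertible. The map `s`
  -- selects the coordinates of `X` among those of `U`, and `g` expresses every coordinate of `U`
  -- through them.
  obtain ⟨h1, h2⟩ := (hB _ (cst Y.X) b).1 hY.rep.eqn
  obtain ⟨h3, h4, h5⟩ := hC _ (cst U.X) e hU.rep.unit hU.rep.eqn
  obtain ⟨i, hi⟩ := hX.rep.lift _ b hY.rep.unit h1
  obtain ⟨j, hj⟩ := hX.rep.lift _ (fun i => e (s i)) (fun _ => hU.rep.unit _) h3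
  refine isScissor_of_locus (f := f.eval₂ (cst X.X) a) (i := i) (j := j)
    (hX.isHom i fun δ l => ?_) (hX.isHom j fun δ l => ?_) ?_ ?_
  · rw [hi, hY.act]
  · rw [hj, hU.act, hs]
  · refine ⟨?_, fun Z l hl => ?_, fun Z l l' h => hY.rep.ext _ _ _ fun m => ?_⟩
    · rw [pb_eval₂]
      simpa only [hi] using h2
    · rw [pb_eval₂] at hl
      obtain ⟨m, hm⟩ := hY.rep.lift Z (fun i => pb l (a i)) (fun i => (hX.rep.unit i).map _) <| by
        refine (hB _ _ _).2 ⟨fun p hp => ?_, hl⟩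
        rw [← pb_eval₂, hX.rep.eqn p hp, map_zero]
      exact ⟨m, hX.rep.ext _ _ _ fun i => by rw [pb_comp, hi, hm]⟩
    · rw [← hi, ← pb_comp, h, pb_comp]
  · refine ⟨?_, fun Z l hl => ?_, fun Z l l' h => hU.rep.ext _ _ _ fun m => ?_⟩
    · rw [pb_eval₂]
      simpa only [hj] using h4
    · rw [pb_eval₂] at hl
      obtain ⟨h6, h7, h8⟩ := hC' _ (cst Z) (fun i => pb l (a i))
        (fun i => (hX.rep.unit i).map _)
        (fun p hp => by rw [← pb_eval₂, hX.rep.eqn p hp, map_zero]) hl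
      obtain ⟨m, hm⟩ := hU.rep.lift Z _ h6 h7
      exact ⟨m, hX.rep.ext _ _ _ fun i => by rw [pb_comp, hj, hm, h8]⟩
    · rw [h5, pb_eval₂, pb_eval₂]
      simp only [← hj, ← pb_comp, h]

/-- Split by the function `c - yⁿ`: where it is invertible it serves as the coordinate `w`. The
ambient group does not depend on `c`, so it cancels in the difference that defines Ψ. -/
theorem gmVar_isScissor : (gmVar k n).IsScissor (rootVar n c) (fermatQuot n c) := by
  refine (torusAct_gmVar n).isScissor (torusAct_rootVar n c) (torusAct_fermatQuot n c)
    (.C c - .X 0 ^ n) (fun _ => 1) ![.C c - .X 0 ^ n, .X 0] (fun i => rfl)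
    (fun R _ φ x => ?_) (fun R _ φ x hx h => ?_) fun R _ φ x hx h h' => ?_
  · rw [eqM_iff]
    simp [sub_eq_zero, eq_comm (a := φ c)]
  · rw [eqB_iff, ← eq_sub_iff_add_eq] at h
    simp only [Fin.forall_fin_two]
    simpa [← h] using hx 0
  · rw [eqB_iff]
    simp only [Fin.forall_fin_two]
    simpa using ⟨by simpa using h', hx 0⟩

/-- Split by `xⁿ + yⁿ`: where it is invertible it is the coordinate `w`, and where it vanishes the
equation reduces to `vⁿ = d`. -/
theorem fermatSurface_isScissor :
    (fermatSurface n d).IsScissor (fermatZeroRoot n d) (fermatComp n 1 d) := by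
  refine (torusAct_fermatSurface n d).isScissor (torusAct_fermatZeroRoot n d)
    (torusAct_fermatComp n 1 d) (.X 0 ^ n + .X 1 ^ n) ![0, 1, 3]
    ![.X 0, .X 1, .X 0 ^ n + .X 1 ^ n, .X 2] (fun i => ?_)
    (fun R _ φ x => ?_) (fun R _ φ x hx h => ?_) fun R _ φ x hx h h' => ?_
  · fin_cases i <;> rfl
  · rw [eqE_iff, eqT_iff]
    constructor
    · rintro ⟨h1, h2⟩
      simpa [h1] using h2
    · rintro ⟨h1, h2⟩
      have h2 : x 0 ^ n + x 1 ^ n = 0 := by simpa using h2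
      rw [h2, zero_add] at h1
      exact ⟨h2, h1⟩
  · rw [eqD_iff, map_one, one_mul] at h
    rw [eqT_iff]
    refine ⟨?_, ?_, fun l => ?_⟩
    · simpa [h.1] using h.2
    · simpa [h.1] using hx 2
    · fin_cases l <;> simp [h.1]
  · have h' : IsUnit (x 0 ^ n + x 1 ^ n) := by simpa using h'
    rw [eqD_iff]
    rw [eqT_iff] at h
    refine ⟨fun l => ?_, ?_, fun i => ?_⟩
    · fin_cases l
      exacts [by simpa using hx 0, by simpa using hx 1, by simpa using h', by simpa using hx 2]
    · simpa using h
    · fin_cases i <;> simp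

/-- Split by `d - vⁿ`, which is `w` where it is invertible. The closed part is the same as for the
surface `xⁿ + yⁿ + vⁿ = d`, and the ambient variety is independent of `d`; both facts are needed for
the cancellation in `psi_addProd`. -/
theorem fermatZeroGm_isScissor :
    (fermatZeroGm k n).IsScissor (fermatZeroRoot n d) (fermatComp n 0 d) := by
  refine (torusAct_fermatZeroGm n).isScissor (torusAct_fermatZeroRoot n d)
    (torusAct_fermatComp n 0 d) (.C d - .X 2 ^ n) ![0, 1, 3]
    ![.X 0, .X 1, .C d - .X 2 ^ n, .X 2] (fun i => ?_)
    (fun R _ φ x => ?_) (fun R _ φ x hx h => ?_) fun R _ φ x hx h h' => ?_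
  · fin_cases i <;> rfl
  · rw [eqE_iff, eqG_iff]
    simp [sub_eq_zero, eq_comm (a := φ d)]
  · rw [eqD_iff, map_zero, zero_mul, ← eq_sub_iff_add_eq (a := x 2)] at h
    rw [eqG_iff]
    refine ⟨h.1, ?_, fun l => ?_⟩
    · simpa [← h.2] using hx 2
    · fin_cases l <;> simp [h.2]
  · have h' : IsUnit (φ d - x 2 ^ n) := by simpa using h'
    rw [eqD_iff]
    rw [eqG_iff] at h
    refine ⟨fun l => ?_, ?_, fun i => ?_⟩
    · fin_cases l
      exacts [by simpa using hx 0, by simpa using hx 1, by simpa using h', by simpa using hx 2]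
    · simpa using h
    · fin_cases i <;> simp

/-! ### Quotients -/

theorem IsKummer.isQuot {n : ℕ} [NeZero n] {Δ Δ' : Type*} [Group Δ] [Group Δ']
    {P : EqVar (𝟙_ (Sch k)) Δ} {Q : EqVar (𝟙_ (Sch k)) Δ'} {π : Δ →* Δ'} {p : P.X ⟶ Q.X}
    {y : Gl P.X} {w : Gl Q.X} (h : IsKummer n p y w) (hp : ∀ δ, p ≫ Q.act (π δ) = P.act δ ≫ p)
    (ι : rootsOfUnity n k → Δ) (hι : ∀ s, π (ι s) = 1) (hι' : ∀ δ, π δ = 1 → ∃ s, ι s = δ)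
    (hy : ∀ s, pb (P.act (ι s)) y = cst P.X ((s : kˣ) : k) * y) : IsQuot π P Q := by
  refine ⟨p, ?_, toUnit_unique _ _, hp⟩
  refine (h.isQuotientBy (fun s => P.act (ι s)) (fun s => ?_) hy).congr
    (fun s => ⟨⟨ι s, hι s⟩, rfl⟩) fun δ => ?_
  · rw [← hp, hι, Q.act_one, Category.comp_id]
  · obtain ⟨s, hs⟩ := hι' δ.1 δ.2
    exact ⟨s, by rw [hs]⟩

/-- The map `(x, y) ↦ (xⁿ, y)` is the Kummer cover that adjoins `x` as a root of `w`, with the first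
factor as its group. -/
theorem TorusAct.isQuot_eqB {P : EqVar (𝟙_ (Sch k)) (RootPair n k)}
    {Q : EqVar (𝟙_ (Sch k)) (rootsOfUnity n k)} {x : Fin 2 → Gl P.X} {b : Fin 2 → Gl Q.X}
    (hF : TorusAct P x (eqF n c)
      fun i δ => ((![MonoidHom.fst _ _, MonoidHom.snd _ _] i δ : rootsOfUnity n k) : kˣ))
    (hB : TorusAct Q b (eqB n c)
      fun i δ => ((![1, MonoidHom.id _] i δ : rootsOfUnity n k) : kˣ)) :
    IsQuot (MonoidHom.snd (rootsOfUnity n k) (rootsOfUnity n k)) P Q := by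
  have e1 := (eqF_iff ..).1 hF.rep.eqn
  have e2 := (eqB_iff ..).1 hB.rep.eqn
  obtain ⟨p, hp⟩ := hB.rep.lift P.X ![x 0 ^ n, x 1]
    (by rw [Fin.forall_fin_two]; exact ⟨(hF.rep.unit 0).pow n, hF.rep.unit 1⟩)
    (by rw [eqB_iff]; exact e1)
  have hp0 : pb p (b 0) = x 0 ^ n := hp 0
  have hp1 : pb p (b 1) = x 1 := hp 1
  have hK : IsKummer n p (x 0) (b 0) := by
    refine ⟨hp0.symm, fun T f v hv => ?_, fun T g g' h h' => hF.rep.ext _ _ _ ?_⟩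
    · have hvu : IsUnit v := by
        rw [← isUnit_pow_iff (NeZero.ne n), hv]
        exact (hB.rep.unit 0).map _
      obtain ⟨g, hg⟩ := hF.rep.lift T ![v, pb f (b 1)]
        (by rw [Fin.forall_fin_two]; exact ⟨hvu, (hB.rep.unit 1).map _⟩) <| by
          rw [eqF_iff]
          change v ^ n + pb f (b 1) ^ n = _
          rw [hv, ← map_pow, ← map_add, e2, pb_cst]
      have hg0 : pb g (x 0) = v := hg 0
      have hg1 : pb g (x 1) = pb f (b 1) := hg 1
      refine ⟨g, hB.rep.ext _ _ _ ?_, hg0⟩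
      rw [Fin.forall_fin_two, pb_comp, pb_comp, hp0, hp1, map_pow, hg0, hg1, hv]
      exact ⟨rfl, rfl⟩
    · rw [Fin.forall_fin_two]
      refine ⟨h', ?_⟩
      rw [← hp1, ← pb_comp, h, pb_comp]
  have hact0 (δ) : pb (P.act δ) (x 0) = cst _ ((δ.1 : kˣ) : k) * x 0 := hF.act δ 0
  have hact1 (δ) : pb (P.act δ) (x 1) = cst _ ((δ.2 : kˣ) : k) * x 1 := hF.act δ 1
  have hactb0 (δ) : pb (Q.act δ) (b 0) = b 0 :=
    (hB.act δ 0).trans (by simp)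
  have hactb1 (δ) : pb (Q.act δ) (b 1) = cst _ ((δ : kˣ) : k) * b 1 := hB.act δ 1
  refine hK.isQuot (fun δ => hB.rep.ext _ _ _ ?_) (fun s => (s, 1)) (fun s => rfl)
    (fun δ hδ => ⟨δ.1, Prod.ext rfl hδ.symm⟩) fun s => hact0 _
  rw [Fin.forall_fin_two, pb_comp, pb_comp, pb_comp, pb_comp, hactb0, hactb1, hp0, map_pow, hact0,
    root_smul_pow, map_mul, pb_cst, hp1, hact1]
  exact ⟨rfl, rfl⟩

theorem isQuot_fermatVar :
    IsQuot (MonoidHom.snd (rootsOfUnity n k) (rootsOfUnity n k)) (fermatVar n c)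
      (fermatQuot n c) :=
  (torusAct_fermatVar n c).isQuot_eqB n c (torusAct_fermatQuot n c)

/-- The morphism `((a, b), (e, f)) ↦ ((a e, b e), f)`. -/
def rootMul (n : ℕ) (k : Type u) [Field k] : RootPair n k × RootPair n k →* RootTriple n k where
  toFun x := ((x.1.1 * x.2.1, x.1.2 * x.2.1), x.2.2)
  map_one' := by simp
  map_mul' x y := by ext <;> simp <;> ring

-- The map is `((x, y), (u, v)) ↦ (x u, y u, uⁿ, v)`: multiplying the first curve by `u` turns its
-- constant `c` into `c w`. It is the Kummer cover adjoining `u` as a root of `w`, since `x` and `y`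
-- are recovered on dividing by `u`; its group consists of the elements `((s⁻¹, s⁻¹), (s, 1))`.
variable {c d} in
theorem TorusAct.isQuot_eqD {P P' : EqVar (𝟙_ (Sch k)) (RootPair n k)}
    {Q : EqVar (𝟙_ (Sch k)) (RootTriple n k)} {x : Fin 2 → Gl P.X} {u : Fin 2 → Gl P'.X}
    {b : Fin 4 → Gl Q.X}
    (hP : TorusAct P x (eqF n c)
      fun i δ => ((![MonoidHom.fst _ _, MonoidHom.snd _ _] i δ : rootsOfUnity n k) : kˣ))
    (hP' : TorusAct P' u (eqF n d)
      fun i δ => ((![MonoidHom.fst _ _, MonoidHom.snd _ _] i δ : rootsOfUnity n k) : kˣ))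
    (hQ : TorusAct Q b (eqD n c d) fun i δ =>
      ((![tripleChar k n 0, tripleChar k n 1, 1, tripleChar k n 2] i δ : rootsOfUnity n k) : kˣ)) :
    IsQuot (rootMul n k) ((P.prod P').push (λ_ (𝟙_ (Sch k))).hom) Q := by
  have e1 := (eqF_iff ..).1 hP.rep.eqn
  have e1' := (eqF_iff ..).1 hP'.rep.eqn
  have e2 := (eqD_iff ..).1 hQ.rep.eqn
  have hx i : IsUnit (pb (fst P.X P'.X) (x i)) := (hP.rep.unit i).map _
  have hu i : IsUnit (pb (snd P.X P'.X) (u i)) := (hP'.rep.unit i).map _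
  have f1 := congr(pb (fst P.X P'.X) $e1)
  have f1' := congr(pb (snd P.X P'.X) $e1')
  rw [map_add, map_pow, map_pow, pb_cst] at f1 f1'
  obtain ⟨p, hp⟩ := hQ.rep.lift (P.X ⊗ P'.X) ![pb (fst P.X P'.X) (x 0) * pb (snd P.X P'.X) (u 0),
      pb (fst P.X P'.X) (x 1) * pb (snd P.X P'.X) (u 0), pb (snd P.X P'.X) (u 0) ^ n,
      pb (snd P.X P'.X) (u 1)]
    (by
      intro i
      fin_cases i
      exacts [(hx 0).mul (hu 0), (hx 1).mul (hu 0), (hu 0).pow n, hu 1])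
    (by
      rw [eqD_iff]
      refine ⟨?_, f1'⟩
      change (_ * _) ^ n + (_ * _) ^ n = _ * _ ^ n
      rw [mul_pow, mul_pow, ← add_mul, f1])
  have hp0 : pb p (b 0) = _ := hp 0
  have hp1 : pb p (b 1) = _ := hp 1
  have hp2 : pb p (b 2) = _ := hp 2
  have hp3 : pb p (b 3) = _ := hp 3
  simp only [Matrix.cons_val] at hp0 hp1 hp2 hp3
  have hK : IsKummer n p (pb (snd P.X P'.X) (u 0)) (b 2) := by
    refine ⟨hp2.symm, fun T f v hv => ?_, fun T g g' h h' => ?_⟩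
    · have hvu : IsUnit v := by
        rw [← isUnit_pow_iff (NeZero.ne n), hv]
        exact (hQ.rep.unit 2).map _
      obtain ⟨v', hv'⟩ := hvu.exists_right_inv
      have hv'u : IsUnit v' := .of_mul_eq_one v (by rw [mul_comm, hv'])
      obtain ⟨g, hg⟩ := hP.rep.lift T ![pb f (b 0) * v', pb f (b 1) * v']
        (by
          rw [Fin.forall_fin_two]
          exact ⟨((hQ.rep.unit 0).map _).mul hv'u, ((hQ.rep.unit 1).map _).mul hv'u⟩) <| by
          rw [eqF_iff]
          change (_ * _) ^ n + (_ * _) ^ n = _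
          rw [mul_pow, mul_pow, ← add_mul, ← map_pow, ← map_pow, ← map_add, e2.1, map_mul, pb_cst,
            ← hv, mul_assoc, ← mul_pow, hv', one_pow, mul_one]
      obtain ⟨g', hg'⟩ := hP'.rep.lift T ![v, pb f (b 3)]
        (by
          rw [Fin.forall_fin_two]
          exact ⟨hvu, (hQ.rep.unit 3).map _⟩) <| by
          rw [eqF_iff]
          change v ^ n + pb f (b 3) ^ n = _
          rw [hv, ← map_pow, ← map_add, e2.2, pb_cst]
      have hg0 : pb g (x 0) = pb f (b 0) * v' := hg 0
      have hg1 : pb g (x 1) = pb f (b 1) * v' := hg 1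
      have hg0' : pb g' (u 0) = v := hg' 0
      have hg1' : pb g' (u 1) = pb f (b 3) := hg' 1
      have hv'' : v' * v = 1 := by rw [mul_comm, hv']
      refine ⟨lift g g', hQ.rep.ext _ _ _ fun i => ?_, ?_⟩
      · rw [pb_comp]
        fin_cases i
        · change pb _ (pb p (b 0)) = pb f (b 0)
          rw [hp0, map_mul, ← pb_comp, ← pb_comp, lift_fst, lift_snd, hg0, hg0', mul_assoc, hv'',
            mul_one]
        · change pb _ (pb p (b 1)) = pb f (b 1)
          rw [hp1, map_mul, ← pb_comp, ← pb_comp, lift_fst, lift_snd, hg1, hg0', mul_assoc, hv'',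
            mul_one]
        · change pb _ (pb p (b 2)) = pb f (b 2)
          rw [hp2, map_pow, ← pb_comp, lift_snd, hg0', hv]
        · change pb _ (pb p (b 3)) = pb f (b 3)
          rw [hp3, ← pb_comp, lift_snd, hg1']
      · rw [← pb_comp, lift_snd, hg0']
    · rw [← pb_comp, ← pb_comp] at h'
      have h0 := congr(pb $h (b 0))
      have h1 := congr(pb $h (b 1))
      have h3 := congr(pb $h (b 3))
      rw [pb_comp, pb_comp] at h0 h1 h3
      rw [hp0, map_mul, map_mul, ← pb_comp, ← pb_comp, ← pb_comp, ← pb_comp, h'] at h0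
      rw [hp1, map_mul, map_mul, ← pb_comp, ← pb_comp, ← pb_comp, ← pb_comp, h'] at h1
      rw [hp3, ← pb_comp, ← pb_comp] at h3
      have hc : IsUnit (pb (g' ≫ snd P.X P'.X) (u 0)) := (hP'.rep.unit 0).map _
      refine CartesianMonoidalCategory.hom_ext _ _ (hP.rep.ext _ _ _ ?_) (hP'.rep.ext _ _ _ ?_)
      · rw [Fin.forall_fin_two]
        exact ⟨hc.mul_left_injective h0, hc.mul_left_injective h1⟩
      · rw [Fin.forall_fin_two]
        exact ⟨h', h3⟩
  have hact (δ : RootPair n k × RootPair n k) (i) : pb (P.act δ.1 ⊗ₘ P'.act δ.2)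
      (pb (fst P.X P'.X) (x i)) = pb (fst P.X P'.X) (pb (P.act δ.1) (x i)) := by
    rw [← pb_comp, ← pb_comp, tensorHom_fst]
  have hact' (δ : RootPair n k × RootPair n k) (i) : pb (P.act δ.1 ⊗ₘ P'.act δ.2)
      (pb (snd P.X P'.X) (u i)) = pb (snd P.X P'.X) (pb (P'.act δ.2) (u i)) := by
    rw [← pb_comp, ← pb_comp, tensorHom_snd]
  refine hK.isQuot (P := (P.prod P').push (λ_ (𝟙_ (Sch k))).hom)
    (fun δ => hQ.rep.ext _ _ _ fun i => ?_) (fun s => ((s⁻¹, s⁻¹), (s, 1))) (fun s => ?_)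
    (fun δ hδ => ⟨δ.2.1, ?_⟩) fun s => ?_
  · rw [pb_comp, pb_comp, hQ.act, map_mul, pb_cst]
    change _ = pb (P.act δ.1 ⊗ₘ P'.act δ.2) _
    fin_cases i
    · change _ * pb p (b 0) = pb _ (pb p (b 0))
      rw [hp0, map_mul, hact, hact', hP.act, hP'.act]
      simp [rootMul, tripleChar]
      ring
    · change _ * pb p (b 1) = pb _ (pb p (b 1))
      rw [hp1, map_mul, hact, hact', hP.act, hP'.act]
      simp [rootMul, tripleChar]
      ring
    · change _ * pb p (b 2) = pb _ (pb p (b 2))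
      rw [hp2, map_pow, hact', hP'.act, map_mul, pb_cst, root_smul_pow]
      simp
    · change _ * pb p (b 3) = pb _ (pb p (b 3))
      rw [hp3, hact', hP'.act]
      simp [rootMul, tripleChar]
  · ext <;> simp [rootMul]
  · obtain ⟨⟨a, b⟩, e, f⟩ := δ
    simp only [rootMul, MonoidHom.coe_mk, OneHom.coe_mk, Prod.mk_eq_one] at hδ
    obtain ⟨⟨h1, h2⟩, rfl⟩ := hδ
    rw [eq_inv_of_mul_eq_one_left h1, eq_inv_of_mul_eq_one_left h2]
  · change pb (P.act (s⁻¹, s⁻¹) ⊗ₘ P'.act (s, 1)) _ = _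
    rw [hact' ((s⁻¹, s⁻¹), (s, 1)), hP'.act, map_mul, pb_cst]
    rfl

theorem isQuot_fermatComp : IsQuot (rootMul n k)
    (((fermatVar n c).prod (fermatVar n d)).push (λ_ (𝟙_ (Sch k))).hom) (fermatComp n c d) :=
  (torusAct_fermatVar n c).isQuot_eqD n (torusAct_fermatVar n d) (torusAct_fermatComp n c d)

theorem isQuot_rootVar_one : IsQuot (1 : rootsOfUnity n k →* Unit) (rootVar n (1 : k))
    (.triv Unit (𝟙_ (Sch k)) inferInstance (𝟙 _)) := by
  have hM := torusAct_rootVar n (1 : k)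
  have e := (eqM_iff ..).1 hM.rep.eqn
  rw [map_one] at e
  have hK : IsKummer n (toUnit (rootVar n (1 : k)).X) (torusCoord (eqM n (1 : k)) 0) 1 := by
    refine ⟨by rw [e, map_one], fun T f v hv => ?_, fun T g g' h h' => hM.rep.ext _ _ _ ?_⟩
    · rw [map_one] at hv
      obtain ⟨g, hg⟩ := hM.rep.lift T (fun _ => v)
        (fun _ => .of_pow_eq_one hv (NeZero.ne n)) (by rw [eqM_iff, hv, map_one])
      exact ⟨g, toUnit_unique _ _, hg 0⟩
    · rwa [Fin.forall_fin_one]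
  exact hK.isQuot (fun δ => toUnit_unique _ _) id (fun _ => rfl) (fun δ _ => ⟨δ, rfl⟩)
    fun s => hM.act s 0

end scissor

end torusVar

/-! ### Twisted products -/

section twist

variable {k : Type u} [Field k] {S T : Sch k}

namespace EqVar

variable {Γ Δ : Type*} [Group Γ] [Group Δ] {X Y U A B : EqVar S Γ}

theorem Iso.push (h : A.Iso B) (f : S ⟶ T) : (A.push f).Iso (B.push f) := by
  obtain ⟨e, h1, h2⟩ := h
  exact ⟨e, by simp [← h1], h2⟩

theorem Iso.res (h : A.Iso B) (φ : Δ →* Γ) : (A.res φ).Iso (B.res φ) := by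
  obtain ⟨e, h1, h2⟩ := h
  exact ⟨e, h1, fun _ => h2 _⟩

theorem IsScissor.push (h : X.IsScissor Y U) (f : S ⟶ T) :
    (X.push f).IsScissor (Y.push f) (U.push f) := by
  obtain ⟨i, j, hi, hj, h⟩ := h
  exact ⟨i, j, ⟨by simp [← hi.1], hi.2⟩, ⟨by simp [← hj.1], hj.2⟩, h⟩

theorem IsScissor.res (h : X.IsScissor Y U) (φ : Δ →* Γ) :
    (X.res φ).IsScissor (Y.res φ) (U.res φ) := by
  obtain ⟨i, j, hi, hj, h⟩ := h
  exact ⟨i, j, ⟨hi.1, fun _ => hi.2 _⟩, ⟨hj.1, fun _ => hj.2 _⟩, h⟩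

end EqVar

variable [IsAlgClosed k] {Γ Γ' Δ Δ' H H' : Type*} [Group Γ] [Group Γ'] [Group Δ] [Group Δ']
  [Group H] [Group H']

/-- The product of an `S`-variety and a `k`-variety, with the action of a group `H` that acts on
both factors. -/
abbrev tw (φ : H →* Γ × Δ) (Z : EqVar S Γ) (B : EqVar (𝟙_ (Sch k)) Δ) : EqVar S H :=
  ((Z.prod B).push (ρ_ S).hom).res φ

theorem tw_iso_left (φ : H →* Γ × Δ) {Z Z' : EqVar S Γ} (h : Z.Iso Z')
    (B : EqVar (𝟙_ (Sch k)) Δ) : (tw φ Z B).Iso (tw φ Z' B) :=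
  ((h.prod B).push _).res _

theorem tw_scissor_left (φ : H →* Γ × Δ) {X Y U : EqVar S Γ} (h : X.IsScissor Y U)
    (B : EqVar (𝟙_ (Sch k)) Δ) : (tw φ X B).IsScissor (tw φ Y B) (tw φ U B) :=
  ((h.prod B).push _).res _

theorem tw_swap_iso (φ : H →* Γ × Δ) (Z : EqVar S Γ) (B : EqVar (𝟙_ (Sch k)) Δ) :
    (tw φ Z B).Iso (((B.prod Z).push (λ_ S).hom).res
      ((MonoidHom.prod (MonoidHom.snd Γ Δ) (MonoidHom.fst Γ Δ)).comp φ)) := by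
  refine ⟨β_ Z.X B.X, ?_, fun g => ?_⟩
  · simp [leftUnitor_hom, rightUnitor_hom]
  · simp

variable [CharZero k]

/-- One factor of a twisted product may be replaced by its quotient. Hypothesis `e'` lifts the
kernel of `π` to elements of the kernel of `ρ` that do not move the other factor; `e` is
compatibility of the actions. -/
theorem isQuot_tw_left [Finite Γ] {Z : EqVar S Γ} {Z' : EqVar S Γ'} {π : Γ →* Γ'}
    (h : IsQuot π Z Z') (B : EqVar (𝟙_ (Sch k)) Δ) (φ : H →* Γ × Δ) (φ' : H' →* Γ' × Δ)
    (ρ : H →* H') (e : ∀ x, (π (φ x).1, (φ x).2) = φ' (ρ x))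
    (e' : ∀ g, π g = 1 → ∃ x, ρ x = 1 ∧ φ x = (g, 1)) : IsQuot ρ (tw φ Z B) (tw φ' Z' B) := by
  refine ((h.prod B).push _).res _ _ e ?_
  rintro ⟨g, d⟩ hg
  obtain ⟨h1, rfl⟩ := Prod.ext_iff.1 hg
  exact e' g h1

theorem isQuot_tw_right [Finite Δ] (Z : EqVar S Γ) {B : EqVar (𝟙_ (Sch k)) Δ}
    {B' : EqVar (𝟙_ (Sch k)) Δ'} {π : Δ →* Δ'} (h : IsQuot π B B') (φ : H →* Γ × Δ)
    (φ' : H' →* Γ × Δ') (ρ : H →* H') (e : ∀ x, ((φ x).1, π (φ x).2) = φ' (ρ x))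
    (e' : ∀ d, π d = 1 → ∃ x, ρ x = 1 ∧ φ x = (1, d)) : IsQuot ρ (tw φ Z B) (tw φ' Z B') := by
  refine ((h.prod_left Z).push _).res _ _ e ?_
  rintro ⟨g, d⟩ hg
  obtain ⟨rfl, h1⟩ := Prod.ext_iff.1 hg
  exact e' d h1

theorem quo_tw_scissor [Finite H] {π : H →* H'} (hπ : Function.Surjective π) (φ : H →* Γ × Δ)
    (Z : EqVar S Γ) {X Y U : EqVar (𝟙_ (Sch k)) Δ} (h : X.IsScissor Y U) :
    quo π hπ (tw φ Z X) = quo π hπ (tw φ Z U) + quo π hπ (tw φ Z Y) := by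
  simp only [quo_iso hπ (tw_swap_iso φ Z _)]
  exact quo_scissor hπ (((h.prod Z).push _).res _)

-- An empty variety is both its own closed part and its own complement, so additivity forces any
-- additive invariant of it to vanish.
omit [IsAlgClosed k] [CharZero k] in
theorem isScissor_of_isEmpty {X : EqVar S H} (h : IsEmpty X.X.left) : X.IsScissor X X :=
  ⟨𝟙 _, 𝟙 _, ⟨by simp, by simp⟩, ⟨by simp, by simp⟩, inferInstanceAs (IsClosedImmersion (𝟙 _)),
    inferInstanceAs (IsOpenImmersion (𝟙 _)), Subsingleton.elim _ _⟩

omit [IsAlgClosed k] in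
theorem quo_of_isEmpty [Finite H] {π : H →* H'} (hπ : Function.Surjective π) {X : EqVar S H}
    (h : IsEmpty X.X.left) : quo π hπ X = 0 := by
  simpa using quo_scissor hπ (isScissor_of_isEmpty h)

omit [IsAlgClosed k] [CharZero k] in
theorem equivariant_of_snd {P : EqVar S (Γ × Δ)} {Q : EqVar S Δ} {q : P.X ⟶ Q.X}
    (hq : ∀ g, P.act (g, 1) ≫ q = q) (h : ∀ t, q ≫ Q.act t = P.act (1, t) ≫ q) (x : Γ × Δ) :
    q ≫ Q.act x.2 = P.act x ≫ q := by
  have e : x = (x.1, 1) * (1, x.2) := by simp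
  conv_rhs => rw [e, P.act_mul, Category.assoc, ← h, reassoc_of% (hq x.1)]

/-! ### Balanced products as quotients -/

variable (n : ℕ) [NeZero n] (c : k)

variable (k) in
/-- The morphism `((s, t), r) ↦ ((s, t), (s⁻¹ r, t⁻¹ r))`. -/
def balHom : RootTriple n k →* RootPair n k × RootPair n k where
  toFun x := (x.1, (x.1.1⁻¹ * x.2, x.1.2⁻¹ * x.2))
  map_one' := by simp
  map_mul' x y := by ext <;> simp <;> ring

/-- The product with the curve `xⁿ + yⁿ = c`, whose quotient is the balanced product. -/
abbrev bal (Z : EqVar S (RootPair n k)) : EqVar S (RootTriple n k) :=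
  tw (balHom k n) Z (fermatVar n c)

/-- The balancing action and the residual diagonal action on the curve commute, and `balHom` merges
them into one action of μ_n³. The balancing group is then the kernel of the projection to the last
factor, and the general theory of `IsQuot` applies. -/
theorem isBalancedProduct_iff (Z : EqVar S (RootPair n k)) (Q : EqVar S (rootsOfUnity n k)) :
    IsBalancedProduct n c Z Q ↔ IsQuot (MonoidHom.snd (RootPair n k) _) (bal n c Z) Q := by
  have hact (x : RootTriple n k) : (bal n c Z).act x =
      Z.act x.1 ⊗ₘ fermatScale c (x.1.1⁻¹ * x.2) (x.1.2⁻¹ * x.2) := by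
    rw [← fermatVar_act]
    rfl
  refine exists_congr fun q => ?_
  have h1 : IsQuotientBy (fun g : RootPair n k =>
      (Z.act g ⊗ₘ fermatScale c g.1⁻¹ g.2⁻¹).left) q.left ↔
      IsQuotientBy (fun x : (MonoidHom.snd (RootPair n k) (rootsOfUnity n k)).ker =>
        ((bal n c Z).act x).left) q.left := by
    constructor
    · refine fun h => h.congr (fun g => ⟨⟨(g, 1), rfl⟩, ?_⟩) fun g => ⟨g.1.1, ?_⟩
      · change ((bal n c Z).act (g, 1)).left = _
        rw [hact]
        simp
      · change _ = ((bal n c Z).act g.1).left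
        rw [hact, show g.1.2 = 1 from g.2]
        simp only [mul_one]
        rfl
    · refine fun h => h.congr (fun g => ⟨g.1.1, ?_⟩) fun g => ⟨⟨(g, 1), rfl⟩, ?_⟩
      · change _ = ((bal n c Z).act g.1).left
        rw [hact, show g.1.2 = 1 from g.2]
        simp only [mul_one]
        rfl
      · change ((bal n c Z).act (g, 1)).left = _
        rw [hact]
        simp
  have h2 : (bal n c Z).p = fst Z.X (fermat n c) ≫ Z.p := by
    change (Z.p ⊗ₘ (fermatVar n c).p) ≫ (ρ_ S).hom = _
    simp only [rightUnitor_hom, tensorHom_fst]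
    rfl
  have h3 (t : rootsOfUnity n k) : (bal n c Z).act (1, t) = Z.X ◁ fermatScale c t t := by
    rw [hact, Z.act_one]
    simp only [Prod.fst_one, Prod.snd_one, inv_one, one_mul, id_tensorHom]
    rfl
  rw [h1, h2]
  refine and_congr_right fun hq => and_congr_right fun _ => ⟨?_, fun h t => ?_⟩
  · intro h
    refine equivariant_of_snd (P := bal n c Z) (q := q) (fun g => ?_) fun t => ?_
    · ext1
      exact hq.invariant ⟨(g, 1), rfl⟩
    · rw [h3]
      exact h t
  · rw [← h3]
    exact h (1, t)

end twist

/-! ### Coordinates on trivial affine bundles -/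

section coord

variable {k : Type u} [Field k] {r : ℕ}

/-- The functions `t` are coordinates on the trivial affine bundle `π`. -/
structure IsCoord {E Y : Sch k} (π : E ⟶ Y) (t : Fin r → Gl E) : Prop where
  lift : ∀ (T : Sch k) (f : T ⟶ Y) (v : Fin r → Gl T), ∃ g : T ⟶ E, g ≫ π = f ∧
    ∀ i, pb g (t i) = v i
  ext : ∀ (T : Sch k) (g g' : T ⟶ E), g ≫ π = g' ≫ π → (∀ i, pb g (t i) = pb g' (t i)) → g = g'

theorem isCoord_of_isIso {E Y : Sch k} {π : E ⟶ Y} {t : ULift.{u} (Fin r) → Gl E}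
    (h : IsIso (AffineSpace.homOfVector π.left t)) : IsCoord π fun i => t ⟨i⟩ := by
  have h1 : inv (AffineSpace.homOfVector π.left t) ≫ π.left = _ ↘ Y.left := by
    rw [IsIso.inv_comp_eq, AffineSpace.homOfVector_over]
  have h2 (i) : (inv (AffineSpace.homOfVector π.left t)).appTop (t i) =
      AffineSpace.coord Y.left i := by
    rw [← AffineSpace.homOfVector_appTop_coord π.left t i, ← CommRingCat.comp_apply,
      ← Scheme.Hom.comp_appTop, IsIso.inv_hom_id]
    simp
  refine ⟨fun T f v => ?_, fun T g g' h3 h4 => ?_⟩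
  · refine ⟨Over.homMk (AffineSpace.homOfVector f.left (fun i : ULift.{u} (Fin r) => v i.1) ≫
      inv (AffineSpace.homOfVector π.left t)) ?_, ?_, fun i => ?_⟩
    · rw [← Over.w π, Category.assoc, reassoc_of% h1, AffineSpace.homOfVector_over_assoc, Over.w f]
    · ext1
      change (_ ≫ _) ≫ _ = _
      rw [Category.assoc, h1, AffineSpace.homOfVector_over]
    · change (_ ≫ _ : T.left ⟶ E.left).appTop (t ⟨i⟩) = _
      rw [Scheme.Hom.comp_appTop, CommRingCat.comp_apply, h2,
        AffineSpace.homOfVector_appTop_coord]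
  · ext1
    rw [← cancel_mono (AffineSpace.homOfVector π.left t)]
    refine AffineSpace.hom_ext ?_ fun i => ?_
    · rw [Category.assoc, Category.assoc, AffineSpace.homOfVector_over]
      exact congr(($h3).left)
    · rw [Scheme.Hom.comp_appTop, CommRingCat.comp_apply, Scheme.Hom.comp_appTop,
        CommRingCat.comp_apply, AffineSpace.homOfVector_appTop_coord]
      exact h4 i.1

theorem IsCoord.isIso {E Y : Sch k} {π : E ⟶ Y} {t : Fin r → Gl E} (h : IsCoord π t) :
    IsIso (AffineSpace.homOfVector π.left fun i : ULift.{u} (Fin r) => t i.1) := by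
  let A : Sch k := Over.mk (𝔸(ULift.{u} (Fin r); Y.left) ↘ Y.left ≫ Y.hom)
  let p : A ⟶ Y := Over.homMk (𝔸(ULift.{u} (Fin r); Y.left) ↘ Y.left) rfl
  obtain ⟨g, h1, h2⟩ := h.lift A p fun i => AffineSpace.coord Y.left ⟨i⟩
  let m : E ⟶ A := Over.homMk (AffineSpace.homOfVector π.left fun i => t i.1) <| by
    change _ ≫ _ ≫ _ = _
    rw [AffineSpace.homOfVector_over_assoc, Over.w]
  have hm : m ≫ p = π := by
    ext1
    exact AffineSpace.homOfVector_over _ _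
  have hm' (i : ULift.{u} (Fin r)) : pb m (AffineSpace.coord Y.left i) = t i.1 :=
    AffineSpace.homOfVector_appTop_coord _ _ _
  have e1 : m ≫ g = 𝟙 E := by
    refine h.ext _ _ _ (by rw [Category.assoc, h1, hm, Category.id_comp]) fun i => ?_
    rw [pb_comp, h2, hm', pb_id]
  have e2 : g.left ≫ m.left = 𝟙 A.left := by
    refine AffineSpace.hom_ext ?_ fun i => ?_
    · change (g.left ≫ m.left) ≫ p.left = 𝟙 _ ≫ p.left
      rw [← Over.comp_left, ← Over.comp_left, Category.assoc, hm, h1, Category.id_comp]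
    · change pb (g ≫ m) (AffineSpace.coord Y.left i) = pb (𝟙 A) (AffineSpace.coord Y.left i)
      rw [pb_comp, hm', h2, pb_id]
  exact ⟨g.left, congr(($e1).left), e2⟩

namespace IsCoord

variable {E Y : Sch k} {π : E ⟶ Y} {t : Fin r → Gl E}

/-- Evaluate on sections of the bundle: the zero section isolates the constant term and the unit
vectors isolate the coefficients. -/
theorem coeff_unique (h : IsCoord π t) {b b' : Gl Y} {a a' : Fin r → Gl Y}
    (e : pb π b + ∑ j, pb π (a j) * t j = pb π b' + ∑ j, pb π (a' j) * t j) : a = a' := by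
  have key (v : Fin r → Gl Y) : b + ∑ j, a j * v j = b' + ∑ j, a' j * v j := by
    obtain ⟨s, h1, h2⟩ := h.lift Y (𝟙 Y) v
    have := congr(pb s $e)
    simpa only [map_add, map_sum, map_mul, ← pb_comp, h1, pb_id, h2] using this
  have hb : b = b' := by simpa using key 0
  funext i
  simpa [hb, Pi.single_apply] using key (Pi.single i 1)

theorem affine_change (h : IsCoord π t) {e : Fin r → Gl E} {b : Fin r → Gl Y}
    {a : Matrix (Fin r) (Fin r) (Gl Y)} (he : ∀ i, e i = pb π (b i) + ∑ j, pb π (a i j) * t j)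
    (ha : IsUnit a.det) : IsCoord π e := by
  have hinv : a⁻¹ * a = 1 := Matrix.nonsing_inv_mul a ha
  have hinv' : a * a⁻¹ = 1 := Matrix.mul_nonsing_inv a ha
  have hT {T : Sch k} (g : T ⟶ E) (i) : pb g (e i) = pb (g ≫ π) (b i) +
      ∑ j, pb (g ≫ π) (a i j) * pb g (t j) := by
    simp only [he, map_add, map_sum, map_mul, pb_comp]
  refine ⟨fun T f v => ?_, fun T g g' h1 h2 => h.ext _ _ _ h1 ?_⟩
  · obtain ⟨g, h1, h2⟩ := h.lift T f (((pb f).mapMatrix a⁻¹).mulVec fun i => v i - pb f (b i))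
    refine ⟨g, h1, fun i => ?_⟩
    rw [hT, h1]
    simp only [h2]
    have : ((pb f).mapMatrix a).mulVec (((pb f).mapMatrix a⁻¹).mulVec fun i => v i - pb f (b i)) =
        fun i => v i - pb f (b i) := by
      rw [Matrix.mulVec_mulVec, ← map_mul, hinv', map_one, Matrix.one_mulVec]
    have := congr($this i)
    simp only [Matrix.mulVec, dotProduct] at this ⊢
    exact (congr(pb f (b i) + $this)).trans (by ring)
  · have key : ((pb (g ≫ π)).mapMatrix a).mulVec (fun i => pb g (t i)) =
        ((pb (g ≫ π)).mapMatrix a).mulVec (fun i => pb g' (t i)) := by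
      funext i
      have := h2 i
      rw [hT, hT, h1] at this
      rw [h1]
      exact add_left_cancel this
    have := congr(((pb (g ≫ π)).mapMatrix a⁻¹).mulVec $key)
    rw [Matrix.mulVec_mulVec, Matrix.mulVec_mulVec, ← map_mul, hinv, map_one, Matrix.one_mulVec,
      Matrix.one_mulVec] at this
    exact fun i => congr($this i)

end IsCoord

/-- The affine space over `k`. -/
abbrev affSpace (k : Type u) [Field k] (r : ℕ) : Sch k := specOver k (MvPolynomial (Fin r) k)

/-- The coordinates on the affine space. -/
def affSpaceCoord (k : Type u) [Field k] {r : ℕ} (i : Fin r) : Gl (affSpace k r) :=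
  gen k _ (MvPolynomial.X i)

theorem isCoord_affSpace (r : ℕ) :
    IsCoord (toUnit (affSpace k r)) (affSpaceCoord k) :=
  ⟨fun T f v => by
    obtain ⟨g, hg⟩ := exists_toAffineSpace v
    exact ⟨g, toUnit_unique _ _, hg⟩, fun T g g' _ h => affineSpace_ext h⟩

theorem IsCoord.whiskerRight {E Y : Sch k} {π : E ⟶ Y} {t : Fin r → Gl E} (h : IsCoord π t)
    (Z : Sch k) : IsCoord (π ▷ Z) fun i => pb (fst E Z) (t i) := by
  refine ⟨fun T f v => ?_, fun T g g' h1 h2 => ?_⟩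
  · obtain ⟨g, h1, h2⟩ := h.lift T (f ≫ fst Y Z) v
    refine ⟨CartesianMonoidalCategory.lift g (f ≫ snd Y Z), ?_, fun i => ?_⟩
    · ext1
      · rw [Category.assoc, whiskerRight_fst, lift_fst_assoc, h1]
      · rw [Category.assoc, whiskerRight_snd, lift_snd]
    · rw [← pb_comp, lift_fst, h2]
  · ext1
    · refine h.ext _ _ _ ?_ fun i => ?_
      · have := congr($h1 ≫ fst Y Z)
        simpa using this
      · rw [pb_comp, pb_comp, h2]
    · have := congr($h1 ≫ snd Y Z)
      simpa using this

theorem IsCoord.fst_of_unit {A : Sch k} {a : Fin r → Gl A} (h : IsCoord (toUnit A) a) (Y : Sch k) :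
    IsCoord (fst Y A) fun i => pb (snd Y A) (a i) := by
  refine ⟨fun T f v => ?_, fun T g g' h1 h2 => ?_⟩
  · obtain ⟨g, -, h2⟩ := h.lift T (toUnit T) v
    exact ⟨CartesianMonoidalCategory.lift f g, lift_fst _ _, fun i => by
      rw [← pb_comp, lift_snd, h2]⟩
  · ext1
    · exact h1
    · refine h.ext _ _ _ (toUnit_unique _ _) fun i => ?_
      rw [pb_comp, pb_comp, h2]

theorem IsCoord.comp_iso {E E' Y : Sch k} {π : E ⟶ Y} {t : Fin r → Gl E} (h : IsCoord π t)
    {π' : E' ⟶ Y} {t' : Fin r → Gl E'} (h' : IsCoord π' t') :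
    ∃ e : E ≅ E', e.hom ≫ π' = π ∧ ∀ i, pb e.hom (t' i) = t i := by
  obtain ⟨f, h1, h2⟩ := h'.lift E π t
  obtain ⟨g, h3, h4⟩ := h.lift E' π' t'
  refine ⟨⟨f, g, h.ext _ _ _ ?_ ?_, h'.ext _ _ _ ?_ ?_⟩, h1, h2⟩
  · rw [Category.assoc, h3, h1, Category.id_comp]
  · intro i
    rw [pb_comp, h4, h2, pb_id]
  · rw [Category.assoc, h1, h3, Category.id_comp]
  · intro i
    rw [pb_comp, h2, h4, pb_id]

theorem isVariety_affSpace (r : ℕ) : IsVariety (affSpace k r) :=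
  (isAffineFT_specOver _).isVariety isReduced_specOver

end coord

/-! ### Affine spaces with a diagonal action -/

section affVar

variable {k : Type u} [Field k] {r : ℕ} {S : Sch k} {H Γ : Type*} [Group Γ] [Group H]

/-- The affine space with a diagonal linear action. -/
def affVar (χ : Γ →* (Fin r → kˣ)) : EqVar (𝟙_ (Sch k)) Γ where
  X := affSpace k r
  isVariety := isVariety_affSpace r
  p := toUnit _
  act γ := ((isCoord_affSpace r).lift _ (toUnit _)
    fun i => cst _ (χ γ i : k) * affSpaceCoord k i).choose
  act_one := (isCoord_affSpace r).ext _ _ _ (toUnit_unique _ _) fun i => by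
    have h := ((isCoord_affSpace r).lift _ (toUnit _)
      fun i => cst _ (χ 1 i : k) * affSpaceCoord k i).choose_spec.2 i
    rw [h]
    simp
  act_mul γ δ := (isCoord_affSpace r).ext _ _ _ (toUnit_unique _ _) fun i => by
    have h (γ) := ((isCoord_affSpace r).lift _ (toUnit _)
      fun i => cst _ (χ γ i : k) * affSpaceCoord k i).choose_spec.2 i
    rw [h, pb_comp, h, map_mul (pb _), pb_cst, h, map_mul, Pi.mul_apply, Units.val_mul, map_mul]
    ring
  act_p _ := toUnit_unique _ _
  good x := ⟨⊤, isAffineOpen_top _, fun _ => trivial⟩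

/-- The functions `a` are coordinates on which the group acts through the characters `χ`. -/
structure LinRep (A : EqVar (𝟙_ (Sch k)) Γ) (a : Fin r → Gl A.X) (χ : Γ →* (Fin r → kˣ)) :
    Prop where
  coord : IsCoord (toUnit A.X) a
  act : ∀ γ i, pb (A.act γ) (a i) = cst A.X (χ γ i : k) * a i

theorem linRep_affVar (χ : Γ →* (Fin r → kˣ)) : LinRep (affVar χ) (affSpaceCoord k) χ :=
  ⟨isCoord_affSpace r, fun γ => ((isCoord_affSpace r).lift _ (toUnit _)
    fun i => cst _ (χ γ i : k) * affSpaceCoord k i).choose_spec.2⟩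

theorem LinRep.comp {A : EqVar (𝟙_ (Sch k)) Γ} {a : Fin r → Gl A.X} {χ : Γ →* (Fin r → kˣ)}
    (h : LinRep A a χ) (π : H →* Γ) : LinRep (A.res π) a (χ.comp π) :=
  ⟨h.coord, fun _ => h.act _⟩

variable [IsAlgClosed k]

/-- A trivial affine bundle whose coordinates are eigenfunctions. -/
theorem IsCoord.iso_tw {Y E : EqVar S H} {f : E.X ⟶ Y.X} (hf : E.IsHom Y f) {e : Fin r → Gl E.X}
    (h : IsCoord f e) {χ : H →* (Fin r → kˣ)}
    (he : ∀ g i, pb (E.act g) (e i) = cst _ (χ g i : k) * e i) {A : EqVar (𝟙_ (Sch k)) H}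
    {a : Fin r → Gl A.X} (hA : LinRep A a χ) :
    E.Iso (tw ((MonoidHom.id H).prod (MonoidHom.id H)) Y A) := by
  obtain ⟨m, h1, h2⟩ := h.comp_iso (hA.coord.fst_of_unit Y.X)
  refine ⟨m, ?_, fun g => (hA.coord.fst_of_unit Y.X).ext _ _ _ ?_ fun i => ?_⟩
  · change m.hom ≫ (Y.p ⊗ₘ A.p) ≫ (ρ_ S).hom = _
    rw [rightUnitor_hom, tensorHom_fst, reassoc_of% h1, hf.comm]
  · change (E.act g ≫ m.hom) ≫ fst Y.X A.X = (m.hom ≫ (Y.act g ⊗ₘ A.act g)) ≫ fst Y.X A.X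
    rw [Category.assoc, Category.assoc, tensorHom_fst, h1, reassoc_of% h1, hf.equivariant]
  · change pb (E.act g ≫ m.hom) _ = pb (m.hom ≫ (Y.act g ⊗ₘ A.act g)) _
    rw [pb_comp, h2, he, ← pb_comp, Category.assoc, tensorHom_snd, pb_comp, pb_comp, hA.act,
      map_mul, map_mul, pb_cst, pb_cst, h2]

theorem LinRep.isAffineLift {A : EqVar (𝟙_ (Sch k)) Γ} {a : Fin r → Gl A.X}
    {χ : Γ →* (Fin r → kˣ)} (hA : LinRep A a χ) (Y : EqVar S Γ) :
    Y.IsAffineLift r (tw ((MonoidHom.id Γ).prod (MonoidHom.id Γ)) Y A) := by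
  refine ⟨fst Y.X A.X, fun i => pb (snd Y.X A.X) (a i.1), ⟨?_, fun g => ?_⟩,
    (hA.coord.fst_of_unit Y.X).isIso, fun g i => ?_⟩
  · change _ = (Y.p ⊗ₘ A.p) ≫ (ρ_ S).hom
    rw [rightUnitor_hom, tensorHom_fst]
  · change (Y.act g ⊗ₘ A.act g) ≫ _ = _
    rw [tensorHom_fst]
  · refine ⟨fun j => if j = i then cst _ (χ g i.1 : k) else 0, 0, ?_⟩
    have : pb (Y.act g ⊗ₘ A.act g) (pb (snd Y.X A.X) (a i.1)) =
        cst _ (χ g i.1 : k) * pb (snd Y.X A.X) (a i.1) := by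
      rw [← pb_comp, tensorHom_snd, pb_comp, hA.act, map_mul, pb_cst]
    refine this.trans ?_
    simp only [map_zero, zero_add]
    rw [Finset.sum_eq_single i (fun j _ hj => by rw [if_neg hj, map_zero, zero_mul]) (by simp)]
    rw [if_pos rfl]
    exact congr($((pb_cst (fst Y.X A.X) _).symm) * _)

variable [CharZero k] [Finite H] [Finite Γ]

/-- The product with the affine space of dimension `r`. -/
def lefschetz (S : Sch k) (Γ : Type*) [Group Γ] (r : ℕ) : K0 S Γ →+ K0 S Γ :=
  (K0.res ((MonoidHom.id Γ).prod (MonoidHom.id Γ))).comp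
    ((K0.push (ρ_ S).hom).comp (K0.prodRight (affVar (1 : Γ →* (Fin r → kˣ)))))

-- The weights factor through `π`, so the kernel fixes the coordinates and `E` is `Y` times a
-- representation of `Γ`. The quotient is therefore that of `Y` times the same representation, which
-- the affine relation replaces by affine space with trivial action.
omit [Finite Γ] in
theorem quo_of_eigen {π : H →* Γ} (hπ : Function.Surjective π) {Y E : EqVar S H} {f : E.X ⟶ Y.X}
    (hf : E.IsHom Y f) {e : Fin r → Gl E.X} (h : IsCoord f e) (χ : Γ →* (Fin r → kˣ))
    (he : ∀ g i, pb (E.act g) (e i) = cst _ (χ (π g) i : k) * e i) :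
    quo π hπ E = lefschetz S Γ r (quo π hπ Y) := by
  obtain ⟨Q, hQ⟩ := exists_isQuot hπ Y
  rw [quo_eq hπ hQ, quo_iso hπ (h.iso_tw hf he ((linRep_affVar χ).comp π))]
  have e1 : tw ((MonoidHom.id H).prod (MonoidHom.id H)) Y ((affVar χ).res π) =
    tw ((MonoidHom.id H).prod π) Y (affVar χ) := rfl
  have h2 : IsQuot π (tw ((MonoidHom.id H).prod π) Y (affVar χ))
      (tw ((MonoidHom.id Γ).prod (MonoidHom.id Γ)) Q (affVar χ)) :=
    isQuot_tw_left hQ _ _ _ _ (fun _ => rfl) fun g hg => ⟨g, hg, Prod.ext rfl hg⟩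
  rw [e1, quo_eq hπ h2]
  exact (K0.mk_affine ((linRep_affVar χ).isAffineLift Q)
    ((linRep_affVar (k := k) 1).isAffineLift Q)).trans (by simp [lefschetz])

end affVar

/-! ### Restriction of equivariant affine bundles -/

section restrict

variable {k : Type u} [Field k] {r : ℕ} {S : Sch k} {H : Type*} [Group H]

/-- The quasi-compact case of the description of a reduced closed subscheme. -/
theorem exists_isClosedImmersion_of_isClosed {X : Sch k} (hX : IsVariety X) (Z : Set X.left)
    (hZ : IsClosed Z) : ∃ (Y : Sch k) (i : Y ⟶ X), IsVariety Y ∧ IsClosedImmersion i.left ∧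
      Set.range i.left = Z ∧ ∀ (T : Sch k) (f : T ⟶ X), IsVariety T → Set.range f.left ⊆ Z →
        ∃ g : T ⟶ Y, g ≫ i = f := by
  let C : TopologicalSpace.Closeds X.left := ⟨Z, hZ⟩
  let I := Scheme.IdealSheafData.vanishingIdeal C
  have hred : IsReduced I.subscheme := by
    have : ∀ U, IsReduced (I.subschemeCover.openCover.X U) := fun U => by
      change IsReduced (Spec (.of (Γ(X.left, U.1) ⧸ I.ideal U)))
      have : (I.ideal U).IsRadical := PrimeSpectrum.isRadical_vanishingIdeal _
      rw [affine_isReduced_iff]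
      exact (Ideal.isRadical_iff_quotient_reduced _).1 this
    exact IsReduced.of_openCover _ I.subschemeCover.openCover
  let Y : Sch k := Over.mk (I.subschemeι ≫ X.hom)
  obtain ⟨_, _, _, _⟩ := hX
  refine ⟨Y, Over.homMk I.subschemeι rfl, ⟨hred, ?_, ?_, ?_⟩, ?_, ?_, fun T f hT hf => ?_⟩
  · exact inferInstanceAs (IsSeparated (I.subschemeι ≫ X.hom))
  · exact inferInstanceAs (LocallyOfFiniteType (I.subschemeι ≫ X.hom))
  · exact inferInstanceAs (QuasiCompact (I.subschemeι ≫ X.hom))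
  · exact inferInstanceAs (IsClosedImmersion I.subschemeι)
  · refine I.range_subschemeι.trans ?_
    exact Scheme.IdealSheafData.coe_support_vanishingIdeal _
  · have hT' := hT.reduced
    -- As `T` is reduced, the ideal of functions killed by `f` is radical, so it is determined by
    -- its support, the closure of the image.
    have hle : I.subschemeι.ker ≤ f.left.ker := by
      rw [Scheme.IdealSheafData.ker_subschemeι]
      have : IsSeparated X.hom := ‹_›
      have : QuasiCompact f.left := by
        have h1 : QuasiCompact (f.left ≫ X.hom) := by
          rw [Over.w]
          exact hT.quasiCompact
        exact .of_comp f.left X.hom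
      have hrad : f.left.ker.radical = f.left.ker := by
        ext U : 2
        rw [Scheme.IdealSheafData.radical_ideal, Scheme.Hom.ker_apply]
        refine Ideal.IsRadical.radical fun x ⟨m, hm⟩ => ?_
        refine IsNilpotent.eq_zero ⟨m, ?_⟩
        rw [← map_pow]
        exact hm
      rw [← hrad, ← Scheme.IdealSheafData.vanishingIdeal_support]
      refine Scheme.IdealSheafData.vanishingIdeal_antimono ?_
      change (f.left.ker.support : Set X.left) ⊆ Z
      rw [Scheme.Hom.support_ker]
      exact closure_minimal hf hZ
    refine ⟨Over.homMk (IsClosedImmersion.lift I.subschemeι f.left hle) ?_, ?_⟩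
    · change _ ≫ I.subschemeι ≫ X.hom = _
      rw [IsClosedImmersion.lift_fac_assoc, Over.w]
    · ext1
      exact IsClosedImmersion.lift_fac _ _ _

theorem isAffineHom_pullback_fst {A B C : Scheme.{u}} (f : A ⟶ C) (g : B ⟶ C) [IsAffineHom g] :
    IsAffineHom (pullback.fst f g) :=
  MorphismProperty.of_isPullback (P := @IsAffineHom) (IsPullback.of_hasPullback f g).flip
    ‹IsAffineHom g›

/-- The restriction of an affine bundle with group action to an equivariant morphism to the base. -/
theorem IsCoord.exists_restrict {Y E Y' : EqVar S H} {π : E.X ⟶ Y.X} (hπ : E.IsHom Y π)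
    {t : Fin r → Gl E.X} (h : IsCoord π t) {j : Y'.X ⟶ Y.X} (hj : Y'.IsHom Y j) [IsAlgClosed k] :
    ∃ (E' : EqVar S H) (π' : E'.X ⟶ Y'.X) (η : E'.X ⟶ E.X), E'.IsHom Y' π' ∧ E'.IsHom E η ∧
      η ≫ π = π' ≫ j ∧ IsCoord π' (fun i => pb η (t i)) ∧ IsPullback η π' π j := by
  -- The bundle is trivial, so its restriction is `Y' × 𝔸ʳ`; this is also the fibre product, whose
  -- universal property supplies the action.
  let V : Sch k := Y'.X ⊗ affSpace k r
  let ψ : V ⟶ Y'.X := fst _ _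
  obtain ⟨η, hη, hη'⟩ := h.lift V (ψ ≫ j) fun i => pb (snd _ _) (affSpaceCoord k i)
  have hV : IsCoord ψ fun i => pb η (t i) := by
    simp only [hη']
    exact (isCoord_affSpace r).fst_of_unit Y'.X
  have hext {T : Sch k} {f f' : T ⟶ V} (h1 : f ≫ η = f' ≫ η) (h2 : f ≫ ψ = f' ≫ ψ) : f = f' :=
    hV.ext _ _ _ h2 fun i => by rw [← pb_comp, h1, pb_comp]
  have hlift {T : Sch k} (a : T ⟶ E.X) (b : T ⟶ Y'.X) (e : a ≫ π = b ≫ j) :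
      ∃ l : T ⟶ V, l ≫ η = a ∧ l ≫ ψ = b := by
    obtain ⟨l, h1, h2⟩ := hV.lift T b fun i => pb a (t i)
    refine ⟨l, h.ext _ _ _ ?_ fun i => ?_, h1⟩
    · rw [Category.assoc, hη, reassoc_of% h1, e]
    · rw [pb_comp, h2]
  choose act hact hact' using fun g : H => hlift (η ≫ E.act g) (ψ ≫ Y'.act g)
    (by rw [Category.assoc, hπ.equivariant, reassoc_of% hη, Category.assoc, hj.equivariant])
  have haff : IsAffineHom ψ.left := by
    change IsAffineHom (pullback.fst Y'.X.hom (affSpace k r).hom)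
    have : IsAffineHom (affSpace k r).hom := by
      change IsAffineHom (Spec.map _)
      infer_instance
    exact isAffineHom_pullback_fst _ _
  let E' : EqVar S H :=
    { X := V
      isVariety := Y'.isVariety.tensor (isVariety_affSpace r)
      p := ψ ≫ Y'.p
      act := act
      act_one := hext (by rw [hact, E.act_one]; simp) (by rw [hact', Y'.act_one]; simp)
      act_mul g g' := by
        refine hext ?_ ?_
        · rw [hact, E.act_mul, Category.assoc, hact, reassoc_of% (hact g)]
        · rw [hact', Y'.act_mul, Category.assoc, hact', reassoc_of% (hact' g)]
      act_p g := by rw [reassoc_of% (hact' g), Y'.act_p]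
      good x := by
        obtain ⟨U, hU, hU'⟩ := Y'.good (ψ.left x)
        refine ⟨ψ.left ⁻¹ᵁ U, hU.preimage ψ.left, fun g => ?_⟩
        have : ψ.left ((act g).left x) = (Y'.act g).left (ψ.left x) := by
          rw [← Scheme.Hom.comp_apply, ← Scheme.Hom.comp_apply, ← Over.comp_left,
            ← Over.comp_left, hact']
        change ψ.left _ ∈ U
        rw [this]
        exact hU' g }
  refine ⟨E', ψ, η, ⟨rfl, hact'⟩, ⟨?_, hact⟩, hη, hV, ⟨⟨hη⟩, ⟨PullbackCone.IsLimit.mk _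
    (fun s => (hlift s.fst s.snd s.condition).choose)
    (fun s => (hlift s.fst s.snd s.condition).choose_spec.1)
    (fun s => (hlift s.fst s.snd s.condition).choose_spec.2)
    fun s m h1 h2 => hext (h1.trans (hlift s.fst s.snd s.condition).choose_spec.1.symm)
      (h2.trans (hlift s.fst s.snd s.condition).choose_spec.2.symm)⟩⟩⟩
  change η ≫ E.p = ψ ≫ Y'.p
  rw [← hπ.comm, reassoc_of% hη, hj.comm]

theorem IsNonvanishing.isAffineHom {D T : Sch k} {j : D ⟶ T} {f : Gl T} (h : IsNonvanishing j f) :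
    IsAffineHom j.left := by
  obtain ⟨_, hr⟩ := h.spec
  have hr' : Set.range j.left = Set.range (T.left.basicOpen f).ι := by
    rw [Scheme.Opens.range_ι, ← hr]
    rfl
  rw [← IsOpenImmersion.isoOfRangeEq_hom_fac j.left (T.left.basicOpen f).ι hr']
  infer_instance

/-- The decomposition of a variety with group action by a global function whose nonvanishing locus
is stable. -/
theorem exists_isScissor_basicOpen (Y : EqVar S H) (f : Gl Y.X)
    (hf : ∀ g, ∃ c d, IsUnit c ∧ c * f = pb (Y.act g) f * d) :
    ∃ (C U : EqVar S H) (i : C.X ⟶ Y.X) (j : U.X ⟶ Y.X), C.IsHom Y i ∧ U.IsHom Y j ∧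
      IsClosedImmersion i.left ∧ IsOpenImmersion j.left ∧
        Set.range j.left = (Set.range i.left)ᶜ ∧ pb i f = 0 ∧ IsUnit (pb j f) := by
  obtain ⟨C, i, hC, hi, hri, hCl⟩ := exists_isClosedImmersion_of_isClosed Y.isVariety
    (Y.X.left.basicOpen f : Set Y.X.left)ᶜ (Y.X.left.basicOpen f).isOpen.isClosed_compl
  obtain ⟨U, j, hU⟩ := exists_isNonvanishing f
  obtain ⟨hj, hrj⟩ := hU.spec
  have hja := hU.isAffineHom
  -- The hypothesis says that up to a unit `f` is a multiple of its translate, so the translate is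
  -- invertible wherever `f` is. Using it for `g⁻¹` too shows that the complement is stable.
  have hstab (g) : Y.X.left.basicOpen f ≤ (Y.act g).left ⁻¹ᵁ Y.X.left.basicOpen f := by
    obtain ⟨c, d, hc, e⟩ := hf g
    have h1 : Y.X.left.basicOpen (c * f) = Y.X.left.basicOpen f := by
      rw [Scheme.basicOpen_mul, Scheme.basicOpen_of_isUnit _ hc]
      exact top_inf_eq _
    refine h1.ge.trans ?_
    rw [e, Scheme.basicOpen_mul]
    exact inf_le_left.trans (Scheme.preimage_basicOpen _ _).ge
  have hinv (g) (x : Y.X.left) : (Y.act g⁻¹).left ((Y.act g).left x) = x := by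
    rw [← Scheme.Hom.comp_apply, ← Over.comp_left, ← Y.act_mul, mul_inv_cancel, Y.act_one]
    rfl
  choose a ha using fun g => hCl C (i ≫ Y.act g) hC <| by
    rintro _ ⟨x, rfl⟩ hx
    have h1 : i.left x ∈ (Y.X.left.basicOpen f : Set Y.X.left)ᶜ := hri ▸ ⟨x, rfl⟩
    refine h1 ?_
    have h2 := hstab g⁻¹ hx
    have h3 : (Y.act g⁻¹).left ((i ≫ Y.act g).left x) = i.left x := hinv g (i.left x)
    change (Y.act g⁻¹).left ((i ≫ Y.act g).left x) ∈ Y.X.left.basicOpen f at h2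
    rwa [h3] at h2
  choose b hb using fun g => hU.lift U (j ≫ Y.act g) <| by
    obtain ⟨c, d, hc, e⟩ := hf g
    rw [pb_comp]
    have h1 := congr(pb j $e)
    rw [map_mul, map_mul] at h1
    exact isUnit_of_mul_isUnit_left (h1 ▸ (hc.map _).mul hU.unit)
  have himono : Mono i := (Over.forget _).mono_of_mono_map (inferInstanceAs (Mono i.left))
  have hjmono : Mono j := (Over.forget _).mono_of_mono_map (inferInstanceAs (Mono j.left))
  obtain ⟨_, hs, hl, hq⟩ := Y.isVariety
  have hUv : IsVariety U := by
    have hw : j.left ≫ Y.X.hom = U.hom := Over.w j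
    refine ⟨isReduced_of_isOpenImmersion j.left, ?_, ?_, ?_⟩
    · rw [← hw]
      infer_instance
    · rw [← hw]
      infer_instance
    · rw [← hw]
      infer_instance
  have good {V : Sch k} (h : V ⟶ Y.X) [IsAffineHom h.left] (a : H → (V ⟶ V))
      (ha : ∀ g, a g ≫ h = h ≫ Y.act g) (x : V.left) :
      ∃ W : V.left.Opens, IsAffineOpen W ∧ ∀ g, (a g).left x ∈ W := by
    obtain ⟨W, hW, hW'⟩ := Y.good (h.left x)
    refine ⟨h.left ⁻¹ᵁ W, hW.preimage h.left, fun g => ?_⟩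
    have : h.left ((a g).left x) = (Y.act g).left (h.left x) := by
      rw [← Scheme.Hom.comp_apply, ← Scheme.Hom.comp_apply, ← Over.comp_left, ← Over.comp_left, ha]
    change h.left _ ∈ W
    rw [this]
    exact hW' g
  let mkE (V : Sch k) (hV : IsVariety V) (h : V ⟶ Y.X) (hm : Mono h) (h' : IsAffineHom h.left)
      (a : H → (V ⟶ V)) (ha : ∀ g, a g ≫ h = h ≫ Y.act g) : EqVar S H :=
    { X := V
      isVariety := hV
      p := h ≫ Y.p
      act := a
      act_one := by rw [← cancel_mono h, ha, Y.act_one, Category.comp_id, Category.id_comp]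
      act_mul g g' := by
        rw [← cancel_mono h, ha, Y.act_mul, Category.assoc, ha, reassoc_of% (ha g)]
      act_p g := by rw [reassoc_of% (ha g), Y.act_p]
      good := good h a ha }
  refine ⟨mkE C hC i himono inferInstance a ha, mkE U hUv j hjmono hja b hb, i, j, ⟨rfl, ha⟩,
    ⟨rfl, hb⟩, hi, hj, ?_, ?_, hU.unit⟩
  · rw [hri, compl_compl, ← hrj]
    rfl
  · have := hC.reduced
    refine eq_zero_of_basicOpen_eq_bot (X := C.left) (pb i f) ?_
    have : C.left.basicOpen (pb i f) = i.left ⁻¹ᵁ Y.X.left.basicOpen f :=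
      (Scheme.preimage_basicOpen _ _).symm
    rw [this, eq_bot_iff]
    intro x hx
    have h1 : i.left x ∈ (Y.X.left.basicOpen f : Set Y.X.left)ᶜ := hri ▸ ⟨x, rfl⟩
    exact (h1 hx).elim

end restrict

/-! ### Affine bundles and characters -/

section bundle

variable {k : Type u} [Field k] {r : ℕ} {S : Sch k} {G : Type*} [Group G] {M : Type*}
  [AddCommGroup M] {κ : Type*}

theorem range_eq_preimage_of_isPullback {A B C D : Sch k} {f : A ⟶ B} {g : A ⟶ C} {h : B ⟶ D}
    {i : C ⟶ D} (sq : IsPullback f g h i) :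
    Set.range f.left = h.left ⁻¹' Set.range i.left := by
  have sq' := sq.map (Over.forget _)
  ext x
  constructor
  · rintro ⟨y, rfl⟩
    refine ⟨g.left y, ?_⟩
    rw [← Scheme.Hom.comp_apply, ← Scheme.Hom.comp_apply]
    exact congr(($(sq'.w.symm)) y)
  · rintro ⟨y, hy⟩
    obtain ⟨z, hz, -⟩ := Scheme.exists_preimage_of_isPullback sq' x y hy.symm
    exact ⟨z, hz⟩

/-- A scissor decomposition of the base induces one of an affine bundle. -/
theorem isScissor_of_isPullback {E E₁ E₂ : EqVar S G} {Y Y₁ Y₂ : Sch k} {π : E.X ⟶ Y}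
    {π₁ : E₁.X ⟶ Y₁} {π₂ : E₂.X ⟶ Y₂} {i : Y₁ ⟶ Y} {j : Y₂ ⟶ Y} {η₁ : E₁.X ⟶ E.X}
    {η₂ : E₂.X ⟶ E.X} (hη₁ : E₁.IsHom E η₁) (hη₂ : E₂.IsHom E η₂) (sq₁ : IsPullback η₁ π₁ π i)
    (sq₂ : IsPullback η₂ π₂ π j) (hi : IsClosedImmersion i.left) (hj : IsOpenImmersion j.left)
    (hij : Set.range j.left = (Set.range i.left)ᶜ) : E.IsScissor E₁ E₂ := by
  refine ⟨η₁, η₂, hη₁, hη₂, ?_, ?_, ?_⟩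
  · exact MorphismProperty.of_isPullback (P := @IsClosedImmersion)
      (sq₁.map (Over.forget _)).flip hi
  · exact MorphismProperty.of_isPullback (P := @IsOpenImmersion)
      (sq₂.map (Over.forget _)).flip hj
  · rw [range_eq_preimage_of_isPullback sq₁, range_eq_preimage_of_isPullback sq₂, hij,
      Set.preimage_compl]

/-- Computing the translates of the eigenfunctions `e` in two ways gives `diag(c) * a = (g^* a) * α`
by uniqueness of coefficients; then take determinants. This makes the locus where `e` is a
coordinate system stable. -/
theorem IsCoord.det_stable {Y E : EqVar S G} {π : E.X ⟶ Y.X} (hπ : E.IsHom Y π)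
    {t : Fin r → Gl E.X} (h : IsCoord π t) {g : G} {α : Matrix (Fin r) (Fin r) (Gl Y.X)}
    {β : Fin r → Gl Y.X}
    (hα : ∀ i, pb (E.act g) (t i) = pb π (β i) + ∑ j, pb π (α i j) * t j)
    {e : Fin r → Gl E.X} {a : Matrix (Fin r) (Fin r) (Gl Y.X)} {b : Fin r → Gl Y.X}
    (he : ∀ i, e i = pb π (b i) + ∑ j, pb π (a i j) * t j) {c : Fin r → kˣ}
    (hc : ∀ i, pb (E.act g) (e i) = cst _ (c i : k) * e i) :
    (∏ i, cst Y.X (c i : k)) * a.det = pb (Y.act g) a.det * α.det := by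
  have key : Matrix.diagonal (fun i => cst Y.X (c i : k)) * a = (pb (Y.act g)).mapMatrix a * α := by
    refine Matrix.ext fun i => ?_
    refine congr_fun (h.coeff_unique (b := cst Y.X (c i : k) * b i)
      (b' := pb (Y.act g) (b i) + ∑ j, pb (Y.act g) (a i j) * β j) ?_)
    have h1 := hc i
    simp only [he, map_add, map_sum, map_mul, hα, ← pb_comp, hπ.equivariant] at h1
    have hd (l : Fin r) : (Matrix.diagonal (fun i => cst Y.X (c i : k)) * a) i l =
        cst Y.X (c i : k) * a i l := Matrix.diagonal_mul ..
    have hm (l : Fin r) : ((pb (Y.act g)).mapMatrix a * α) i l =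
        ∑ j, pb (Y.act g) (a i j) * α j l := Matrix.mul_apply
    simp only [hd, hm, map_mul, map_add, map_sum, pb_cst, ← pb_comp]
    rw [mul_add] at h1
    simp only [Finset.mul_sum, mul_add, Finset.sum_add_distrib] at h1
    simp only [mul_assoc, Finset.sum_mul]
    refine Eq.trans ?_ (h1.symm.trans ?_)
    · rfl
    rw [add_assoc]
    congr 2
    exact Finset.sum_comm
  have := congr(Matrix.det $key)
  rwa [Matrix.det_mul, Matrix.det_mul, Matrix.det_diagonal, ← RingHom.map_det] at this

/-- Two additive invariants that agree on the affine bundles with eigencoordinates agree on the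
affine bundles that decompose into eigenfunctions. -/
theorem eq_of_sum_det_eq_one [IsAlgClosed k] {Θ Λ : EqVar S G → M} {χ : κ → G →* kˣ}
    (hΘ : ∀ X Y U : EqVar S G, X.IsScissor Y U → Θ X = Θ U + Θ Y)
    (hΛ : ∀ X Y U : EqVar S G, X.IsScissor Y U → Λ X = Λ U + Λ Y)
    (heig : ∀ (Y E : EqVar S G) (π : E.X ⟶ Y.X) (f : Fin r → κ) (e : Fin r → Gl E.X),
      E.IsHom Y π → IsCoord π e → (∀ g i, pb (E.act g) (e i) = cst _ (χ (f i) g : k) * e i) →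
      Θ E = Λ Y) (s : Finset (Fin r → κ)) :
    ∀ (Y E : EqVar S G) (π : E.X ⟶ Y.X) (t : Fin r → Gl E.X) (e : κ → Fin r → Gl E.X)
      (a : κ → Matrix (Fin r) (Fin r) (Gl Y.X)) (b : κ → Fin r → Gl Y.X)
      (α : G → Matrix (Fin r) (Fin r) (Gl Y.X)) (β : G → Fin r → Gl Y.X),
      E.IsHom Y π → IsCoord π t →
      (∀ x i, e x i = pb π (b x i) + ∑ j, pb π (a x i j) * t j) →
      (∀ g x i, pb (E.act g) (e x i) = cst _ (χ x g : k) * e x i) →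
      (∀ g i, pb (E.act g) (t i) = pb π (β g i) + ∑ j, pb π (α g i j) * t j) →
      ∑ f ∈ s, Matrix.det (.of fun i => a (f i) i) = 1 → Θ E = Λ Y := by
  have hzero {Φ : EqVar S G → M} (hΦ : ∀ X Y U : EqVar S G, X.IsScissor Y U → Φ X = Φ U + Φ Y)
      {X : EqVar S G} (hX : IsEmpty X.X.left) : Φ X = 0 := by
    simpa using hΦ _ _ _ (isScissor_of_isEmpty hX)
  classical
  -- Induction on the number of summands. Where the determinant of `f` is invertible the
  -- eigenfunctions chosen by `f` are coordinates and `heig` applies; on the closed complement this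
  -- summand vanishes and the others still sum to 1. With no summand left, 0 = 1 and the base is
  -- empty.
  induction s using Finset.induction_on with
  | empty =>
    intro Y E π t e a b α β hπ h he hχ hα hs
    have h1 : (0 : Gl Y.X) = 1 := by simpa using hs
    have h2 : IsEmpty Y.X.left := by
      have h2 : Y.X.left.basicOpen 0 = Y.X.left.basicOpen 1 := congr(Y.X.left.basicOpen $h1)
      rw [Scheme.basicOpen_zero, Scheme.basicOpen_of_isUnit _ isUnit_one] at h2
      exact ⟨fun x => (h2.ge (Set.mem_univ x) : x ∈ (⊥ : Y.X.left.Opens)).elim⟩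
    have h3 : IsEmpty E.X.left := ⟨fun x => h2.elim (π.left x)⟩
    rw [hzero hΘ h3, hzero hΛ h2]
  | insert f s hf ih =>
    intro Y E π t e a b α β hπ h he hχ hα hs
    rw [Finset.sum_insert hf] at hs
    have hst (g : G) := h.det_stable hπ (hα g) (e := fun i => e (f i) i)
      (a := .of fun i => a (f i) i) (fun i => he (f i) i) fun i => hχ g (f i) i
    obtain ⟨C, U, i, j, hi, hj, hi', hj', hij, h0, h1⟩ :=
      exists_isScissor_basicOpen Y (Matrix.det (.of fun i => a (f i) i)) fun g =>
        ⟨_, _, IsUnit.prod_univ_iff.2 fun i => (χ (f i) g).isUnit.map (cst Y.X), hst g⟩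
    obtain ⟨EC, πC, ηC, hπC, hηC, eC, hC, sqC⟩ := h.exists_restrict hπ hi
    obtain ⟨EU, πU, ηU, hπU, hηU, eU, hU, sqU⟩ := h.exists_restrict hπ hj
    have hsc := isScissor_of_isPullback hηC hηU sqC sqU hi' hj' hij
    rw [hΘ _ _ _ hsc, hΛ Y C U ⟨i, j, hi, hj, hi', hj', hij⟩]
    have hres {E' : EqVar S G} {Y' : Sch k} {η : E'.X ⟶ E.X} {π' : E'.X ⟶ Y'} {l : Y' ⟶ Y.X}
        (e' : η ≫ π = π' ≫ l) (x : κ) (i : Fin r) : pb η (e x i) = pb π' (pb l (b x i)) +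
          ∑ j, pb π' (pb l (a x i j)) * pb η (t j) := by
      simp only [he, map_add, map_sum, map_mul, ← pb_comp, e']
    have hres' {E' : EqVar S G} {η : E'.X ⟶ E.X} (hη : E'.IsHom E η) (g x i) :
        pb (E'.act g) (pb η (e x i)) = cst _ (χ x g : k) * pb η (e x i) := by
      rw [← pb_comp, hη.equivariant, pb_comp, hχ, map_mul, pb_cst]
    congr 1
    · refine heig U EU πU f (fun i => pb ηU (e (f i) i)) hπU ?_ fun g i => hres' hηU g _ i
      refine hU.affine_change (b := fun i => pb j (b (f i) i))
        (a := (pb j).mapMatrix (.of fun i => a (f i) i)) (fun i => hres eU (f i) i) ?_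
      rwa [← RingHom.map_det]
    · refine ih C EC πC (fun i => pb ηC (t i)) (fun x l => pb ηC (e x l))
        (fun x => (pb i).mapMatrix (a x)) (fun x l => pb i (b x l))
        (fun g => (pb i).mapMatrix (α g)) (fun g l => pb i (β g l)) hπC hC
        (fun x l => hres eC x l) (fun g x l => hres' hηC g x l) (fun g l => ?_) ?_
      · rw [← pb_comp, hηC.equivariant, pb_comp, hα]
        simp only [map_add, map_sum, map_mul, ← pb_comp, eC]
        rfl
      · have := congr(pb i $hs)
        rw [map_add, h0, zero_add, map_one, map_sum] at this
        rw [← this]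
        refine Finset.sum_congr rfl fun f' _ => ?_
        rw [RingHom.map_det]
        rfl

/-- Two additive invariants that agree on the affine bundles with eigencoordinates agree on all
affine bundles. -/
theorem eq_of_isAffineLift [IsAlgClosed k] [CharZero k] [Finite G] [Fintype κ]
    {Θ Λ : EqVar S G → M} {χ : κ → G →* kˣ}
    (hχ₁ : Fintype.card κ = Nat.card G) (hχ : ∀ g ≠ 1, ∑ x, (χ x g : k) = 0)
    (hΘ : ∀ X Y U : EqVar S G, X.IsScissor Y U → Θ X = Θ U + Θ Y)
    (hΛ : ∀ X Y U : EqVar S G, X.IsScissor Y U → Λ X = Λ U + Λ Y)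
    (heig : ∀ (Y E : EqVar S G) (π : E.X ⟶ Y.X) (f : Fin r → κ) (e : Fin r → Gl E.X),
      E.IsHom Y π → IsCoord π e → (∀ g i, pb (E.act g) (e i) = cst _ (χ (f i) g : k) * e i) →
      Θ E = Λ Y) {Y E : EqVar S G} (h : Y.IsAffineLift r E) : Θ E = Λ Y := by
  have := Fintype.ofFinite G
  obtain ⟨π, t, hπ, ht, hact⟩ := h
  have ht' := isCoord_of_isIso ht
  choose α β hα using fun g (i : Fin r) => hact g ⟨i⟩
  let α' (g : G) : Matrix (Fin r) (Fin r) (Gl Y.X) := .of fun i j => α g i ⟨j⟩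
  have hα' (g) (i : Fin r) : pb (E.act g) (t ⟨i⟩) =
      pb π (β g i) + ∑ j : Fin r, pb π (α' g i j) * t ⟨j⟩ := by
    refine (hα g i).trans (congr(_ + $(?_)))
    exact (Fintype.sum_equiv Equiv.ulift.{u}.symm _ _ fun _ => rfl).symm
  have hα1 : α' 1 = 1 := by
    refine Matrix.ext fun i => congr_fun (ht'.coeff_unique (b := β 1 i) (b' := 0) ?_)
    rw [← hα', E.act_one, pb_id, map_zero, zero_add, Finset.sum_eq_single i]
    · simp
    · intro j _ hj
      simp [Matrix.one_apply_ne' hj]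
    · simp
  let N : k := (Nat.card G : k)⁻¹
  have hN : N * (Nat.card G : k) = 1 := inv_mul_cancel₀ (Nat.cast_ne_zero.2 Nat.card_pos.ne')
  -- The projector to the isotypic part of the character `x`, applied to the coordinates: `e x i` is
  -- that component of the `i`-th coordinate, and `a x`, `b x` are its coefficients.
  let a (x : κ) : Matrix (Fin r) (Fin r) (Gl Y.X) :=
    .of fun i j => ∑ g, cst Y.X (N * (χ x g⁻¹ : k)) * α' g i j
  let b (x : κ) (i : Fin r) : Gl Y.X := ∑ g, cst Y.X (N * (χ x g⁻¹ : k)) * β g i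
  let e (x : κ) (i : Fin r) : Gl E.X := ∑ g, cst E.X (N * (χ x g⁻¹ : k)) * pb (E.act g) (t ⟨i⟩)
  -- The components sum to the coordinates: by orthogonality of the characters only `g = 1`
  -- survives, with coefficient matrix 1.
  have ha : ∑ x, a x = 1 := by
    refine Matrix.ext fun i j => ?_
    rw [Matrix.sum_apply]
    change ∑ x, ∑ g, cst Y.X (N * (χ x g⁻¹ : k)) * α' g i j = _
    rw [Finset.sum_comm]
    simp only [← Finset.sum_mul, ← map_sum, ← Finset.mul_sum]
    rw [Finset.sum_eq_single 1]
    · simp only [inv_one, map_one, Units.val_one, Finset.sum_const, Finset.card_univ, hχ₁,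
        nsmul_eq_mul, mul_one, hN, one_mul]
      rw [hα1]
    · intro g _ hg
      rw [hχ _ (by simpa using hg), mul_zero, map_zero, zero_mul]
    · simp
  classical
  refine eq_of_sum_det_eq_one hΘ hΛ heig Finset.univ Y E π (fun i => t ⟨i⟩) e a b α' β hπ ht' ?_ ?_
    hα' ?_
  · intro x i
    simp only [e, a, b, hα', map_sum, map_mul, pb_cst, mul_add, Finset.sum_add_distrib,
      Matrix.of_apply, Finset.sum_mul, Finset.mul_sum, mul_assoc]
    rw [Finset.sum_comm]
  · intro g x i
    simp only [e, map_sum, map_mul, pb_cst, ← pb_comp, ← E.act_mul, Finset.mul_sum, ← mul_assoc]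
    refine Fintype.sum_equiv (Equiv.mulLeft g) _ _ fun g' => ?_
    rw [Equiv.coe_mulLeft, mul_inv_rev, map_mul, Units.val_mul]
    change _ = _ * pb (E.act (g * g')) (t ⟨i⟩)
    congr 1
    simp only [← map_mul]
    congr 1
    have : (χ x g : k) * (χ x g⁻¹ : k) = 1 := by rw [← Units.val_mul, ← map_mul]; simp
    linear_combination (-N * (χ x g'⁻¹ : k)) * this
  -- Expand the determinant of `∑ x, a x` row by row: the terms are indexed by the choices of a
  -- character for every row.
  · have := (Matrix.detRowAlternating (n := Fin r) (R := Gl Y.X)).toMultilinearMap.map_sum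
      fun i x => a x i
    refine this.symm.trans ?_
    change Matrix.det _ = 1
    rw [← Matrix.det_one (n := Fin r), ← ha]
    congr 1
    ext i j
    rw [Matrix.sum_apply, Finset.sum_apply]

end bundle

/-! ### The map `Ψ` -/

section psi

variable {k : Type u} [Field k] [IsAlgClosed k] {S : Sch k} {n : ℕ} [NeZero n]

theorem surjective_snd (G H : Type*) [Group G] [Group H] :
    Function.Surjective (MonoidHom.snd G H) := Prod.snd_surjective

variable (k) in
/-- The character `(s, t) ↦ sᵃ tᵇ`. -/
def powChar (x : Fin n × Fin n) : RootPair n k →* kˣ :=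
  (powMonoidHom x.1.1).comp ((rootsOfUnity n k).subtype.comp (MonoidHom.fst _ _)) *
    (powMonoidHom x.2.1).comp ((rootsOfUnity n k).subtype.comp (MonoidHom.snd _ _))

omit [IsAlgClosed k] [NeZero n] in
theorem powChar_apply (x : Fin n × Fin n) (g : RootPair n k) :
    (powChar k x g : k) = ((g.1 : kˣ) : k) ^ x.1.1 * ((g.2 : kˣ) : k) ^ x.2.1 := rfl

omit [IsAlgClosed k] in
theorem sum_powChar (g : RootPair n k) (hg : g ≠ 1) : ∑ x, (powChar k x g : k) = 0 := by
  have h : ∑ x, (powChar k x g : k) = (∑ i ∈ Finset.range n, ((g.1 : kˣ) : k) ^ i) *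
      ∑ i ∈ Finset.range n, ((g.2 : kˣ) : k) ^ i := by
    simp only [powChar_apply, Fintype.sum_prod_type, Finset.sum_mul_sum, Finset.sum_range]
  rw [h]
  by_cases h1 : g.1 = 1
  · rw [sum_pow_root g.2 fun h2 => hg (Prod.ext h1 h2), mul_zero]
  · rw [sum_pow_root g.1 h1, zero_mul]

variable [CharZero k]

theorem card_rootPair : Fintype.card (Fin n × Fin n) = Nat.card (RootPair n k) := by
  rw [Nat.card_prod, HasEnoughRootsOfUnity.natCard_rootsOfUnity, Fintype.card_prod,
    Fintype.card_fin]

/-- The balanced product of an affine bundle with eigencoordinates. -/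
theorem quo_tw_of_eigen {r : ℕ} {Y E : EqVar S (RootPair n k)} {π : E.X ⟶ Y.X} (hπ : E.IsHom Y π)
    {e : Fin r → Gl E.X} (h : IsCoord π e) {f : Fin r → Fin n × Fin n}
    (he : ∀ g i, pb (E.act g) (e i) = cst _ (powChar k (f i) g : k) * e i)
    (F : EqVar (𝟙_ (Sch k)) (RootPair n k)) {x y : Gl F.X} (hx : IsUnit x) (hy : IsUnit y)
    (hx' : ∀ g, pb (F.act g) x = cst _ ((g.1 : kˣ) : k) * x)
    (hy' : ∀ g, pb (F.act g) y = cst _ ((g.2 : kˣ) : k) * y) :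
    quo (MonoidHom.snd (RootPair n k) (rootsOfUnity n k)) (surjective_snd _ _)
      (tw (balHom k n) E F) = lefschetz S _ r (quo (MonoidHom.snd (RootPair n k) _)
        (surjective_snd _ _) (tw (balHom k n) Y F)) := by
  -- If `e i` has weight `sᵃ tᵇ`, multiply it by `xᵃ yᵇ`. The group acts on `F` through `(s⁻¹ q, t⁻¹
  -- q)`, so the product has weight `q^(a+b)`, which factors through the residual group. As `m i` is
  -- a unit, the products are again coordinates.
  let m (i : Fin r) : Gl F.X := x ^ (f i).1.1 * y ^ (f i).2.1
  have hm (i) : IsUnit (m i) := (hx.pow _).mul (hy.pow _)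
  have hm' (s t q : rootsOfUnity n k) (i) : cst F.X (powChar k (f i) (s, t) : k) *
      pb (F.act (s⁻¹ * q, t⁻¹ * q)) (m i) = cst F.X (((q : kˣ) : k) ^ ((f i).1.1 + (f i).2.1)) * m i := by
    have hs : cst F.X ((s : kˣ) : k) * cst F.X (((s⁻¹ * q : rootsOfUnity n k) : kˣ) : k) = cst F.X ((q : kˣ) : k) := by
      rw [← map_mul]
      congr 1
      exact congr((($(mul_inv_cancel_left s q) : kˣ) : k))
    have ht : cst F.X ((t : kˣ) : k) * cst F.X (((t⁻¹ * q : rootsOfUnity n k) : kˣ) : k) = cst F.X ((q : kˣ) : k) := by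
      rw [← map_mul]
      congr 1
      exact congr((($(mul_inv_cancel_left t q) : kˣ) : k))
    simp only [m, powChar_apply, map_mul, map_pow, hx', hy', pow_add]
    nth_rw 1 [← hs]
    rw [← ht]
    ring
  clear_value m
  refine quo_of_eigen (f := π ▷ F.X) (surjective_snd _ _) ⟨?_, fun g => ?_⟩
    (e := fun i => pb (fst E.X F.X) (e i) * pb (snd E.X F.X) (m i)) ?_
    (MonoidHom.pi fun i => (powMonoidHom ((f i).1.1 + (f i).2.1)).comp
      (rootsOfUnity n k).subtype) ?_
  · change π ▷ F.X ≫ (Y.p ⊗ₘ F.p) ≫ (ρ_ S).hom = (E.p ⊗ₘ F.p) ≫ (ρ_ S).hom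
    simp [rightUnitor_hom, hπ.comm]
  · change (E.act _ ⊗ₘ F.act _) ≫ π ▷ F.X = π ▷ F.X ≫ (Y.act _ ⊗ₘ F.act _)
    ext <;> simp [hπ.equivariant]
  · refine (h.whiskerRight F.X).affine_change (b := 0)
      (a := Matrix.diagonal fun i => pb (snd Y.X F.X) (m i)) (fun i => ?_) ?_
    · rw [Finset.sum_eq_single i]
      · rw [Matrix.diagonal_apply_eq, ← pb_comp, whiskerRight_snd]
        rw [Pi.zero_apply, map_zero, zero_add, mul_comm]
      · intro j _ hj
        rw [Matrix.diagonal_apply_ne' _ hj, map_zero, zero_mul]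
      · exact fun h => (h (Finset.mem_univ _)).elim
    · rw [Matrix.det_diagonal, IsUnit.prod_univ_iff]
      exact fun i => (hm i).map _
  · rintro ⟨⟨s, t⟩, q⟩ i
    change pb (E.act (s, t) ⊗ₘ F.act (s⁻¹ * q, t⁻¹ * q)) (pb (fst E.X F.X) (e i) *
      pb (snd E.X F.X) (m i)) = cst _ (((q : kˣ) : k) ^ ((f i).1.1 + (f i).2.1)) * _
    rw [map_mul, ← pb_comp, ← pb_comp, tensorHom_fst, tensorHom_snd, pb_comp, pb_comp, he]
    have := congr(pb (snd E.X F.X) $(hm' s t q i))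
    rw [map_mul, map_mul, pb_cst, pb_cst] at this
    rw [map_mul, pb_cst]
    linear_combination (pb (fst E.X F.X) (e i)) * this

variable (n) (c : k)

/-- The class of the balanced product. -/
def balClass (Z : EqVar S (RootPair n k)) : K0 S (rootsOfUnity n k) :=
  quo (MonoidHom.snd (RootPair n k) _) (surjective_snd _ _) (bal n c Z)

variable {n c}

theorem IsBalancedProduct.mk_eq {Z : EqVar S (RootPair n k)} {Q : EqVar S (rootsOfUnity n k)}
    (h : IsBalancedProduct n c Z Q) : K0.mk Q = balClass n c Z :=
  (quo_eq _ ((isBalancedProduct_iff n c Z Q).1 h)).symm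

variable (n c) in
theorem exists_isBalancedProduct (Z : EqVar S (RootPair n k)) : ∃ Q, IsBalancedProduct n c Z Q := by
  obtain ⟨Q, hQ⟩ := exists_isQuot (π := MonoidHom.snd (RootPair n k) (rootsOfUnity n k))
    (surjective_snd _ _) (bal n c Z)
  exact ⟨Q, (isBalancedProduct_iff n c Z Q).2 hQ⟩

theorem balClass_iso {Z Z' : EqVar S (RootPair n k)} (h : Z.Iso Z') :
    balClass n c Z = balClass n c Z' :=
  quo_iso _ (tw_iso_left _ h _)

theorem balClass_scissor {X Y U : EqVar S (RootPair n k)} (h : X.IsScissor Y U) :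
    balClass n c X = balClass n c U + balClass n c Y :=
  quo_scissor _ (tw_scissor_left _ h _)

/-- The right-hand side involves only `Y` and `r`, so any two affine liftings have the same image
and Ψ is well defined. -/
theorem balClass_affine {r : ℕ} {Y E : EqVar S (RootPair n k)} (h : Y.IsAffineLift r E) :
    balClass n c E = lefschetz S _ r (balClass n c Y) := by
  refine eq_of_isAffineLift (Θ := balClass n c) (Λ := fun Y => lefschetz S _ r (balClass n c Y))
    (card_rootPair (k := k)) sum_powChar (fun _ _ _ => balClass_scissor)
    (fun _ _ _ h => by rw [balClass_scissor h, map_add]) (fun Y E π f e hπ he he' => ?_) h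
  have hF := torusAct_fermatVar n c
  exact quo_tw_of_eigen hπ he he' (fermatVar n c) (hF.rep.unit 0) (hF.rep.unit 1)
    (fun g => hF.act g 0) fun g => hF.act g 1

variable (n c) in
/-- The morphism induced by the balanced product. -/
def balHomK0 : K0 S (RootPair n k) →+ K0 S (rootsOfUnity n k) :=
  K0.lift (balClass n c) (fun _ _ => balClass_iso) (fun _ _ _ => balClass_scissor)
    fun _ _ _ _ h h' => (balClass_affine h).trans (balClass_affine h').symm

theorem balClass_smul (R : EqVar (𝟙_ (Sch k)) Unit) (Z : EqVar S (RootPair n k)) :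
    balClass n c (R.smul Z) = K0.mk R • balClass n c Z := by
  rw [balClass, balClass, ← quo_smul]
  refine quo_iso _ ⟨α_ R.X Z.X _, ?_, fun g => ?_⟩
  · ext; simp [leftUnitor_hom, rightUnitor_hom]
  · ext <;> simp

variable (S n) in
/-- The map `Ψ`. -/
def psi : K0 S (RootPair n k) →ₗ[K0Var k] K0 S (rootsOfUnity n k) :=
  { -balHomK0 n (1 : k) + balHomK0 n (0 : k) with
    map_smul' := fun r a => by
      have key (c : k) : balHomK0 n c (r • a) = r • balHomK0 n c a := by
        change balHomK0 n c (K0.smulHom r a) = K0.smulHom r (balHomK0 n c a)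
        induction r using K0.induction with
        | zero => simp
        | add x y hx hy => simp only [map_add, AddMonoidHom.add_apply, hx, hy]
        | neg x hx => simp only [map_neg, AddMonoidHom.neg_apply, hx]
        | mk R =>
        induction a using K0.induction with
        | zero => simp
        | add x y hx hy => simp only [map_add, hx, hy]
        | neg x hx => simp only [map_neg, hx]
        | mk A =>
        rw [K0.smulHom_mk]
        simp only [balHomK0, K0.lift_mk]
        exact balClass_smul R A
      change -balHomK0 n 1 (r • a) + balHomK0 n 0 (r • a) =
        r • (-balHomK0 n 1 a + balHomK0 n 0 a)
      rw [key, key, smul_add, smul_neg] }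

theorem psi_mk (Z : EqVar S (RootPair n k)) :
    psi S n (K0.mk Z) = -balClass n 1 Z + balClass n 0 Z := by
  change -balHomK0 n 1 (K0.mk Z) + balHomK0 n 0 (K0.mk Z) = _
  simp only [balHomK0, K0.lift_mk]

theorem isPsi_psi : IsPsi (S := S) n (psi S n) := by
  intro Z Q₁ Q₀ h₁ h₀
  rw [psi_mk, h₁.mk_eq, h₀.mk_eq]

theorem IsPsi.eq_psi {Ψ : K0 S (RootPair n k) →ₗ[K0Var k] K0 S (rootsOfUnity n k)}
    (h : IsPsi n Ψ) : Ψ = psi S n := by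
  suffices Ψ.toAddMonoidHom = (psi S n).toAddMonoidHom from LinearMap.ext fun x => congr($this x)
  refine K0.hom_ext fun Z => ?_
  obtain ⟨Q₁, h₁⟩ := exists_isBalancedProduct n (1 : k) Z
  obtain ⟨Q₀, h₀⟩ := exists_isBalancedProduct n (0 : k) Z
  exact (h Z _ _ h₁ h₀).trans (isPsi_psi Z _ _ h₁ h₀).symm

end psi

/-! ### Gluing over the points of the group of roots of unity -/

section glue

variable {k : Type u} [Field k] {X Y : Sch k}

theorem isEmpty_of_zero_eq_one {T : Sch k} (h : (0 : Gl T) = 1) : IsEmpty T.left := by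
  have h2 : T.left.basicOpen 0 = T.left.basicOpen 1 := congr(T.left.basicOpen $h)
  rw [Scheme.basicOpen_zero, Scheme.basicOpen_of_isUnit _ isUnit_one] at h2
  exact ⟨fun x => (h2.ge (Set.mem_univ x) : x ∈ (⊥ : T.left.Opens)).elim⟩

/-- The open cover given by functions with sum one. -/
def coverOfSum {ι : Type*} [Fintype ι] {D : ι → Sch k} {j : ∀ i, D i ⟶ X} {e : ι → Gl X}
    (hD : ∀ i, IsNonvanishing (j i) (e i)) (he : ∑ i, e i = 1) : X.left.OpenCover where
  I₀ := ι
  X i := (D i).left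
  f i := (j i).left
  mem₀ := by
    rw [Scheme.presieve₀_mem_precoverage_iff]
    refine ⟨fun x => ?_, fun i => (hD i).spec.choose⟩
    by_contra! hx
    have h1 (i) : ¬ IsUnit (X.left.presheaf.germ ⊤ x trivial (e i)) := by
      rw [← Scheme.mem_basicOpen_top, ← (hD i).spec.choose_spec]
      exact hx i
    have h2 : ∑ i, X.left.presheaf.germ ⊤ x trivial (e i) = 1 := by
      rw [← map_sum, he, map_one]
    exact (IsLocalRing.maximalIdeal.isMaximal _).ne_top ((Ideal.eq_top_iff_one _).2
      (h2 ▸ Ideal.sum_mem _ fun i _ => (IsLocalRing.mem_maximalIdeal _).2 (h1 i)))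

theorem hom_ext_of_sum {ι : Type*} [Fintype ι] {D : ι → Sch k} {j : ∀ i, D i ⟶ X} {e : ι → Gl X}
    (hD : ∀ i, IsNonvanishing (j i) (e i)) (he : ∑ i, e i = 1) {f f' : X ⟶ Y}
    (h : ∀ i, j i ≫ f = j i ≫ f') : f = f' := by
  ext1
  exact (coverOfSum hD he).hom_ext _ _ fun i => congr(($(h i)).left)

theorem exists_glue {ι : Type*} [Fintype ι] {D : ι → Sch k} {j : ∀ i, D i ⟶ X} {e : ι → Gl X}
    (hD : ∀ i, IsNonvanishing (j i) (e i)) (he : ∑ i, e i = 1) (f : ∀ i, D i ⟶ Y)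
    (hf : ∀ (T : Sch k) (a b : ι) (g : T ⟶ D a) (g' : T ⟶ D b), g ≫ j a = g' ≫ j b →
      g ≫ f a = g' ≫ f b) : ∃ θ : X ⟶ Y, ∀ i, j i ≫ θ = f i := by
  let 𝒰 := coverOfSum hD he
  let m : X.left ⟶ Y.left := 𝒰.glueMorphisms (fun i => (f i).left) fun a b => by
    let p₁ : pullback (j a).left (j b).left ⟶ (D a).left := pullback.fst _ _
    let p₂ : pullback (j a).left (j b).left ⟶ (D b).left := pullback.snd _ _
    have hp : p₁ ≫ (j a).left = p₂ ≫ (j b).left := pullback.condition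
    let T : Sch k := Over.mk (p₁ ≫ (D a).hom)
    let g : T ⟶ D a := Over.homMk p₁ rfl
    let g' : T ⟶ D b := Over.homMk p₂ (by
      change p₂ ≫ (D b).hom = p₁ ≫ (D a).hom
      rw [← Over.w (j b), ← Over.w (j a), reassoc_of% hp])
    have hg : g ≫ j a = g' ≫ j b := by
      ext1
      exact hp
    exact congr(($(hf T a b g g' hg)).left)
  have hm (i) : (j i).left ≫ m = (f i).left := 𝒰.ι_glueMorphisms _ _ i
  refine ⟨Over.homMk m (𝒰.hom_ext _ _ fun i => ?_), fun i => ?_⟩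
  · change (j i).left ≫ m ≫ Y.hom = (j i).left ≫ X.hom
    rw [reassoc_of% (hm i), Over.w, Over.w]
  · ext1
    exact hm i

theorem hom_ext_of_isEmpty {T : Sch k} (h : IsEmpty T.left) (f g : T ⟶ Y) : f = g := by
  ext1
  exact isInitialOfIsEmpty.hom_ext _ _

variable {n : ℕ} [NeZero n]

/-! ### Idempotents attached to a root of unity in a ring -/

section idem

variable {R R' : Type*} [CommRing R] [CommRing R'] (φ : k →+* R) (v : R)

/-- The idempotent of the locus where `v = ζ`. -/
def rootIdem (ζ : rootsOfUnity n k) : R :=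
  φ (n : k)⁻¹ * ∑ i ∈ Finset.range n, (φ ((ζ⁻¹ : kˣ) : k) * v) ^ i

variable {φ v}

omit [NeZero n] in
theorem mul_rootIdem (hv : v ^ n = 1) (ζ : rootsOfUnity n k) :
    v * rootIdem φ v ζ = φ ((ζ : kˣ) : k) * rootIdem φ v ζ := by
  have h1 : φ ((ζ : kˣ) : k) * φ ((ζ⁻¹ : kˣ) : k) = 1 := by
    rw [← map_mul, ← Units.val_mul, mul_inv_cancel, Units.val_one, map_one]
  have h2 : (φ ((ζ⁻¹ : kˣ) : k) * v) ^ n = 1 := by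
    have := root_smul_pow φ ζ⁻¹ v
    rw [hv] at this
    exact this
  have h3 := geom_sum_mul (φ ((ζ⁻¹ : kˣ) : k) * v) n
  rw [h2, sub_self] at h3
  rw [rootIdem]
  linear_combination φ (n : k)⁻¹ * φ ((ζ : kˣ) : k) * h3 - φ (n : k)⁻¹ * v *
    (∑ i ∈ Finset.range n, (φ ((ζ⁻¹ : kˣ) : k) * v) ^ i) * h1

variable [CharZero k]

theorem map_rootIdem (f : R →+* R') (ζ : rootsOfUnity n k) (h : f v = f (φ ((ζ : kˣ) : k))) :
    f (rootIdem φ v ζ) = 1 := by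
  have h1 : φ ((ζ⁻¹ : kˣ) : k) * φ ((ζ : kˣ) : k) = 1 := by
    rw [← map_mul, ← Units.val_mul, inv_mul_cancel, Units.val_one, map_one]
  have h2 : f (φ ((ζ⁻¹ : kˣ) : k) * v) = 1 := by
    rw [map_mul, h, ← map_mul, h1, map_one]
  have h3 : (n : k)⁻¹ * n = 1 := inv_mul_cancel₀ (Nat.cast_ne_zero.2 (NeZero.ne n))
  rw [rootIdem, map_mul, map_sum]
  simp only [map_pow, h2, one_pow, Finset.sum_const, Finset.card_range, nsmul_eq_mul, mul_one]
  rw [← map_natCast (f.comp φ), ← RingHom.comp_apply f φ, ← map_mul, h3, map_one]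

/-- The coefficient of `vⁱ` is a sum of `i`-th powers of all roots of unity, zero unless `i = 0`. No
equation for `v` is needed. -/
theorem sum_rootIdem [IsAlgClosed k] [Fintype (rootsOfUnity n k)] :
    ∑ ζ : rootsOfUnity n k, rootIdem φ v ζ = 1 := by
  have h3 : (n : k)⁻¹ * n = 1 := inv_mul_cancel₀ (Nat.cast_ne_zero.2 (NeZero.ne n))
  obtain ⟨ξ, hξ⟩ := exists_primitive n k
  simp only [rootIdem, ← Finset.mul_sum]
  rw [Finset.sum_comm, Finset.sum_eq_single 0]
  · simp only [pow_zero, Finset.sum_const, Finset.card_univ, nsmul_eq_mul, mul_one]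
    rw [← Nat.card_eq_fintype_card, HasEnoughRootsOfUnity.natCard_rootsOfUnity, ← map_natCast φ,
      ← map_mul, h3, map_one]
  · intro i hi hi0
    simp only [mul_pow]
    rw [← Finset.sum_mul]
    simp only [← map_pow]
    rw [← map_sum]
    suffices ∑ ζ : rootsOfUnity n k, ((ζ⁻¹ : kˣ) : k) ^ i = 0 by rw [this, map_zero, zero_mul]
    have h4 : ((ξ : kˣ) : k) ^ i ≠ 1 := fun h =>
      hξ.pow_ne_one_of_pos_of_lt hi0 (Finset.mem_range.1 hi) h
    have h5 : ((ξ : kˣ) : k) ^ i * ∑ ζ : rootsOfUnity n k, ((ζ⁻¹ : kˣ) : k) ^ i =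
        ∑ ζ : rootsOfUnity n k, ((ζ⁻¹ : kˣ) : k) ^ i := by
      rw [Finset.mul_sum]
      refine Fintype.sum_equiv (Equiv.mulLeft ξ⁻¹) _ _ fun ζ => ?_
      rw [← mul_pow]
      congr 1
      simp [mul_comm]
    exact (mul_left_eq_self₀.1 h5).resolve_left h4
  · intro h
    exact (h (Finset.mem_range.2 (NeZero.pos n))).elim

end idem

variable [IsAlgClosed k] [CharZero k] {v : Gl X}

/-- A function with `vⁿ = 1` cuts `X` into the disjoint open loci `v = ζ`, so morphisms can be
compared, and in `exists_hom_of_roots` constructed, locus by locus. -/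
theorem hom_ext_of_roots (hv : v ^ n = 1) {f f' : X ⟶ Y}
    (h : ∀ (T : Sch k) (g : T ⟶ X) (ζ : rootsOfUnity n k), pb g v = cst T ((ζ : kˣ) : k) →
      g ≫ f = g ≫ f') : f = f' := by
  have := Fintype.ofFinite (rootsOfUnity n k)
  choose D j hD using fun ζ : rootsOfUnity n k => exists_isNonvanishing (rootIdem (cst X) v ζ)
  refine hom_ext_of_sum hD sum_rootIdem fun ζ => h _ _ ζ ?_
  have := congr(pb (j ζ) $(mul_rootIdem (φ := cst X) hv ζ))
  rw [map_mul, map_mul, pb_cst] at this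
  exact (hD ζ).unit.mul_right_cancel this

theorem exists_hom_of_roots (hv : v ^ n = 1) (f : rootsOfUnity n k → (X ⟶ Y)) :
    ∃ θ : X ⟶ Y, ∀ (T : Sch k) (g : T ⟶ X) (ζ : rootsOfUnity n k),
      pb g v = cst T ((ζ : kˣ) : k) → g ≫ θ = g ≫ f ζ := by
  have := Fintype.ofFinite (rootsOfUnity n k)
  choose D j hD using fun ζ : rootsOfUnity n k => exists_isNonvanishing (rootIdem (cst X) v ζ)
  have hj (ζ) : pb (j ζ) v = cst _ ((ζ : kˣ) : k) := by
    have := congr(pb (j ζ) $(mul_rootIdem (φ := cst X) hv ζ))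
    rw [map_mul, map_mul, pb_cst] at this
    exact (hD ζ).unit.mul_right_cancel this
  obtain ⟨θ, hθ⟩ := exists_glue hD sum_rootIdem (fun ζ => j ζ ≫ f ζ) fun T a b g g' e => by
    by_cases hab : a = b
    · subst hab
      rw [reassoc_of% e]
    · refine hom_ext_of_isEmpty (isEmpty_of_zero_eq_one ?_) _ _
      have h1 : cst T (((a : kˣ) : k) - ((b : kˣ) : k)) = 0 := by
        rw [map_sub, sub_eq_zero, ← pb_cst g, ← pb_cst g', ← hj, ← hj, ← pb_comp, ← pb_comp, e]
      have h2 : ((a : kˣ) : k) - ((b : kˣ) : k) ≠ 0 :=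
        sub_ne_zero.2 fun h => hab (Subtype.ext (Units.ext h))
      have h3 := (isUnit_iff_ne_zero.2 h2).map (cst T)
      rw [h1] at h3
      exact isUnit_zero_iff.1 h3
  refine ⟨θ, fun T g ζ hg => ?_⟩
  obtain ⟨l, rfl⟩ := (hD ζ).lift T g <| by
    rw [map_rootIdem (pb g) ζ (by rw [hg, pb_cst])]
    exact isUnit_one
  rw [Category.assoc, hθ, Category.assoc]

end glue

/-! ### Unit and commutativity -/

section unit

variable {k : Type u} [Field k] [IsAlgClosed k] [CharZero k] {S T : Sch k} {n : ℕ} [NeZero n]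

variable (k n) in
/-- The morphism `(t, r) ↦ (t, t⁻¹ r)`. -/
def shear : RootPair n k →* RootPair n k where
  toFun x := (x.1, x.1⁻¹ * x.2)
  map_one' := by simp
  map_mul' x y := by ext <;> simp; ring

variable (k n) in
/-- The morphism `(t, r) ↦ (r, t⁻¹ r)`. -/
def coshear : RootPair n k →* RootPair n k where
  toFun x := (x.2, x.1⁻¹ * x.2)
  map_one' := by simp
  map_mul' x y := by ext <;> simp; ring

/-- The isomorphism `(z, ζ) ↦ (z ζ, ζ)`. -/
theorem tw_shear_iso (Z : EqVar S (rootsOfUnity n k)) {M : EqVar (𝟙_ (Sch k)) (rootsOfUnity n k)}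
    {v : Gl M.X} (hv : v ^ n = 1) (hM : ∀ t, pb (M.act t) v = cst M.X ((t : kˣ) : k) * v) :
    (tw (shear k n) Z M).Iso (tw (coshear k n) Z M) := by
  let V : Sch k := Z.X ⊗ M.X
  let w : Gl V := pb (snd Z.X M.X) v
  have hw : w ^ n = 1 := by rw [← map_pow, hv, map_one]
  -- The morphism `(z, ζ) ↦ z ζ`, glued from the actions of the individual roots of unity. Since `t
  -- · (t⁻¹ r ζ) = ζ r`, it turns the action of `t` on `Z` into that of `r`.
  obtain ⟨θ, hθ⟩ := exists_hom_of_roots hw fun ζ => fst Z.X M.X ≫ Z.act ζ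
  obtain ⟨θ', hθ'⟩ := exists_hom_of_roots hw fun ζ => fst Z.X M.X ≫ Z.act ζ⁻¹
  have hlift (m : V ⟶ Z.X) {T : Sch k} {g : T ⟶ V} {ζ : rootsOfUnity n k}
      (hg : pb g w = cst T ((ζ : kˣ) : k)) :
      pb (g ≫ lift m (snd Z.X M.X)) w = cst T ((ζ : kˣ) : k) := by
    change pb _ (pb _ v) = _
    rw [← pb_comp, Category.assoc, lift_snd, pb_comp]
    exact hg
  have e1 : lift θ (snd Z.X M.X) ≫ θ' = fst Z.X M.X := by
    refine hom_ext_of_roots hw fun T g ζ hg => ?_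
    rw [← Category.assoc, hθ' T _ ζ (hlift θ hg), Category.assoc, lift_fst_assoc,
      ← Category.assoc, hθ T g ζ hg, Category.assoc, Category.assoc, ← Z.act_mul, mul_inv_cancel,
      Z.act_one, Category.comp_id]
  have e2 : lift θ' (snd Z.X M.X) ≫ θ = fst Z.X M.X := by
    refine hom_ext_of_roots hw fun T g ζ hg => ?_
    rw [← Category.assoc, hθ T _ ζ (hlift θ' hg), Category.assoc, lift_fst_assoc,
      ← Category.assoc, hθ' T g ζ hg, Category.assoc, Category.assoc, ← Z.act_mul, inv_mul_cancel,
      Z.act_one, Category.comp_id]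
  refine ⟨⟨lift θ (snd Z.X M.X), lift θ' (snd Z.X M.X), ?_, ?_⟩, ?_, ?_⟩
  · change lift θ (snd Z.X M.X) ≫ lift θ' (snd Z.X M.X) = 𝟙 (Z.X ⊗ M.X)
    rw [comp_lift, e1, lift_snd, lift_fst_snd]
  · change lift θ' (snd Z.X M.X) ≫ lift θ (snd Z.X M.X) = 𝟙 (Z.X ⊗ M.X)
    rw [comp_lift, e2, lift_snd, lift_fst_snd]
  · change lift θ (snd Z.X M.X) ≫ (Z.p ⊗ₘ M.p) ≫ (ρ_ S).hom = (Z.p ⊗ₘ M.p) ≫ (ρ_ S).hom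
    rw [rightUnitor_hom, tensorHom_fst, lift_fst_assoc]
    refine hom_ext_of_roots hw fun T g ζ hg => ?_
    rw [← Category.assoc, hθ T g ζ hg, Category.assoc, Category.assoc, Z.act_p]
  · rintro ⟨t, r⟩
    change (Z.act t ⊗ₘ M.act (t⁻¹ * r)) ≫ lift θ (snd Z.X M.X) =
      lift θ (snd Z.X M.X) ≫ (Z.act r ⊗ₘ M.act (t⁻¹ * r))
    rw [comp_lift, lift_map, tensorHom_snd]
    congr 1
    refine hom_ext_of_roots hw fun T g ζ hg => ?_
    have h1 : pb (g ≫ (Z.act t ⊗ₘ M.act (t⁻¹ * r))) w =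
        cst T (((t⁻¹ * r * ζ : rootsOfUnity n k) : kˣ) : k) := by
      change pb _ (pb _ v) = _
      rw [← pb_comp, Category.assoc, tensorHom_snd, pb_comp, pb_comp, hM, map_mul, map_mul,
        pb_cst, pb_cst]
      refine (congrArg (_ * ·) hg).trans ?_
      rw [← map_mul]
      rfl
    rw [← Category.assoc, hθ T _ _ h1, Category.assoc, tensorHom_fst_assoc, ← Category.assoc g θ,
      hθ T g ζ hg, Category.assoc, Category.assoc, ← Z.act_mul, ← Z.act_mul]
    congr 3
    rw [mul_assoc, mul_inv_cancel_left, mul_comm]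

/-- The balanced product of a variety on which the first factor acts trivially. -/
theorem balClass_res_snd (c : k) (Z : EqVar S (rootsOfUnity n k)) :
    balClass n c (Z.res (MonoidHom.snd _ _)) = quo (MonoidHom.snd _ _) (surjective_snd _ _)
      (tw (shear k n) Z (fermatQuot n c)) := by
  -- Divide first by the factor that does not move `Z`: only the curve changes, and it becomes `w +
  -- yⁿ = c`.
  let ρ : RootTriple n k →* RootPair n k :=
    ((MonoidHom.snd _ _).comp (MonoidHom.fst _ _)).prod (MonoidHom.snd _ _)
  have h : IsQuot ρ (tw (((MonoidHom.snd _ _).prodMap (MonoidHom.id _)).comp (balHom k n)) Z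
      (fermatVar n c)) (tw (shear k n) Z (fermatQuot n c)) := by
    refine isQuot_tw_right Z (isQuot_fermatVar n c) _ _ ρ (fun x => rfl) ?_
    rintro ⟨a, b⟩ (rfl : b = 1)
    exact ⟨((a⁻¹, 1), 1), rfl, by simp [balHom]⟩
  exact quo_comp (π := ρ) (fun x => ⟨((1, x.1), x.2), rfl⟩) h _ (surjective_snd _ _) _
    (surjective_snd _ _) fun _ => rfl

/-- After division by the trivially acting factor, both terms of Ψ are the class for 𝔾ₘ minus the
class for `yⁿ = c`. The first part cancels; `yⁿ = 0` is empty in the torus, and `yⁿ = 1` is a torsor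
under μ_n, which contributes `Z` after the shear. -/
theorem psi_res_snd (Z : EqVar S (rootsOfUnity n k)) :
    psi S n (K0.mk (Z.res (MonoidHom.snd _ _))) = K0.mk Z := by
  have hsc (c : k) := quo_tw_scissor (surjective_snd (rootsOfUnity n k) (rootsOfUnity n k))
    (shear k n) Z (gmVar_isScissor n c)
  rw [psi_mk, balClass_res_snd, balClass_res_snd]
  have h0 : quo (MonoidHom.snd _ _) (surjective_snd _ _) (tw (shear k n) Z (rootVar n 0)) = 0 := by
    refine quo_of_isEmpty _ ?_
    have hM := torusAct_rootVar n (0 : k)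
    have h1 := (eqM_iff ..).1 hM.rep.eqn
    rw [map_zero] at h1
    have h2 : IsEmpty (rootVar n (0 : k)).X.left := by
      refine isEmpty_of_zero_eq_one ?_
      have := (hM.rep.unit 0).pow n
      rw [h1] at this
      exact isUnit_zero_iff.1 this
    exact ⟨fun x => h2.elim ((snd Z.X (rootVar n (0 : k)).X).left x)⟩
  have h1 : quo (MonoidHom.snd _ _) (surjective_snd _ _) (tw (shear k n) Z (rootVar n 1)) =
      K0.mk Z := by
    have hM := torusAct_rootVar n (1 : k)
    have h1 := (eqM_iff ..).1 hM.rep.eqn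
    rw [map_one] at h1
    rw [quo_iso _ (tw_shear_iso Z h1 fun t => hM.act t 0)]
    have h2 : IsQuot (MonoidHom.snd _ _) (tw (coshear k n) Z (rootVar n 1))
        (tw ((MonoidHom.id _).prod 1) Z
          (.triv Unit (𝟙_ (Sch k)) inferInstance (𝟙 (𝟙_ (Sch k))))) := by
      refine isQuot_tw_right Z (isQuot_rootVar_one n) _ _ _ (fun x => rfl) fun d _ => ?_
      exact ⟨(d⁻¹, 1), rfl, by simp [coshear]⟩
    rw [quo_eq _ h2]
    exact K0.mk_iso ⟨ρ_ Z.X, by simp [rightUnitor_hom], fun g => by simp [rightUnitor_hom]⟩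
  have a1 := hsc 1
  have a0 := hsc 0
  rw [h1] at a1
  rw [h0, add_zero] at a0
  rw [← a0, a1]
  abel

omit [CharZero k] in
theorem tw_iso_right {Γ Δ H : Type*} [Group Γ] [Group Δ] [Group H] (φ : H →* Γ × Δ)
    (Z : EqVar S Γ) {B B' : EqVar (𝟙_ (Sch k)) Δ} (h : B.Iso B') :
    (tw φ Z B).Iso (tw φ Z B') :=
  ((tw_swap_iso φ Z B).trans (((h.prod Z).push _).res _)).trans (tw_swap_iso φ Z B').symm

omit [IsAlgClosed k] [CharZero k] in
/-- Subschemes of tori that correspond to each other under a permutation of the coordinates. -/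
theorem TorusAct.iso {σ τ : Type} {Δ : Type*} [Group Δ] {A B : EqVar (𝟙_ (Sch k)) Δ}
    {a : σ → Gl A.X} {b : τ → Gl B.X} {E : Set (MvPolynomial σ k)} {E' : Set (MvPolynomial τ k)}
    {χ : σ → Δ → k} {χ' : τ → Δ → k} (hA : TorusAct A a E χ) (hB : TorusAct B b E' χ')
    (e : τ ≃ σ) (hχ : ∀ i, χ' i = χ (e i))
    (hE : ∀ (R : Type u) [CommRing R] (φ : k →+* R) (x : σ → R),
      (∀ p ∈ E, p.eval₂ φ x = 0) ↔ ∀ p ∈ E', p.eval₂ φ (fun i => x (e i)) = 0) : A.Iso B := by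
  obtain ⟨f, hf⟩ := hB.rep.lift A.X (fun i => a (e i)) (fun _ => hA.rep.unit _)
    ((hE _ _ _).1 hA.rep.eqn)
  obtain ⟨g, hg⟩ := hA.rep.lift B.X (fun i => b (e.symm i)) (fun _ => hB.rep.unit _)
    ((hE _ _ _).2 (by simpa using hB.rep.eqn))
  refine ⟨⟨f, g, hA.rep.ext _ _ _ fun i => ?_, hB.rep.ext _ _ _ fun i => ?_⟩,
    hB.isHom f fun δ i => ?_⟩
  · rw [pb_comp, hg, hf, pb_id, Equiv.apply_symm_apply]
  · rw [pb_comp, hf, hg, pb_id, Equiv.symm_apply_apply]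
  · rw [hf, hA.act, hχ]

omit [IsAlgClosed k] [CharZero k] in
theorem TorusAct.res {σ : Type} {Δ Δ' : Type*} [Group Δ] [Group Δ'] {A : EqVar (𝟙_ (Sch k)) Δ}
    {a : σ → Gl A.X} {E : Set (MvPolynomial σ k)} {χ : σ → Δ → k} (hA : TorusAct A a E χ)
    (φ : Δ' →* Δ) : TorusAct (A.res φ) a E fun i δ => χ i (φ δ) :=
  ⟨hA.rep, fun _ => hA.act _⟩

variable (k n) in
/-- The exchange of the factors. -/
abbrev rootSwap : RootPair n k →* RootPair n k := (MonoidHom.snd _ _).prod (MonoidHom.fst _ _)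

theorem fermatVar_swap_iso (c : k) : (fermatVar n c).Iso ((fermatVar n c).res (rootSwap k n)) := by
  refine (torusAct_fermatVar n c).iso ((torusAct_fermatVar n c).res (rootSwap k n))
    (Equiv.swap 0 1) (Fin.forall_fin_two.2 ⟨rfl, rfl⟩) fun R _ φ x => ?_
  rw [eqF_iff, eqF_iff, Equiv.swap_apply_left, Equiv.swap_apply_right, add_comm]

theorem quo_tw_swap (Z : EqVar S (RootPair n k)) {F : EqVar (𝟙_ (Sch k)) (RootPair n k)}
    (h : F.Iso (F.res (rootSwap k n))) :
    quo (MonoidHom.snd _ _) (surjective_snd _ _) (tw (balHom k n) (Z.res (rootSwap k n)) F) =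
      quo (MonoidHom.snd _ _) (surjective_snd _ _) (tw (balHom k n) Z F) := by
  rw [quo_iso _ (tw_iso_right _ _ h),
    ← quo_res (surjective_snd _ _) (tw (balHom k n) Z F) (MonoidHom.snd _ _) (surjective_snd _ _)
      ((rootSwap k n).prodMap (MonoidHom.id _)) (fun _ => rfl)
      fun x hx => ⟨(x.1.swap, x.2), hx, rfl⟩]
  refine quo_iso _ ⟨Iso.refl _, ⟨Category.id_comp _, fun g => ?_⟩⟩
  rw [Iso.refl_hom, Category.id_comp, Category.comp_id]
  rfl

theorem balClass_swap (c : k) (Z : EqVar S (RootPair n k)) :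
    balClass n c (Z.res (rootSwap k n)) = balClass n c Z :=
  quo_tw_swap Z (fermatVar_swap_iso c)

omit [IsAlgClosed k] [CharZero k] in
theorem A1.swap_add : (β_ (A1 k) (A1 k)).hom ≫ A1.add k = A1.add k := by
  rw [A1.add, A1.comp_ofFun]
  congr 1
  change pb _ (pb _ _ + pb _ _) = pb _ _ + pb _ _
  rw [map_add, ← pb_comp, ← pb_comp, braiding_hom_fst, braiding_hom_snd, add_comm]

/-- The exterior sum of functions. -/
abbrev addProd {Γ Δ : Type*} [Group Γ] [Group Δ] (A : EqVar (A1 k) Γ) (B : EqVar (A1 k) Δ) :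
    EqVar (A1 k) (Γ × Δ) := (A.prod B).push (A1.add k)

omit [CharZero k] in
theorem addProd_swap_iso {Γ Δ : Type*} [Group Γ] [Group Δ] (A : EqVar (A1 k) Γ)
    (B : EqVar (A1 k) Δ) : (addProd A B).Iso
      ((addProd B A).res ((MonoidHom.snd _ _).prod (MonoidHom.fst _ _))) := by
  refine ⟨β_ A.X B.X, ?_, fun g => ?_⟩
  · change (β_ A.X B.X).hom ≫ (B.p ⊗ₘ A.p) ≫ A1.add k = (A.p ⊗ₘ B.p) ≫ A1.add k
    rw [← BraidedCategory.braiding_naturality_assoc, A1.swap_add]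
  · exact BraidedCategory.braiding_naturality _ _

theorem balClass_comm (c : k) (A B : EqVar (A1 k) (rootsOfUnity n k)) :
    balClass n c (addProd A B) = balClass n c (addProd B A) := by
  rw [balClass_iso (addProd_swap_iso A B)]
  exact balClass_swap c _

omit [IsAlgClosed k] [CharZero k] in
theorem A1.zero_add : (A1.zero k ▷ A1 k) ≫ A1.add k = (λ_ (A1 k)).hom := by
  rw [A1.add, A1.comp_ofFun]
  refine A1.hom_ext ?_
  rw [A1.pb_ofFun]
  change pb _ (pb _ _ + pb _ _) = _
  rw [map_add, ← pb_comp, ← pb_comp, whiskerRight_fst, whiskerRight_snd, pb_comp, A1.zero,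
    A1.pb_ofFun, map_zero, _root_.zero_add, leftUnitor_hom]

omit [CharZero k] [NeZero n] in
theorem addProd_originVar_iso (A : EqVar (A1 k) (rootsOfUnity n k)) :
    (addProd (originVar k n) A).Iso (A.res (MonoidHom.snd _ _)) := by
  refine ⟨λ_ A.X, ?_, fun g => ?_⟩
  · change (λ_ A.X).hom ≫ A.p = (A1.zero k ⊗ₘ A.p) ≫ A1.add k
    rw [tensorHom_def', Category.assoc, A1.zero_add, leftUnitor_naturality]
  · change (𝟙 _ ⊗ₘ A.act g.2) ≫ (λ_ A.X).hom = _
    simp only [id_tensorHom, leftUnitor_naturality]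
    rfl

omit [CharZero k] [NeZero n] in
theorem starProduct_mk {Ψ : K0 (A1 k) (RootPair n k) →ₗ[K0Var k] K0 (A1 k) (rootsOfUnity n k)}
    (A B : EqVar (A1 k) (rootsOfUnity n k)) :
    starProduct Ψ (K0.mk A) (K0.mk B) = Ψ (K0.mk (addProd A B)) := by
  change Ψ (K0.push (A1.add k) (K0.prod (K0.mk A) (K0.mk B))) = _
  rw [K0.prod_mk, K0.push_mk]

end unit

/-! ### Associativity -/

section assoc

variable {k : Type u} [Field k]

theorem A1.pb_lift_add {X : Sch k} (f g : X ⟶ A1 k) :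
    pb (lift f g ≫ A1.add k) (A1.coord k) = pb f (A1.coord k) + pb g (A1.coord k) := by
  rw [A1.add, A1.comp_ofFun, A1.pb_ofFun]
  change pb _ (pb _ _ + pb _ _) = _
  rw [map_add, ← pb_comp, ← pb_comp, lift_fst, lift_snd]

theorem A1.add_reverse {X Y Z : Sch k} (a : X ⟶ A1 k) (b : Y ⟶ A1 k) (c : Z ⟶ A1 k) :
    lift (lift (snd (X ⊗ Y) Z) (fst (X ⊗ Y) Z ≫ snd X Y)) (fst (X ⊗ Y) Z ≫ fst X Y) ≫
      (((c ⊗ₘ b) ≫ A1.add k) ⊗ₘ a) ≫ A1.add k =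
    (((a ⊗ₘ b) ≫ A1.add k) ⊗ₘ c) ≫ A1.add k := by
  have e {P Q : Sch k} (f : P ⟶ A1 k) (g : Q ⟶ A1 k) :
      f ⊗ₘ g = lift (fst P Q ≫ f) (snd P Q ≫ g) := by ext <;> simp
  refine A1.hom_ext ?_
  rw [lift_map_assoc, A1.pb_lift_add, lift_map_assoc, A1.pb_lift_add, e _ c, A1.pb_lift_add, e a b,
    comp_lift_assoc, A1.pb_lift_add, Category.assoc, Category.assoc]
  abel

variable [IsAlgClosed k] {n : ℕ}

variable (k n) in
/-- The morphism `(g, q) ↦ (g, g⁻¹ q)`, with `q` on the diagonal. -/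
def tripleHom : RootTriple n k × rootsOfUnity n k →* RootTriple n k × RootTriple n k where
  toFun x := (x.1, ((x.1.1.1⁻¹ * x.2, x.1.1.2⁻¹ * x.2), x.1.2⁻¹ * x.2))
  map_one' := by simp
  map_mul' x y := by ext <;> simp <;> ring

variable (k n) in
/-- The reversal of the factors. -/
abbrev rootReverse : RootTriple n k →* RootTriple n k :=
  ((MonoidHom.snd _ _).prod ((MonoidHom.snd _ _).comp (MonoidHom.fst _ _))).prod
    ((MonoidHom.fst _ _).comp (MonoidHom.fst _ _))

variable [CharZero k] [NeZero n] {S : Sch k}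

/-- The class of the quotient of `V × X` by the group `μ_n³`. -/
abbrev tripleClass (V : EqVar S (RootTriple n k)) (X : EqVar (𝟙_ (Sch k)) (RootTriple n k)) :
    K0 S (rootsOfUnity n k) :=
  quo (MonoidHom.snd (RootTriple n k) _) (surjective_snd _ _) (tw (tripleHom k n) V X)

theorem tripleClass_reverse (V : EqVar S (RootTriple n k))
    {X : EqVar (𝟙_ (Sch k)) (RootTriple n k)} (h : X.Iso (X.res (rootReverse k n))) :
    tripleClass (V.res (rootReverse k n)) X = tripleClass V X := by
  rw [tripleClass, tripleClass, quo_iso _ (tw_iso_right _ _ h),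
    ← quo_res (surjective_snd _ _) (tw (tripleHom k n) V X) (MonoidHom.snd _ _)
      (surjective_snd _ _) ((rootReverse k n).prodMap (MonoidHom.id _)) (fun _ => rfl)
      fun x hx => ⟨(((x.1.2, x.1.1.2), x.1.1.1), x.2), hx, rfl⟩]
  refine quo_iso _ ⟨Iso.refl _, ⟨Category.id_comp _, fun g => ?_⟩⟩
  rw [Iso.refl_hom, Category.id_comp, Category.comp_id]
  rfl

theorem fermatSurface_reverse_iso (c : k) :
    (fermatSurface n c).Iso ((fermatSurface n c).res (rootReverse k n)) := by
  refine (torusAct_fermatSurface n c).iso ((torusAct_fermatSurface n c).res (rootReverse k n))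
    (Equiv.swap 0 2) (fun i => ?_) fun R _ φ x => ?_
  · fin_cases i <;> rfl
  · have h : Equiv.swap (0 : Fin 3) 2 1 = 1 := by decide
    rw [eqT_iff, eqT_iff, Equiv.swap_apply_left, Equiv.swap_apply_right, h]
    refine Eq.congr_left ?_
    ring

omit [CharZero k] [NeZero n] in
theorem addProd_reverse_iso (A B C : EqVar (A1 k) (rootsOfUnity n k)) :
    (addProd (addProd A B) C).Iso ((addProd (addProd C B) A).res (rootReverse k n)) := by
  refine ⟨⟨lift (lift (snd _ _) (fst _ _ ≫ snd _ _)) (fst _ _ ≫ fst _ _),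
    lift (lift (snd _ _) (fst _ _ ≫ snd _ _)) (fst _ _ ≫ fst _ _), ?_, ?_⟩, ?_, fun g => ?_⟩
  · ext <;> simp
  · ext <;> simp
  · exact A1.add_reverse A.p B.p C.p
  · ext <;> simp

variable {c d : k}

/-- An iterated balanced product as the quotient of a triple product. -/
theorem balClass_addProd {W : EqVar (A1 k) (RootPair n k)} {Q : EqVar (A1 k) (rootsOfUnity n k)}
    {F F' : EqVar (𝟙_ (Sch k)) (RootPair n k)} {D : EqVar (𝟙_ (Sch k)) (RootTriple n k)}
    (hD : IsQuot (rootMul n k) ((F.prod F').push (λ_ (𝟙_ (Sch k))).hom) D)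
    (hQ : IsQuot (MonoidHom.snd (RootPair n k) _) (tw (balHom k n) W F) Q)
    (C : EqVar (A1 k) (rootsOfUnity n k)) :
    quo (MonoidHom.snd (RootPair n k) _) (surjective_snd _ _)
      (tw (balHom k n) (addProd Q C) F') = tripleClass (addProd W C) D := by
  -- Both sides are quotients of `W × F × C × F'` by a group with elements `s, t, a, u, q`: `a`
  -- moves `F` and `F'` in opposite senses, and `q` is the residual parameter. Dividing by `s, t`
  -- first yields the iterated balanced product.
  let ρ : (RootTriple n k × rootsOfUnity n k) × rootsOfUnity n k →* RootTriple n k :=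
    ((MonoidHom.snd _ _).prodMap (MonoidHom.id _)).prodMap (MonoidHom.id _)
  let φ : (RootTriple n k × rootsOfUnity n k) × rootsOfUnity n k →*
      (RootTriple n k × rootsOfUnity n k) × RootPair n k :=
    (MonoidHom.fst _ _).prod ((MonoidHom.snd _ _).comp ((balHom k n).comp ρ))
  have h1 : IsQuot ρ (tw φ (addProd (tw (balHom k n) W F) C) F')
      (tw (balHom k n) (addProd Q C) F') := by
    refine isQuot_tw_left ((hQ.prod C).push _) F' φ _ ρ (fun _ => rfl) ?_
    rintro ⟨⟨g, a⟩, u⟩ hg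
    obtain ⟨ha, hu⟩ := Prod.ext_iff.1 hg
    change a = 1 at ha
    change u = 1 at hu
    subst ha hu
    exact ⟨(((g, 1), 1), 1), rfl, by simp [φ, ρ, balHom]⟩
  rw [← quo_comp (fun x => ⟨(((1, x.1.1), x.1.2), x.2), rfl⟩) h1 _ (surjective_snd _ _)
    (MonoidHom.snd _ _) (surjective_snd _ _) fun _ => rfl]
  -- Dividing by `a` first affects only `F × F'`, whose quotient is `D`; what remains is the triple
  -- quotient.
  let ρ' : (RootTriple n k × rootsOfUnity n k) × rootsOfUnity n k →*
      RootTriple n k × rootsOfUnity n k :=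
    ((MonoidHom.fst _ _).prodMap (MonoidHom.id _)).prodMap (MonoidHom.id _)
  let φ' : (RootTriple n k × rootsOfUnity n k) × rootsOfUnity n k →*
      RootTriple n k × (RootPair n k × RootPair n k) :=
    ((MonoidHom.fst _ _).comp ρ').prod
      (((MonoidHom.snd _ _).comp ((balHom k n).comp
        ((MonoidHom.fst _ _).comp (MonoidHom.fst _ _)))).prod
          ((MonoidHom.snd _ _).comp ((balHom k n).comp ρ)))
  have h2 : IsQuot ρ' (tw φ' (addProd W C) ((F.prod F').push (λ_ (𝟙_ (Sch k))).hom))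
      (tw (tripleHom k n) (addProd W C) D) := by
    refine isQuot_tw_right _ hD φ' _ ρ' (fun x => ?_) ?_
    · obtain ⟨⟨⟨⟨s, t⟩, a⟩, u⟩, q⟩ := x
      simp [φ', ρ', ρ, balHom, tripleHom, rootMul, mul_assoc]
    · rintro ⟨⟨x, y⟩, z, w⟩ hx
      obtain ⟨h, hw⟩ := Prod.ext_iff.1 hx
      obtain ⟨hx, hy⟩ := Prod.ext_iff.1 h
      change x * z = 1 at hx
      change y * z = 1 at hy
      change w = 1 at hw
      obtain rfl := mul_eq_one_iff_eq_inv.1 hx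
      obtain rfl := mul_eq_one_iff_eq_inv.1 hy
      subst hw
      exact ⟨((((1, 1), z⁻¹), 1), 1), rfl, by simp [φ', ρ', ρ, balHom]⟩
  rw [tripleClass, ← quo_comp (fun x => ⟨(((x.1.1, 1), x.1.2), x.2), rfl⟩) h2 _
    (surjective_snd _ _) (MonoidHom.snd _ _) (surjective_snd _ _) fun _ => rfl]
  refine quo_iso _ ⟨⟨
    lift (lift (fst _ _ ≫ fst _ _ ≫ fst _ _) (fst _ _ ≫ snd _ _))
      (lift (fst _ _ ≫ fst _ _ ≫ snd _ _) (snd _ _)),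
    lift (lift (lift (fst _ _ ≫ fst _ _) (snd _ _ ≫ fst _ _)) (fst _ _ ≫ snd _ _))
      (snd _ _ ≫ snd _ _), ?_, ?_⟩, ?_, fun g => ?_⟩
  · ext <;> simp
  · ext <;> simp
  · change _ ≫ (((W.p ⊗ₘ C.p) ≫ A1.add k) ⊗ₘ _) ≫ (ρ_ _).hom =
      (((((W.p ⊗ₘ F.p) ≫ (ρ_ _).hom) ⊗ₘ C.p) ≫ A1.add k) ⊗ₘ F'.p) ≫ (ρ_ _).hom
    have e : lift (fst ((W.X ⊗ F.X) ⊗ C.X) F'.X ≫ fst (W.X ⊗ F.X) C.X ≫ fst W.X F.X)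
        (fst ((W.X ⊗ F.X) ⊗ C.X) F'.X ≫ snd (W.X ⊗ F.X) C.X) ≫ (W.p ⊗ₘ C.p) =
        fst ((W.X ⊗ F.X) ⊗ C.X) F'.X ≫ ((fst W.X F.X ≫ W.p) ⊗ₘ C.p) := by
      ext <;> simp
    simp only [rightUnitor_hom, tensorHom_fst]
    rw [lift_fst_assoc, reassoc_of% e]
  · obtain ⟨⟨⟨⟨s, t⟩, a⟩, u⟩, q⟩ := g
    change (((W.act (s, t) ⊗ₘ F.act (s⁻¹ * a, t⁻¹ * a)) ⊗ₘ C.act u) ⊗ₘ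
      F'.act (a⁻¹ * q, u⁻¹ * q)) ≫ lift (lift _ _) (lift _ _) = lift (lift _ _) (lift _ _) ≫
        ((W.act (s, t) ⊗ₘ C.act u) ⊗ₘ (F.act (s⁻¹ * a, t⁻¹ * a) ⊗ₘ F'.act (a⁻¹ * q, u⁻¹ * q)))
    ext <;> simp

/-- The left side is the alternating sum of the classes for `fermatComp n c d` with `c, d` in {0,
1}. Rewriting `c = 1` by the surface and `c = 0` by the variety independent of `d`, the terms of
`fermatZeroRoot` cancel and only the two symmetric surfaces remain. -/
theorem psi_addProd {W : EqVar (A1 k) (RootPair n k)} {Q₁ Q₀ : EqVar (A1 k) (rootsOfUnity n k)}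
    (h₁ : IsQuot (MonoidHom.snd (RootPair n k) _) (bal n 1 W) Q₁)
    (h₀ : IsQuot (MonoidHom.snd (RootPair n k) _) (bal n 0 W) Q₀)
    (C : EqVar (A1 k) (rootsOfUnity n k)) :
    -psi _ n (K0.mk (addProd Q₁ C)) + psi _ n (K0.mk (addProd Q₀ C)) =
      tripleClass (addProd W C) (fermatSurface n 1) -
        tripleClass (addProd W C) (fermatSurface n 0) := by
  have h (d : k) : tripleClass (addProd W C) (fermatSurface n d) = tripleClass (addProd W C)
      (fermatComp n 1 d) + tripleClass (addProd W C) (fermatZeroRoot n d) :=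
    quo_tw_scissor _ _ _ (fermatSurface_isScissor n d)
  have h' (d : k) : tripleClass (addProd W C) (fermatZeroGm k n) = tripleClass (addProd W C)
      (fermatComp n 0 d) + tripleClass (addProd W C) (fermatZeroRoot n d) :=
    quo_tw_scissor _ _ _ (fermatZeroGm_isScissor n d)
  have e₁ (d : k) : balClass n d (addProd Q₁ C) = _ :=
    balClass_addProd (isQuot_fermatComp n 1 d) h₁ C
  have e₀ (d : k) : balClass n d (addProd Q₀ C) = _ :=
    balClass_addProd (isQuot_fermatComp n 0 d) h₀ C
  rw [psi_mk, psi_mk, e₁, e₁, e₀, e₀, h, h]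
  have := (h' 0).symm.trans (h' 1)
  rw [eq_sub_of_add_eq this]
  abel

theorem star_star (A B C : EqVar (A1 k) (rootsOfUnity n k)) :
    starProduct (psi _ n) (starProduct (psi _ n) (K0.mk A) (K0.mk B)) (K0.mk C) =
      tripleClass (addProd (addProd A B) C) (fermatSurface n 1) -
        tripleClass (addProd (addProd A B) C) (fermatSurface n 0) := by
  obtain ⟨Q₁, h₁⟩ := exists_isBalancedProduct n (1 : k) (addProd A B)
  obtain ⟨Q₀, h₀⟩ := exists_isBalancedProduct n (0 : k) (addProd A B)
  rw [starProduct_mk, isPsi_psi _ _ _ h₁ h₀, map_add, map_neg, LinearMap.add_apply,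
    LinearMap.neg_apply, starProduct_mk, starProduct_mk]
  exact psi_addProd ((isBalancedProduct_iff ..).1 h₁) ((isBalancedProduct_iff ..).1 h₀) C

/-- By `star_star` the triple product involves only the surfaces `xⁿ + yⁿ + vⁿ = c`, and these are
preserved by exchanging `x` and `v`. -/
theorem star_star_reverse (A B C : EqVar (A1 k) (rootsOfUnity n k)) :
    starProduct (psi _ n) (starProduct (psi _ n) (K0.mk A) (K0.mk B)) (K0.mk C) =
      starProduct (psi _ n) (starProduct (psi _ n) (K0.mk C) (K0.mk B)) (K0.mk A) := by
  have h (c : k) : tripleClass (addProd (addProd A B) C) (fermatSurface n c) =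
      tripleClass (addProd (addProd C B) A) (fermatSurface n c) := by
    rw [tripleClass, quo_iso _ (tw_iso_left _ (addProd_reverse_iso A B C) _)]
    exact tripleClass_reverse _ (fermatSurface_reverse_iso c)
  rw [star_star, star_star, h, h]

theorem star_comm (a b : K0 (A1 k) (rootsOfUnity n k)) :
    starProduct (psi _ n) a b = starProduct (psi _ n) b a := by
  induction a using K0.induction with
  | zero => simp
  | add x y hx hy => simp only [map_add, LinearMap.add_apply, hx, hy]
  | neg x hx => simp only [map_neg, LinearMap.neg_apply, hx]
  | mk A =>
  induction b using K0.induction with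
  | zero => simp
  | add x y hx hy => simp only [map_add, LinearMap.add_apply, hx, hy]
  | neg x hx => simp only [map_neg, LinearMap.neg_apply, hx]
  | mk B =>
  rw [starProduct_mk, starProduct_mk, psi_mk, psi_mk, balClass_comm 1 A B, balClass_comm 0 A B]

/-- Commutativity turns the right side into `(c ★ b) ★ a`, which reduces the claim to the reversal
symmetry on generators. -/
theorem star_assoc (a b c : K0 (A1 k) (rootsOfUnity n k)) :
    starProduct (psi _ n) (starProduct (psi _ n) a b) c =
      starProduct (psi _ n) a (starProduct (psi _ n) b c) := by
  rw [star_comm a (starProduct _ b c), star_comm b c]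
  induction a using K0.induction with
  | zero => simp
  | add x y hx hy => simp only [map_add, LinearMap.add_apply, hx, hy]
  | neg x hx => simp only [map_neg, LinearMap.neg_apply, hx]
  | mk A =>
  induction b using K0.induction with
  | zero => simp
  | add x y hx hy => simp only [map_add, LinearMap.add_apply, hx, hy]
  | neg x hx => simp only [map_neg, LinearMap.neg_apply, hx]
  | mk B =>
  induction c using K0.induction with
  | zero => simp
  | add x y hx hy => simp only [map_add, LinearMap.add_apply, hx, hy]
  | neg x hx => simp only [map_neg, LinearMap.neg_apply, hx]
  | mk C => exact star_star_reverse A B C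

theorem originVar_star (a : K0 (A1 k) (rootsOfUnity n k)) :
    starProduct (psi _ n) (K0.mk (originVar k n)) a = a := by
  induction a using K0.induction with
  | zero => simp
  | add x y hx hy => rw [map_add, hx, hy]
  | neg x hx => rw [map_neg, hx]
  | mk A => rw [starProduct_mk, K0.mk_iso (addProd_originVar_iso A), psi_res_snd]

/-- The exterior sum of varieties with trivial actions again has trivial action; in particular the
action is restricted along the second projection, and `psi_res_snd` removes Ψ. -/
theorem star_trivialAction (X Y : EqVar (A1 k) Unit) :
    starProduct (psi _ n) (trivialAction k n (K0.mk X)) (trivialAction k n (K0.mk Y)) =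
      trivialAction k n (K0.mk (thomSebastiani X Y)) := by
  rw [trivialAction, K0.res_mk, K0.res_mk, K0.res_mk, starProduct_mk]
  have h : (addProd (X.res (1 : rootsOfUnity n k →* Unit)) (Y.res 1)).Iso
      (((thomSebastiani X Y).res (1 : rootsOfUnity n k →* Unit)).res (MonoidHom.snd _ _)) :=
    ⟨Iso.refl _, ⟨Category.id_comp _, fun _ => (Category.comp_id _).trans (Category.id_comp _).symm⟩⟩
  rw [K0.mk_iso h, psi_res_snd]

omit [IsAlgClosed k] [CharZero k] [NeZero n] in
theorem bijective_trivialAction (hn : n = 1) : Function.Bijective (trivialAction k n) := by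
  subst hn
  have hs : Subsingleton (rootsOfUnity 1 k) := by
    rw [rootsOfUnity_one]
    infer_instance
  have h1 : (K0.res (S := A1 k) (1 : Unit →* rootsOfUnity 1 k)).comp (trivialAction k 1) =
      .id _ := by
    refine K0.hom_ext fun A => ?_
    rw [AddMonoidHom.comp_apply, AddMonoidHom.id_apply, trivialAction, K0.res_mk, K0.res_mk]
  have h2 : (trivialAction k 1).comp (K0.res (S := A1 k) (1 : Unit →* rootsOfUnity 1 k)) =
      .id _ := by
    refine K0.hom_ext fun A => ?_
    rw [AddMonoidHom.comp_apply, AddMonoidHom.id_apply, trivialAction, K0.res_mk, K0.res_mk]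
    refine K0.mk_iso ⟨Iso.refl _, ⟨Category.id_comp _, fun g => ?_⟩⟩
    rw [Subsingleton.elim g 1]
    exact (Category.comp_id _).trans (Category.id_comp _).symm
  exact Function.bijective_iff_has_inverse.2
    ⟨K0.res 1, fun x => congr($h1 x), fun x => congr($h2 x)⟩

end assoc

end

end MotConv

open MotConv

theorem propositionp {k : Type u} [Field k] [IsAlgClosed k] [CharZero k] (n : ℕ) (hn : 0 < n) :
    -- the balanced products exist
    (∀ (Z : EqVar (A1 k) (rootsOfUnity n k × rootsOfUnity n k)) (c : k),
      c = 1 ∨ c = 0 → ∃ Q, IsBalancedProduct n c Z Q) ∧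
    -- the morphism `Ψ` is well defined
    (∃! Ψ : K0 (A1 k) (rootsOfUnity n k × rootsOfUnity n k) →ₗ[K0Var k]
      K0 (A1 k) (rootsOfUnity n k), IsPsi n Ψ) ∧
    ∀ Ψ : K0 (A1 k) (rootsOfUnity n k × rootsOfUnity n k) →ₗ[K0Var k]
      K0 (A1 k) (rootsOfUnity n k), IsPsi n Ψ →
      -- the `K₀(Var_k)`-bilinear product is associative, commutative and unital
      (∀ a b c, starProduct Ψ (starProduct Ψ a b) c =
        starProduct Ψ a (starProduct Ψ b c)) ∧
      (∀ a b, starProduct Ψ a b = starProduct Ψ b a) ∧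
      (∀ a, starProduct Ψ (K0.mk (originVar k n)) a = a) ∧
      -- on `K₀(Var_{𝔸¹})` it is the Thom-Sebastiani product
      (∀ X Y : EqVar (A1 k) Unit,
        starProduct Ψ (trivialAction k n (K0.mk X))
          (trivialAction k n (K0.mk Y)) =
        trivialAction k n (K0.mk (thomSebastiani X Y))) ∧
      (n = 1 → Function.Bijective (trivialAction k n)) := by
  have : NeZero n := ⟨hn.ne'⟩
  refine ⟨fun Z c _ => exists_isBalancedProduct n c Z, ⟨psi _ n, isPsi_psi, fun Ψ h => h.eq_psi⟩,
    fun Ψ h => ?_⟩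
  obtain rfl := h.eq_psi
  exact ⟨star_assoc, star_comm, originVar_star, star_trivialAction, bijective_trivialAction⟩
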